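/- **Setting.** Let $\operatorname{Im}\tau>0$ and $\theta_{ab}(z;\tau)=\sum_{m\in\mathbb Z}\exp\bigl(\pi i(\tfrac a2+m)^2\tau+2\pi i(\tfrac a2+m)(\tfrac b2+z)\bigr)$, $\theta_{ab}(z)=\theta_{ab}(z;\tau)$. Let $\eta=r'/r$ with coprime integers $r'$ and $r\ge 1$ and $\theta_{11}(2\eta)\ne0$ (i.e. $2\eta\notin\mathbb Z$). Let $\kappa,c\in\mathbb C$, and let $\overset{\circ}{\lambda}\in\mathbb C$ be such that $\lambda_a:=\overset{\circ}{\lambda}+2a\eta$ satisfies $\theta_{11}(\lambda_a)\neq 0$ for all $a\in\mathbb Z$. Let $l_1,\dots,l_N\in\frac12\mathbb Z_{\ge0}$. *State space.* $V^l$ is the space of entire functions $f$ with $f(y+1)=f(-y)=f(y)$ and $f(y+\tau)=e^{-4l\pi i(2y+\tau)}f(y)$, and $\mathcal H=V^{l_1}\otimes\dots\otimes V^{l_N}$. *Intertwining vectors.* Write $\theta_{10}(y\pm x)$ for $\theta_{10}(y+x)\theta_{10}(y-x)$. For $\lambda'-\lambda=4m\eta$ with $m\in\{-l,-l+1,\dots,l\}$,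 $\phi^{(l)}_{\lambda,\lambda'}(u)\in V^l$ is the function $$y\mapsto\prod_{j=1}^{l+m}\theta_{10}\Bigl(y\pm\bigl(\tfrac{\lambda-u}2+(2j-l-1)\eta\bigr)\Bigr)\prod_{j=1}^{l-m}\theta_{10}\Bigl(y\pm\bigl(\tfrac{\lambda'+u}2+(2j-l-1)\eta\bigr)\Bigr).$$ *Bethe vectors.* For integers $a_0,\dots,a_N$ with $a_{j-1}-a_j\in\{-2l_j,-2l_j+2,\dots,2l_j\}$ put $|\vec a;\vec z\rangle=\phi^{(l_1)}_{\lambda_{a_0},\lambda_{a_1}}(z_1)\otimes\dots\otimes\phi^{(l_N)}_{\lambda_{a_{N-1}},\lambda_{a_N}}(z_N)$. The space of Bethe vectors $\mathfrak B^{l_1,\dots,l_N}_{z_1,\dots,z_N}$ is the span of the functions $\mathbb Z/r\mathbb Z\to\mathcal H$, $\nu\mapsto e^{2\pi i a_0\nu\eta}|\vec a;\vec z\rangle$, over all such $\vec a$ with $a_0=a_N\in\{0,\dots,r-1\}$. *$R$ matrices.* Let $\sigma^0=1$ and let $\sigma^1,\sigma^2,\sigma^3$ be the Pauli matrices. On $\mathbb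 C^2\otimes\mathbb C^2$ put $$R^{\frac12,\frac12}(u)=\frac{\theta_{11}(2\eta)}{\theta_{11}(u+2\eta)}\sum_{a=0}^3\frac{\vartheta_a(u+\eta)}{2\vartheta_a(\eta)}\,\sigma^a\otimes\sigma^a,\qquad(\vartheta_0,\vartheta_1,\vartheta_2,\vartheta_3)=(\theta_{11},\theta_{10},\theta_{00},\theta_{01}).$$ Identify $\mathbb C^2$ with $V^{1/2}$ by sending the standard basis to $\theta_{00}(2y;2\tau)\mp\theta_{10}(2y;2\tau)$, and let $(\mathbb C^2)^{\otimes 2l}\to V^l$ be the multiplication of functions, which is onto. The fused matrix $R^{l,l'}(u)\in\operatorname{End}(V^l\otimes V^{l'})$ is the operator induced, with $n=2l$, $n'=2l'$, by $$(R_{1,n'}R_{2,n'}\cdots R_{n,n'})\cdots(R_{1,1}R_{2,1}\cdots R_{n,1}),\qquad R_{x,y}=R^{\frac12,\frac12}_{x,y}\bigl(u+(n-n'-2x+2y)\eta\bigr),$$ on $(\mathbb C^2)^{\otimes n}\otimes(\mathbb C^2)^{\otimes n'}$, where $R_{x,y}$ acts on the $x$-th copy of $\mathbb C^2$ in the first block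 and the $y$-th copy in the second. $R^{l_j,l_k}_{j,k}(u)$ denotes its action on the factors $V^{l_j}$ and $V^{l_k}$ of $\mathcal H$ (and, pointwise, on functions $\mathbb Z/r\mathbb Z\to\mathcal H$). *Boundary operator.* $Z^{l_1,\dots,l_N}_{z_1,\dots,z_N}:\mathfrak B^{l_1,\dots,l_N}_{z_1,\dots,z_N}\to\mathfrak B^{l_N,l_1,\dots,l_{N-1}}_{z_N+\kappa,z_1,\dots,z_{N-1}}$ is the linear map with $$e^{2\pi i a_N\nu\eta}|a_0,\dots,a_N;z_1,\dots,z_N\rangle\mapsto e^{2\pi i a_{N-1}\nu\eta}e^{c(a_N-a_{N-1}-2l_N)}|a_{N-1},a_0,\dots,a_{N-1};z_N+\kappa,z_1,\dots,z_{N-1}\rangle .$$ Let $Z^{(j)}$ be $Z^{l_1,\dots,l_{j-1},l_{j+1},\dots,l_N,l_j}_{z_1,\dots,z_{j-1},z_{j+1},\dots,z_N,z_j}$ conjugated by the permutations of tensor factors that move the $j$-th factor to the last place before, and from the first place back to the $j$-th place after, the application of $Z$. With $\vec z_j=(z_1,\dots,z_j+\kappa,\dots,z_N)$, define $$A_j(\vec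 z)=R^{l_j,l_{j-1}}_{j,j-1}(z_j+\kappa-z_{j-1})\cdots R^{l_j,l_1}_{j,1}(z_j+\kappa-z_1)\,Z^{(j)}\,R^{l_j,l_N}_{j,N}(z_j-z_N)\cdots R^{l_j,l_{j+1}}_{j,j+1}(z_j-z_{j+1}).$$ Call $\vec z\in\mathbb C^N$ *regular* if $\theta_{11}(z_i+m\eta)\ne0$ and $\theta_{11}(z_i-z_k+m\eta)\neq0$ for all $m\in\mathbb Z$ and all $i\ne k$. **Proposition.** 1. If $\vec z$ is regular, then the functions $e^{2\pi i a_0\nu\eta}|\vec a;\vec z\rangle$ above form a basis of $\mathfrak B^{l_1,\dots,l_N}_{z_1,\dots,z_N}$, and the operators $Z^{(j)}$ are well defined. 2. If $\vec z$ and $\vec z_j$ are regular, then $A_j(\vec z)$ is a linear isomorphism of $\mathfrak B^{l_1,\dots,l_N}_{z_1,\dots,z_N}$ onto $\mathfrak B^{l_1,\dots,l_N}_{z_1,\dots,z_j+\kappa,\dots,z_N}$. 3. The operators are compatible: if $\vec z,\vec z_j,\vec z_k$ and $(\vec z_k)_j$ are regular, then on $\mathfrak B^{l_1,\dots,l_N}_{z_1,\dots,z_N}$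 $$A_j(\vec z_k)A_k(\vec z)=A_k(\vec z_j)A_j(\vec z).$$ 4. Hence the system $f(\vec z_j)=A_j(\vec z)f(\vec z)$, $j=1,\dots,N$, for $f(\vec z)=\sum_{\vec a}f_{\vec a}(\vec z)\,e^{2\pi i a_0\nu\eta}|\vec a;\vec z\rangle$ is equivalent to a matrix difference system $F(\vec z_j)=M_j(\vec z)F(\vec z)$ for the vector $F=(f_{\vec a})_{\vec a}$ which is holonomic: the entries of $M_j$ are meromorphic (quotients $P/Q$ of entire functions on $\mathbb C^N$ with $Q(\vec z)\ne0$ whenever $\vec z$ and $\vec z_j$ are regular), $M_j(\vec z)$ is invertible whenever $\vec z$ and $\vec z_j$ are regular, and $M_j(\vec z_k)M_k(\vec z)=M_k(\vec z_j)M_j(\vec z)$ whenever $\vec z,\vec z_j,\vec z_k,(\vec z_k)_j$ are regular. -/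

import Mathlib

open scoped TensorProduct

noncomputable section

namespace EllipticQKZ

/-! ### Theta functions and the spaces `V^l` -/

/-- The theta function with characteristics
`θ_{ab}(z;τ) = ∑_{n ∈ ℤ} exp(πi (a/2+n)² τ + 2πi (a/2+n)(b/2+z))`. -/
def theta (a b : ℕ) (z τ : ℂ) : ℂ :=
  ∑' n : ℤ, Complex.exp
    (Real.pi * Complex.I * ((a : ℂ) / 2 + n) ^ 2 * τ
      + 2 * Real.pi * Complex.I * ((a : ℂ) / 2 + n) * ((b : ℂ) / 2 + z))

theorem theta_eq (a b : ℕ) (z τ : ℂ) :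
    theta a b z τ =
      Complex.exp (Real.pi * Complex.I * ((a : ℂ) / 2) ^ 2 * τ
        + 2 * Real.pi * Complex.I * ((a : ℂ) / 2) * ((b : ℂ) / 2 + z))
        * jacobiTheta₂ (z + (b : ℂ) / 2 + (a : ℂ) / 2 * τ) τ := by
  rw [theta, jacobiTheta₂, ← tsum_mul_left]
  refine tsum_congr fun n => ?_
  rw [jacobiTheta₂_term, ← Complex.exp_add]
  congr 1
  ring

/-- The space `V^l = Θ_{00}^{4l+}` with `n = 2l`: entire functions `f` with
`f(y+1) = f(-y) = f(y)` and `f(y+τ) = exp(-4lπi(2y+τ)) f(y)`. -/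
def thetaSpace (τ : UpperHalfPlane) (n : ℕ) : Submodule ℂ (ℂ → ℂ) where
  carrier := {f | Differentiable ℂ f ∧ (∀ y, f (y + 1) = f y) ∧ (∀ y, f (-y) = f y) ∧
    ∀ y, f (y + τ) =
      Complex.exp (-(2 * (n : ℂ) * Real.pi * Complex.I * (2 * y + τ))) * f y}
  add_mem' := by
    rintro f g ⟨hf, hf1, hf2, hf3⟩ ⟨hg, hg1, hg2, hg3⟩
    refine ⟨hf.add hg, fun y => ?_, fun y => ?_, fun y => ?_⟩
    · simp [hf1, hg1]
    · simp [hf2, hg2]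
    · simp only [Pi.add_apply, hf3, hg3]; ring
  zero_mem' := by
    refine ⟨differentiable_const 0, ?_, ?_, ?_⟩ <;> simp
  smul_mem' := by
    rintro c f ⟨hf, hf1, hf2, hf3⟩
    refine ⟨hf.const_smul c, fun y => ?_, fun y => ?_, fun y => ?_⟩
    · simp [hf1]
    · simp [hf2]
    · simp only [Pi.smul_apply, smul_eq_mul, hf3]; ring

theorem differentiable_theta (a b : ℕ) {τ : ℂ} (hτ : 0 < τ.im) :
    Differentiable ℂ fun z => theta a b z τ := by
  have h : (fun z => theta a b z τ) = fun z =>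
      Complex.exp (Real.pi * Complex.I * ((a : ℂ) / 2) ^ 2 * τ
        + 2 * Real.pi * Complex.I * ((a : ℂ) / 2) * ((b : ℂ) / 2 + z))
        * jacobiTheta₂ (z + (b : ℂ) / 2 + (a : ℂ) / 2 * τ) τ := by
    funext z; exact theta_eq a b z τ
  rw [h]
  have h2 : Differentiable ℂ fun z => jacobiTheta₂ z τ :=
    fun z => differentiableAt_jacobiTheta₂_fst z hτ
  have h3 : Differentiable ℂ
      fun z : ℂ => jacobiTheta₂ (z + (b : ℂ) / 2 + (a : ℂ) / 2 * τ) τ :=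
    h2.comp (by fun_prop : Differentiable ℂ fun z : ℂ => z + (b : ℂ) / 2 + (a : ℂ) / 2 * τ)
  exact (by fun_prop : Differentiable ℂ fun z : ℂ =>
    Complex.exp (Real.pi * Complex.I * ((a : ℂ) / 2) ^ 2 * τ
      + 2 * Real.pi * Complex.I * ((a : ℂ) / 2) * ((b : ℂ) / 2 + z))).mul h3

theorem theta_add_tau (a : ℕ) (z τ : ℂ) :
    theta a 0 (z + τ) τ =
      Complex.exp (-(Real.pi * Complex.I * (2 * z + τ))) * theta a 0 z τ := by
  rw [theta_eq, theta_eq]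
  have h : z + τ + ((0 : ℕ) : ℂ) / 2 + (a : ℂ) / 2 * τ
      = (z + ((0 : ℕ) : ℂ) / 2 + (a : ℂ) / 2 * τ) + τ := by ring
  rw [h, jacobiTheta₂_add_left', ← mul_assoc, ← mul_assoc, ← Complex.exp_add,
    ← Complex.exp_add]
  congr 2
  push_cast
  ring

theorem theta_neg (a : ℕ) (z τ : ℂ) : theta a 0 (-z) τ = theta a 0 z τ := by
  rw [theta, theta, ← (Equiv.subLeft (-(a : ℤ))).tsum_eq]
  refine tsum_congr fun n => ?_
  congr 1
  simp only [Equiv.subLeft_apply]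
  push_cast
  ring

theorem theta_zero_add_one (z τ : ℂ) : theta 0 0 (z + 1) τ = theta 0 0 z τ := by
  rw [theta_eq, theta_eq]
  have h : z + 1 + ((0 : ℕ) : ℂ) / 2 + ((0 : ℕ) : ℂ) / 2 * τ
      = (z + ((0 : ℕ) : ℂ) / 2 + ((0 : ℕ) : ℂ) / 2 * τ) + 1 := by ring
  rw [h, jacobiTheta₂_add_left]
  congr 2
  simp

theorem theta_one_add_one (z τ : ℂ) : theta 1 0 (z + 1) τ = -theta 1 0 z τ := by
  rw [theta_eq, theta_eq]
  have h : z + 1 + ((0 : ℕ) : ℂ) / 2 + ((1 : ℕ) : ℂ) / 2 * τ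
      = (z + ((0 : ℕ) : ℂ) / 2 + ((1 : ℕ) : ℂ) / 2 * τ) + 1 := by ring
  rw [h, jacobiTheta₂_add_left, ← neg_mul, ← neg_one_mul, ← Complex.exp_pi_mul_I,
    ← Complex.exp_add]
  congr 2
  push_cast
  ring

theorem theta_mul_mem (τ : UpperHalfPlane) (x : ℂ) :
    (fun y => theta 1 0 (y + x) τ * theta 1 0 (y - x) τ) ∈ thetaSpace τ 1 := by
  have hd := differentiable_theta 1 0 τ.im_pos
  refine ⟨?_, fun y => ?_, fun y => ?_, fun y => ?_⟩
  · exact (hd.comp (by fun_prop : Differentiable ℂ fun y : ℂ => y + x)).mul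
      (hd.comp (by fun_prop : Differentiable ℂ fun y : ℂ => y - x))
  · have h1 : y + 1 + x = (y + x) + 1 := by ring
    have h2 : y + 1 - x = (y - x) + 1 := by ring
    simp only [h1, h2, theta_one_add_one, neg_mul_neg]
  · have h1 : -y + x = -(y - x) := by ring
    have h2 : -y - x = -(y + x) := by ring
    simp only [h1, h2, theta_neg]
    ring
  · have h1 : y + (τ : ℂ) + x = (y + x) + τ := by ring
    have h2 : y + (τ : ℂ) - x = (y - x) + τ := by ring
    simp only [h1, h2, theta_add_tau]
    rw [mul_mul_mul_comm, ← Complex.exp_add]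
    congr 2
    push_cast
    ring

/-- The two functions `θ₀₀(2y;2τ) - θ₁₀(2y;2τ)` and `θ₀₀(2y;2τ) + θ₁₀(2y;2τ)`, the images of
the standard basis of `ℂ²` under the identification of `ℂ²` with `V^{1/2}`. -/
def halfBasis (τ : UpperHalfPlane) (i : Fin 2) (y : ℂ) : ℂ :=
  if i = 0 then theta 0 0 (2 * y) (2 * τ) - theta 1 0 (2 * y) (2 * τ)
  else theta 0 0 (2 * y) (2 * τ) + theta 1 0 (2 * y) (2 * τ)

theorem theta_double_mem (τ : UpperHalfPlane) (a : ℕ) (ha : a = 0 ∨ a = 1) :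
    (fun y => theta a 0 (2 * y) (2 * τ)) ∈ thetaSpace τ 1 := by
  have him : 0 < (2 * (τ : ℂ)).im := by simpa using τ.im_pos
  refine ⟨(differentiable_theta a 0 him).comp
    (by fun_prop : Differentiable ℂ fun y : ℂ => 2 * y), fun y => ?_, fun y => ?_, fun y => ?_⟩
  · have h1 : 2 * (y + 1) = (2 * y + 1) + 1 := by ring
    rcases ha with rfl | rfl
    · simp only [h1, theta_zero_add_one]
    · simp only [h1, theta_one_add_one, neg_neg]
  · simp only [mul_neg, theta_neg]
  · have h1 : 2 * (y + (τ : ℂ)) = 2 * y + 2 * τ := by ring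
    simp only [h1, theta_add_tau]
    congr 2
    push_cast
    ring

theorem halfBasis_mem (τ : UpperHalfPlane) (i : Fin 2) : halfBasis τ i ∈ thetaSpace τ 1 := by
  have h0 := theta_double_mem τ 0 (Or.inl rfl)
  have h1 := theta_double_mem τ 1 (Or.inr rfl)
  by_cases h : i = 0
  · have : halfBasis τ i = (fun y => theta 0 0 (2 * y) (2 * τ))
        - fun y => theta 1 0 (2 * y) (2 * τ) := by
      funext y; simp [halfBasis, h]
    rw [this]; exact sub_mem h0 h1
  · have : halfBasis τ i = (fun y => theta 0 0 (2 * y) (2 * τ))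
        + fun y => theta 1 0 (2 * y) (2 * τ) := by
      funext y; simp [halfBasis, h]
    rw [this]; exact add_mem h0 h1

theorem mul_mem_thetaSpace {τ : UpperHalfPlane} {m n : ℕ} {f g : ℂ → ℂ}
    (hf : f ∈ thetaSpace τ m) (hg : g ∈ thetaSpace τ n) :
    (fun y => f y * g y) ∈ thetaSpace τ (m + n) := by
  obtain ⟨hf, hf1, hf2, hf3⟩ := hf
  obtain ⟨hg, hg1, hg2, hg3⟩ := hg
  refine ⟨hf.mul hg, fun y => ?_, fun y => ?_, fun y => ?_⟩
  · simp only [hf1, hg1]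
  · simp only [hf2, hg2]
  · simp only [hf3, hg3]
    rw [mul_mul_mul_comm, ← Complex.exp_add]
    congr 2
    push_cast
    ring

theorem prod_mem_thetaSpace {ι : Type*} {τ : UpperHalfPlane} (s : Finset ι) (f : ι → ℂ → ℂ)
    (hf : ∀ i ∈ s, f i ∈ thetaSpace τ 1) : (fun y => ∏ i ∈ s, f i y) ∈ thetaSpace τ s.card := by
  classical
  induction s using Finset.induction_on with
  | empty =>
    refine ⟨?_, ?_, ?_, ?_⟩ <;> simp
  | insert i s hi ih =>
    simp only [Finset.prod_insert hi, Finset.card_insert_of_notMem hi, add_comm s.card]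
    exact mul_mem_thetaSpace (hf i (Finset.mem_insert_self i s))
      (ih fun k hk => hf k (Finset.mem_insert_of_mem hk))

/-! ### Parameters -/

/-- The fixed parameters: the modulus `τ`, the numerator `r'` and the denominator `r` of
`η = r'/r`, the reference height `lam`, the step `κ`, and `c`. -/
structure Params where
  τ : UpperHalfPlane
  r' : ℤ
  r : ℕ
  lam : ℂ
  κ : ℂ
  c : ℂ

/-- `η = r'/r`. -/
def Params.η (D : Params) : ℂ := (D.r' : ℂ) / (D.r : ℂ)

/-- `θ_{ab}(z) = θ_{ab}(z;τ)`. -/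
def Params.th (D : Params) (a b : ℕ) (z : ℂ) : ℂ := theta a b z D.τ

/-- The height `λ_a = λ° + 2aη` attached to an integer `a`. -/
def Params.height (D : Params) (a : ℤ) : ℂ := D.lam + 2 * (a : ℂ) * D.η

/-! ### Intertwining vectors and path vectors

A spin `l` is given by the natural number `n = 2l`. -/

/-- The function `φ^{(l)}_{λ,λ'}(u;y)`, where `λ' - λ = 4mη` and `k = l + m`. -/
def intVecFun (D : Params) (n : ℕ) (k : Fin (n + 1)) (lam lam' u y : ℂ) : ℂ :=
  (∏ j ∈ Finset.Icc 1 (k : ℕ),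
    (D.th 1 0 (y + ((lam - u) / 2 + (2 * (j : ℂ) - (n : ℂ) / 2 - 1) * D.η)) *
      D.th 1 0 (y - ((lam - u) / 2 + (2 * (j : ℂ) - (n : ℂ) / 2 - 1) * D.η)))) *
  ∏ j ∈ Finset.Icc 1 (n - (k : ℕ)),
    (D.th 1 0 (y + ((lam' + u) / 2 + (2 * (j : ℂ) - (n : ℂ) / 2 - 1) * D.η)) *
      D.th 1 0 (y - ((lam' + u) / 2 + (2 * (j : ℂ) - (n : ℂ) / 2 - 1) * D.η)))

theorem intVecFun_mem (D : Params) (n : ℕ) (k : Fin (n + 1)) (lam lam' u : ℂ) :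
    intVecFun D n k lam lam' u ∈ thetaSpace D.τ n := by
  have h1 := prod_mem_thetaSpace (τ := D.τ) (Finset.Icc 1 (k : ℕ))
    (fun j y => D.th 1 0 (y + ((lam - u) / 2 + (2 * (j : ℂ) - (n : ℂ) / 2 - 1) * D.η)) *
      D.th 1 0 (y - ((lam - u) / 2 + (2 * (j : ℂ) - (n : ℂ) / 2 - 1) * D.η)))
    (fun j _ => theta_mul_mem D.τ _)
  have h2 := prod_mem_thetaSpace (τ := D.τ) (Finset.Icc 1 (n - (k : ℕ)))
    (fun j y => D.th 1 0 (y + ((lam' + u) / 2 + (2 * (j : ℂ) - (n : ℂ) / 2 - 1) * D.η)) *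
      D.th 1 0 (y - ((lam' + u) / 2 + (2 * (j : ℂ) - (n : ℂ) / 2 - 1) * D.η)))
    (fun j _ => theta_mul_mem D.τ _)
  have h := mul_mem_thetaSpace h1 h2
  have hk : (Finset.Icc 1 (k : ℕ)).card + (Finset.Icc 1 (n - (k : ℕ))).card = n := by
    have := k.isLt
    simp only [Nat.card_Icc]
    omega
  rw [hk] at h
  exact h

/-- The intertwining vector `φ^{(l)}_{λ_a,λ_{a'}}(u) ∈ V^l` for integers `a`, `a'` with
`a' - a = 2m`, `m ∈ {-l, …, l}`; the number of factors of the first kind is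
`l + m = (2l + a' - a) / 2`. -/
def intVec (D : Params) (n : ℕ) (a a' : ℤ) (u : ℂ) : thetaSpace D.τ n :=
  ⟨intVecFun D n (Fin.ofNat (n + 1) (((n : ℤ) + a' - a) / 2).toNat) (D.height a) (D.height a') u,
    intVecFun_mem D n _ _ _ u⟩

/-- The state space `H = V^{l_1} ⊗ ⋯ ⊗ V^{l_N}`, with `n i = 2 l_i`. -/
abbrev StateSpace (D : Params) {N : ℕ} (n : Fin N → ℕ) : Type :=
  ⨂[ℂ] i, thetaSpace D.τ (n i)

/-- The space of all functions `ℤ/rℤ → H`. -/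
abbrev FunSpace (D : Params) {N : ℕ} (n : Fin N → ℕ) : Type :=
  ZMod D.r → StateSpace D n

/- The factors of the tensor product are labelled by `Fin N`, and a permutation `π` records the
order in which they are arranged: the factor with label `i` stands at the position `π i`. In this
way the spaces `𝔅^{l_{i_1}, …, l_{i_N}}_{z_{i_1}, …, z_{i_N}}` for all rearrangements
`i_1, …, i_N` of the labels live in functions with values in one and the same state space, and
the transpositions `P_{j,j+1}` of tensor factors become a mere change of `π`. -/

/-- Admissibility of `a_0, …, a_N`: if the factor `i` stands between `a_{p-1}` and `a_p`, then
`a_{p-1} - a_p ∈ {-2l_i, -2l_i + 2, …, 2l_i}`. -/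
def Admissible {N : ℕ} (n : Fin N → ℕ) (π : Equiv.Perm (Fin N)) (a : Fin (N + 1) → ℤ) : Prop :=
  ∀ i, ∃ k : ℕ, k ≤ n i ∧ a (π i).castSucc - a (π i).succ = 2 * (k : ℤ) - (n i : ℤ)

/-- The path vector `|a_0, …, a_N; z⟩` for the arrangement `π` of the factors. -/
def pathVec (D : Params) {N : ℕ} (n : Fin N → ℕ) (π : Equiv.Perm (Fin N)) (z : Fin N → ℂ)
    (a : Fin (N + 1) → ℤ) : StateSpace D n :=
  PiTensorProduct.tprod ℂ fun i => intVec D (n i) (a (π i).castSucc) (a (π i).succ) (z i)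

/-- The function `ν ↦ e^{2πi a_0 ν η} |a_0, …, a_N; z⟩`. -/
def pathFun (D : Params) {N : ℕ} (n : Fin N → ℕ) (π : Equiv.Perm (Fin N)) (z : Fin N → ℂ)
    (a : Fin (N + 1) → ℤ) : FunSpace D n :=
  fun ν => Complex.exp (2 * Real.pi * Complex.I * (a 0 : ℂ) * (ν.val : ℂ) * D.η) •
    pathVec D n π z a

/-- Closed admissible paths `(a_0, …, a_N)`, `a_0 = a_N ∈ {0, …, r-1}`. -/
def ClosedPath (D : Params) {N : ℕ} (n : Fin N → ℕ) (π : Equiv.Perm (Fin N)) : Type :=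
  {a : Fin (N + 1) → ℤ //
    Admissible n π a ∧ a 0 = a (Fin.last N) ∧ 0 ≤ a 0 ∧ a 0 < (D.r : ℤ)}

instance (D : Params) {N : ℕ} (n : Fin N → ℕ) (π : Equiv.Perm (Fin N)) :
    DecidableEq (ClosedPath D n π) :=
  inferInstanceAs (DecidableEq {a : Fin (N + 1) → ℤ //
    Admissible n π a ∧ a 0 = a (Fin.last N) ∧ 0 ≤ a 0 ∧ a 0 < (D.r : ℤ)})

theorem finite_closedPath (D : Params) {N : ℕ} (n : Fin N → ℕ) (π : Equiv.Perm (Fin N)) :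
    Finite (ClosedPath D n π) := by
  set S : ℤ := ∑ i, (n i : ℤ) with hS
  have hS0 : 0 ≤ S := Finset.sum_nonneg fun i _ => by positivity
  have key : ∀ a : ClosedPath D n π, ∀ p : Fin (N + 1), |a.1 p| ≤ (D.r : ℤ) + (p : ℤ) * S := by
    rintro ⟨a, ha, -, h0, hr⟩ p
    induction p using Fin.induction with
    | zero => simp only [Fin.val_zero, Nat.cast_zero, zero_mul, add_zero]
              rw [abs_le]; constructor <;> omega
    | succ p ih =>
      obtain ⟨k, hk, hak⟩ := ha (π.symm p)
      simp only [Equiv.apply_symm_apply] at hak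
      have hn : (n (π.symm p) : ℤ) ≤ S :=
        Finset.single_le_sum (f := fun i => (n i : ℤ)) (fun i _ => by positivity)
          (Finset.mem_univ _)
      have hk' : (k : ℤ) ≤ n (π.symm p) := by exact_mod_cast hk
      simp only [Fin.val_castSucc] at ih
      simp only [Fin.val_succ, Nat.cast_add, Nat.cast_one, add_mul, one_mul]
      rw [abs_le] at ih ⊢
      constructor <;> omega
  have hfin : {a : Fin (N + 1) → ℤ | ∀ p : Fin (N + 1),
      a p ∈ Set.Icc (-((D.r : ℤ) + (p : ℤ) * S)) ((D.r : ℤ) + (p : ℤ) * S)}.Finite :=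
    Set.Finite.pi' fun p => Set.finite_Icc _ _
  exact (hfin.subset fun a ha p => abs_le.mp (key ⟨a, ha⟩ p) :
    {a : Fin (N + 1) → ℤ | Admissible n π a ∧ a 0 = a (Fin.last N) ∧ 0 ≤ a 0 ∧
      a 0 < (D.r : ℤ)}.Finite)

instance (D : Params) {N : ℕ} (n : Fin N → ℕ) (π : Equiv.Perm (Fin N)) :
    Fintype (ClosedPath D n π) :=
  @Fintype.ofFinite _ (finite_closedPath D n π)

/-- The space of Bethe vectors for the arrangement `π`. For `π = 1` it is
`𝔅^{l_1, …, l_N}_{z_1, …, z_N}`. -/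
def bethe (D : Params) {N : ℕ} (n : Fin N → ℕ) (π : Equiv.Perm (Fin N)) (z : Fin N → ℂ) :
    Submodule ℂ (FunSpace D n) :=
  Submodule.span ℂ (Set.range fun a : ClosedPath D n π => pathFun D n π z a.1)

/-! ### Elliptic `R` matrices by fusion -/

/-- The Pauli matrices. -/
def pauli : Fin 4 → Matrix (Fin 2) (Fin 2) ℂ :=
  ![!![1, 0; 0, 1], !![0, 1; 1, 0], !![0, -Complex.I; Complex.I, 0], !![1, 0; 0, -1]]

/-- The functions `W_a^L(u)`, `a = 0, 1, 2, 3`. -/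
def WL (D : Params) (u : ℂ) : Fin 4 → ℂ :=
  ![D.th 1 1 u / (2 * D.th 1 1 (2 * D.η) * D.th 1 1 D.η),
    D.th 1 0 u / (2 * D.th 1 1 (2 * D.η) * D.th 1 0 D.η),
    D.th 0 0 u / (2 * D.th 1 1 (2 * D.η) * D.th 0 0 D.η),
    D.th 0 1 u / (2 * D.th 1 1 (2 * D.η) * D.th 0 1 D.η)]

/-- The coefficient of `σ^a ⊗ σ^a` in
`R^{1/2,1/2}(u) = θ₁₁(2η) / θ₁₁(u+2η) ∑_a W_a^R(u) σ^a ⊗ σ^a`, `W_a^R(u) = θ₁₁(2η) W_a^L(u+η)`. -/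
def rCoeff (D : Params) (u : ℂ) (a : Fin 4) : ℂ :=
  D.th 1 1 (2 * D.η) / D.th 1 1 (u + 2 * D.η) * (D.th 1 1 (2 * D.η) * WL D (u + D.η) a)

/-- `(ℂ²)^{⊗ n}`. -/
abbrev HalfTensor (n : ℕ) : Type := ⨂[ℂ] _ : Fin n, (Fin 2 → ℂ)

/-- The multiplication map `(V^{1/2})^{⊗ 2l} → V^l`, `f_1 ⊗ ⋯ ⊗ f_{2l} ↦ f_1 ⋯ f_{2l}`, where `ℂ²`
is identified with `V^{1/2}`. It realizes `V^l` as the quotient of `(ℂ²)^{⊗ 2l}` by the span of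
the tensors that are antisymmetric in two neighbouring factors. -/
def mulMap (τ : UpperHalfPlane) (n : ℕ) : HalfTensor n →ₗ[ℂ] thetaSpace τ n :=
  PiTensorProduct.lift
    { toFun := fun v => ⟨fun y => ∏ i, (v i 0 * halfBasis τ 0 y + v i 1 * halfBasis τ 1 y), by
        have h := prod_mem_thetaSpace (τ := τ) (Finset.univ : Finset (Fin n))
          (fun i y => v i 0 * halfBasis τ 0 y + v i 1 * halfBasis τ 1 y)
          (fun i _ => add_mem (Submodule.smul_mem _ (v i 0) (halfBasis_mem τ 0))
            (Submodule.smul_mem _ (v i 1) (halfBasis_mem τ 1)))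
        simpa using h⟩
      map_update_add' := by
        intro _ v i x x'
        apply Subtype.ext
        funext y
        have e : ∀ w : Fin 2 → ℂ, ∀ k ∈ Finset.univ.erase i,
            (Function.update v i w k 0 * halfBasis τ 0 y
              + Function.update v i w k 1 * halfBasis τ 1 y)
              = v k 0 * halfBasis τ 0 y + v k 1 * halfBasis τ 1 y := by
          intro w k hk
          rw [Function.update_of_ne (Finset.ne_of_mem_erase hk)]
        simp only [Submodule.coe_add, Pi.add_apply]
        have hi := Finset.mem_univ i
        rw [← Finset.mul_prod_erase _ _ hi, ← Finset.mul_prod_erase _ _ hi,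
          ← Finset.mul_prod_erase _ _ hi, Finset.prod_congr rfl (e _),
          Finset.prod_congr rfl (e _), Finset.prod_congr rfl (e _)]
        simp only [Function.update_self, Pi.add_apply]
        ring
      map_update_smul' := by
        intro _ v i c x
        apply Subtype.ext
        funext y
        have e : ∀ w : Fin 2 → ℂ, ∀ k ∈ Finset.univ.erase i,
            (Function.update v i w k 0 * halfBasis τ 0 y
              + Function.update v i w k 1 * halfBasis τ 1 y)
              = v k 0 * halfBasis τ 0 y + v k 1 * halfBasis τ 1 y := by
          intro w k hk
          rw [Function.update_of_ne (Finset.ne_of_mem_erase hk)]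
        simp only [Submodule.coe_smul, Pi.smul_apply, smul_eq_mul]
        have hi := Finset.mem_univ i
        rw [← Finset.mul_prod_erase _ _ hi, ← Finset.mul_prod_erase _ _ hi,
          Finset.prod_congr rfl (e _), Finset.prod_congr rfl (e _)]
        simp only [Function.update_self, Pi.smul_apply, smul_eq_mul]
        ring }

theorem exists_section {V W : Type*} [AddCommGroup V] [Module ℂ V] [AddCommGroup W] [Module ℂ W]
    (f : V →ₗ[ℂ] W) : ∃ g : W →ₗ[ℂ] V, ∀ v, f (g (f v)) = f v := by
  obtain ⟨g, hg⟩ := LinearMap.exists_rightInverse_of_surjective f.rangeRestrict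
    (LinearMap.range_rangeRestrict f)
  obtain ⟨g', hg'⟩ := LinearMap.exists_extend g
  refine ⟨g', fun v => ?_⟩
  have h1 : g' (f v) = g (f.rangeRestrict v) := LinearMap.congr_fun hg' (f.rangeRestrict v)
  have h2 : f.rangeRestrict (g (f.rangeRestrict v)) = f.rangeRestrict v :=
    LinearMap.congr_fun hg (f.rangeRestrict v)
  rw [h1]
  exact congrArg Subtype.val h2

/-- A linear section `V^l → (ℂ²)^{⊗ 2l}` of the multiplication map, which is onto. The fused
`R` matrix below does not depend on its choice, because the product of `R` matrices in its
definition preserves the kernel of the multiplication map. -/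
def mulSection (τ : UpperHalfPlane) (n : ℕ) : thetaSpace τ n →ₗ[ℂ] HalfTensor n :=
  (exists_section (mulMap τ n)).choose

/-- `(ℂ²)^{⊗ 2l_1} ⊗ ⋯ ⊗ (ℂ²)^{⊗ 2l_N}`. -/
abbrev BigSpace {N : ℕ} (n : Fin N → ℕ) : Type := ⨂[ℂ] i, HalfTensor (n i)

/-- The matrix `A` acting on the `x`-th copy of `ℂ²` in the block `j`. -/
def siteOp {N : ℕ} (n : Fin N → ℕ) (j : Fin N) (x : Fin (n j))
    (A : Matrix (Fin 2) (Fin 2) ℂ) : Module.End ℂ (BigSpace n) :=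
  PiTensorProduct.map (Function.update (fun _ => LinearMap.id) j
    (PiTensorProduct.map (Function.update (fun _ => LinearMap.id) x (Matrix.toLin' A))))

/-- `R^{1/2,1/2}(u)` acting on the `x`-th copy of `ℂ²` in the block `j` and on the `y`-th copy
of `ℂ²` in the block `k`, for `j ≠ k`. -/
def halfR (D : Params) {N : ℕ} (n : Fin N → ℕ) (j k : Fin N) (x : Fin (n j)) (y : Fin (n k))
    (u : ℂ) : Module.End ℂ (BigSpace n) :=
  ∑ a, rCoeff D u a • (siteOp n j x (pauli a) * siteOp n k y (pauli a))

/-- The ordered product, with `n = 2l_j`, `m = 2l_k`,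
`(R_{1,m} R_{2,m} ⋯ R_{n,m}) ⋯ (R_{1,2} ⋯ R_{n,2}) (R_{1,1} R_{2,1} ⋯ R_{n,1})`, where `R_{x,y}`
stands for `R^{1/2,1/2}(u_x - v_y)` on the copy `x` in the block `j` and the copy `y` in the
block `k`, `u_x = u + (n + 1 - 2x)η` and `v_y = (m + 1 - 2y)η`. (Below, `x` and `y` start at `0`.) -/
def prodR (D : Params) {N : ℕ} (n : Fin N → ℕ) (j k : Fin N) (u : ℂ) :
    Module.End ℂ (BigSpace n) :=
  (List.ofFn fun y : Fin (n k) =>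
    (List.ofFn fun x : Fin (n j) =>
      halfR D n j k x y ((u + ((n j : ℂ) + 1 - 2 * ((x : ℂ) + 1)) * D.η)
        - ((n k : ℂ) + 1 - 2 * ((y : ℂ) + 1)) * D.η)).prod).reverse.prod

/-- The fused elliptic `R` matrix `R^{l_j,l_k}_{j,k}(u)`, acting on the factors `V^{l_j}` and
`V^{l_k}` of the state space: the operator induced by `prodR` on the quotient
`V^{l_1} ⊗ ⋯ ⊗ V^{l_N}` of `(ℂ²)^{⊗ 2l_1} ⊗ ⋯ ⊗ (ℂ²)^{⊗ 2l_N}`. -/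
def fusedR (D : Params) {N : ℕ} (n : Fin N → ℕ) (j k : Fin N) (u : ℂ) :
    Module.End ℂ (StateSpace D n) :=
  PiTensorProduct.map (fun i => mulMap D.τ (n i)) ∘ₗ prodR D n j k u ∘ₗ
    PiTensorProduct.map (fun i => mulSection D.τ (n i))

/-- `R^{l_j,l_k}_{j,k}(u)` acting on functions `ℤ/rℤ → H`. -/
def funR (D : Params) {N : ℕ} (n : Fin N → ℕ) (j k : Fin N) (u : ℂ) :
    Module.End ℂ (FunSpace D n) :=
  (fusedR D n j k u).compLeft (ZMod D.r)

/-! ### Boundary operator and the operators `A_j` -/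

/-- `z_j = (z_1, …, z_j + κ, …, z_N)`. -/
def shift (D : Params) {N : ℕ} (j : Fin N) (z : Fin N → ℂ) : Fin N → ℂ :=
  Function.update z j (z j + D.κ)

/-- The arrangement `(j, 1, …, j-1, j+1, …, N)`. -/
def firstOrder {N : ℕ} (j : Fin N) : Equiv.Perm (Fin N) := j.cycleRange

/-- The arrangement `(1, …, j-1, j+1, …, N, j)`. -/
def lastOrder {N : ℕ} (j : Fin N) : Equiv.Perm (Fin N) :=
  j.cycleRange.trans (finRotate N).symm

/-- The path `(a_{N-1}, a_0, a_1, …, a_{N-1})`. -/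
def rotatePath {N : ℕ} (a : Fin (N + 1) → ℤ) : Fin (N + 1) → ℤ :=
  Fin.cons (a ⟨N - 1, by omega⟩) fun p : Fin N => a p.castSucc

/-- The defining property of the boundary operator
`Z^{l_1, …, l_{j-1}, l_{j+1}, …, l_N, l_j}_{z_1, …, z_{j-1}, z_{j+1}, …, z_N, z_j}(κ, c)`:
`e^{2πi a_N ν η} |a_0, …, a_N; z_1, …, z_N, z_j⟩` goes to
`e^{2πi a_{N-1} ν η} e^{c(a_N - a_{N-1} - 2l_j)} |a_{N-1}, a_0, …, a_{N-1}; z_j + κ, z_1, …, z_N⟩`. -/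
def IsBoundary (D : Params) {N : ℕ} (n : Fin N → ℕ) (j : Fin N) (z : Fin N → ℂ)
    (T : Module.End ℂ (FunSpace D n)) : Prop :=
  ∀ a : ClosedPath D n (lastOrder j),
    T (pathFun D n (lastOrder j) z a.1) =
      Complex.exp (D.c * ((a.1 (Fin.last N) - a.1 ⟨N - 1, by omega⟩ - (n j : ℤ) : ℤ) : ℂ)) •
        pathFun D n (firstOrder j) (shift D j z) (rotatePath a.1)

open Classical in
/-- The boundary operator; only its restriction to `bethe D n (lastOrder j) z` matters, which the
defining property determines. (It is `0` if the property is inconsistent, which cannot happen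
when the functions `pathFun` are linearly independent.) -/
def boundary (D : Params) {N : ℕ} (n : Fin N → ℕ) (j : Fin N) (z : Fin N → ℂ) :
    Module.End ℂ (FunSpace D n) :=
  if h : ∃ T, IsBoundary D n j z T then h.choose else 0

/-- The operator
`A_j(z) = R_{j,j-1}(z_j+κ-z_{j-1}) ⋯ R_{j,1}(z_j+κ-z_1) Z R_{j,N}(z_j-z_N) ⋯ R_{j,j+1}(z_j-z_{j+1})`. -/
def opA (D : Params) {N : ℕ} (n : Fin N → ℕ) (j : Fin N) (z : Fin N → ℂ) :
    Module.End ℂ (FunSpace D n) :=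
  (((List.finRange N).filter (fun k => k < j)).reverse.map
      fun k => funR D n j k (z j + D.κ - z k)).prod *
    boundary D n j z *
    (((List.finRange N).filter (fun k => j < k)).reverse.map
      fun k => funR D n j k (z j - z k)).prod

/-- The spectral parameters in general position: `z_i` and `z_i - z_k` (`i ≠ k`) do not lie in
`ℤ + ℤτ + ℤη`, that is, no `θ₁₁(z_i + mη)` and no `θ₁₁(z_i - z_k + mη)` vanishes. -/
def regular (D : Params) (N : ℕ) : Set (Fin N → ℂ) :=
  {z | ∀ m : ℤ, (∀ i, D.th 1 1 (z i + (m : ℂ) * D.η) ≠ 0) ∧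
    ∀ i k, i ≠ k → D.th 1 1 (z i - z k + (m : ℂ) * D.η) ≠ 0}

/-! ### Matrix difference systems -/

/-- The element `∑_a x_a e^{2πi a_0 ν η} |a; z⟩` of the space of Bethe vectors with the coordinates
`x_a` in the IRF picture. -/
def irf (D : Params) {N : ℕ} (n : Fin N → ℕ) (z : Fin N → ℂ) (x : ClosedPath D n 1 → ℂ) :
    FunSpace D n :=
  ∑ a, x a • pathFun D n 1 z a.1

/-- The matrix difference system `F(z_j) = M_j(z) F(z)`, `j = 1, …, N`, with coefficients
considered at the points `z ∈ U` with `z_j ∈ U`, is holonomic: the entries of `M_j` are quotients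
of entire functions, the matrices `M_j(z)` are invertible, and they are compatible. -/
structure IsHolonomic (D : Params) {N : ℕ} {ι : Type*} [Fintype ι] [DecidableEq ι]
    (U : Set (Fin N → ℂ)) (M : Fin N → (Fin N → ℂ) → Matrix ι ι ℂ) : Prop where
  meromorphic : ∀ j a b, ∃ P Q : (Fin N → ℂ) → ℂ, Differentiable ℂ P ∧ Differentiable ℂ Q ∧
    ∀ z ∈ U, shift D j z ∈ U → Q z ≠ 0 ∧ M j z a b = P z / Q z
  invertible : ∀ j, ∀ z ∈ U, shift D j z ∈ U → IsUnit (M j z)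
  compatible : ∀ j k, ∀ z ∈ U, shift D j z ∈ U → shift D k z ∈ U → shift D j (shift D k z) ∈ U →
    M j (shift D k z) * M k z = M k (shift D j z) * M j z

end EllipticQKZ

end

noncomputable section

namespace EllipticQKZ

/-! ### Addition formulas for theta functions -/

/-! The proof is the vertex-IRF correspondence, carried out in three layers.

Spin 1/2. The addition formulas write products of two theta functions of modulus `τ` through `θ₀₀`
and `θ₁₀` of modulus `2τ`. They identify `θ₁₀(y+x)θ₁₀(y-x)` with a vector `pv x` of `ℂ²`, and turn
symplectic pairings of such vectors with Pauli matrices into theta products. Riemann's relation then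
evaluates matrix elements of `R` and yields the exchange relation `half_exchange`: `R(u-v)` sends
the product of two intertwining vectors along a two-step path of heights to a combination over paths
with the same ends and with the two factors exchanged. The coefficients are entire in `u-v`, up to
the scalar in front of `R`. The Yang-Baxter equation and unitarity are compared coefficientwise in
the Pauli basis, where they reduce to `vt_quartic`; the unitarity scalar is read off from the
exchange relation.

Fusion. The copies of `ℂ²` in one block carry spectral parameters in steps of `-2η`, and `R(-2η)`
without its scalar is `P - 1`, with `P` the flip. Hence, by Yang-Baxter, the fused product preserves
the image of `P - 1` for neighbouring copies, and multiplication of functions kills that image.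
Conversely `apply_mulSection_mulMap` shows that flip-invariant maps factor through multiplication.
So identities between ordered products of spin 1/2 matrices descend to the fused matrices
(`fusedR_mulAll`, `Induces.eq_of_mem`). The spin `l` intertwining vector is the product of spin 1/2
vectors along any path of heights with the given ends (`PathFam.mulMap_eq`), so the exchange
relation fuses too (`fusedR_gvec`).

Bethe vectors. The fused `R_{jk}` carries closed paths for an arrangement `…, j, k, …` to closed
paths for `…, k, j, …`, and the boundary operator rotates an arrangement. Thus `A_j` moves `j` to
the last place, rotates it to the first, and moves it back to its own place. Path functions are
independent by a triangular evaluation of theta products in each factor and by orthogonality of the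
characters of `ℤ/rℤ`. Therefore boundary operators exist and are invertible, and unitarity inverts
the `R` matrices. Compatibility follows from Yang-Baxter, unitarity and two facts about the
boundary: `R_{ij}` commutes with carrying a third label around (`IsB.comm_funRz`), and `R_{jk}`
commutes with carrying both `j` and `k` around (`IsB.exchange`), because both parameters shift by
`κ` and the exponents telescope.

The exchange relations are proved for families over a parameter set `S` with coefficients in an
algebra `𝓜` of functions on `S`. A one-point `S` gives statements about vectors, a two-point `S`
shows that coefficients depend only on differences of spectral parameters, and the set of admissible
`z` with quotients of entire functions gives meromorphic matrix entries. -/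

/-- Pairs of integers, split according to the parity of their sum, in terms of half the sum and
half the difference. -/
def intPairParityEquiv : (ℤ × ℤ) ⊕ (ℤ × ℤ) ≃ ℤ × ℤ where
  toFun := Sum.elim (fun p => (p.1 + p.2, p.1 - p.2)) (fun p => (p.1 + p.2 + 1, p.1 - p.2))
  invFun m := if Even (m.1 + m.2) then Sum.inl ((m.1 + m.2) / 2, (m.1 - m.2) / 2)
    else Sum.inr ((m.1 + m.2 - 1) / 2, (m.1 - m.2 - 1) / 2)
  left_inv := by
    rintro (⟨p, q⟩ | ⟨p, q⟩)
    · have h : Even (p + q + (p - q)) := ⟨p, by ring⟩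
      simp only [Sum.elim_inl, h, if_true]
      congr 2 <;> omega
    · have h : ¬ Even (p + q + 1 + (p - q)) := by rw [Int.not_even_iff_odd]; exact ⟨p, by ring⟩
      simp only [Sum.elim_inr, h, if_false]
      congr 2 <;> omega
  right_inv := by
    rintro ⟨m, k⟩
    by_cases h : Even (m + k)
    · simp only [h, if_true, Sum.elim_inl]
      obtain ⟨c, hc⟩ := h
      ext <;> simp <;> omega
    · simp only [h, if_false, Sum.elim_inr]
      rw [Int.not_even_iff_odd] at h
      obtain ⟨c, hc⟩ := h
      ext <;> simp <;> omega

/-- The `n`-th term of the series `θ_{a0}(z;τ)`. -/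
def thetaTerm (a : ℕ) (z τ : ℂ) (n : ℤ) : ℂ :=
  Complex.exp (Real.pi * Complex.I * ((a : ℂ) / 2 + n) ^ 2 * τ
      + 2 * Real.pi * Complex.I * ((a : ℂ) / 2 + n) * z)

theorem summable_norm_thetaTerm (a : ℕ) (z : ℂ) {τ : ℂ} (hτ : 0 < τ.im) :
    Summable fun n => ‖thetaTerm a z τ n‖ := by
  have h := (summable_jacobiTheta₂_term_iff (z + (a : ℂ) / 2 * τ) τ).2 hτ
  have e : thetaTerm a z τ = fun n => Complex.exp (Real.pi * Complex.I * ((a : ℂ) / 2) ^ 2 * τ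
        + 2 * Real.pi * Complex.I * ((a : ℂ) / 2) * z) *
        jacobiTheta₂_term n (z + (a : ℂ) / 2 * τ) τ := by
    funext n
    rw [thetaTerm, jacobiTheta₂_term, ← Complex.exp_add]
    congr 1
    ring
  rw [e]
  exact (h.mul_left _).norm

theorem theta_eq_tsum (a : ℕ) (z τ : ℂ) : theta a 0 z τ = ∑' n, thetaTerm a z τ n := by
  simp [theta, thetaTerm]

theorem theta_mul_theta (a b : ℕ) (x y : ℂ) {σ τ : ℂ} (hσ : 0 < σ.im) (hτ : 0 < τ.im) :
    theta a 0 x σ * theta b 0 y τ = ∑' p : ℤ × ℤ, thetaTerm a x σ p.1 * thetaTerm b y τ p.2 := by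
  rw [theta_eq_tsum, theta_eq_tsum, tsum_mul_tsum_of_summable_norm
    (summable_norm_thetaTerm a x hσ) (summable_norm_thetaTerm b y hτ)]

theorem summable_thetaTerm_mul (a b : ℕ) (x y : ℂ) {σ τ : ℂ} (hσ : 0 < σ.im) (hτ : 0 < τ.im) :
    Summable fun p : ℤ × ℤ => thetaTerm a x σ p.1 * thetaTerm b y τ p.2 :=
  summable_mul_of_summable_norm (summable_norm_thetaTerm a x hσ) (summable_norm_thetaTerm b y hτ)

theorem two_mul_im_pos {τ : ℂ} (hτ : 0 < τ.im) : 0 < (2 * τ).im := by simpa using hτ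

theorem theta_zero_mul_theta_zero (x y : ℂ) {τ : ℂ} (hτ : 0 < τ.im) :
    theta 0 0 x τ * theta 0 0 y τ =
      theta 0 0 (x + y) (2 * τ) * theta 0 0 (x - y) (2 * τ) +
        theta 1 0 (x + y) (2 * τ) * theta 1 0 (x - y) (2 * τ) := by
  have h2 := two_mul_im_pos hτ
  rw [theta_mul_theta _ _ _ _ hτ hτ, theta_mul_theta _ _ _ _ h2 h2,
    theta_mul_theta _ _ _ _ h2 h2, ← intPairParityEquiv.tsum_eq]
  refine (HasSum.sum ((summable_thetaTerm_mul 0 0 (x + y) (x - y) h2 h2).hasSum.congr_fun ?_)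
    ((summable_thetaTerm_mul 1 1 (x + y) (x - y) h2 h2).hasSum.congr_fun ?_)).tsum_eq <;>
  rintro ⟨p, q⟩ <;>
  · simp only [intPairParityEquiv, Equiv.coe_fn_mk, Sum.elim_inl, Sum.elim_inr, thetaTerm,
      ← Complex.exp_add, Function.comp]
    congr 1
    push_cast
    ring

theorem theta_one_mul_theta_one (x y : ℂ) {τ : ℂ} (hτ : 0 < τ.im) :
    theta 1 0 x τ * theta 1 0 y τ =
      theta 1 0 (x + y) (2 * τ) * theta 0 0 (x - y) (2 * τ) +
        theta 0 0 (x + y) (2 * τ) * theta 1 0 (x - y) (2 * τ) := by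
  have h2 := two_mul_im_pos hτ
  rw [theta_mul_theta _ _ _ _ hτ hτ, theta_mul_theta _ _ _ _ h2 h2,
    theta_mul_theta _ _ _ _ h2 h2, ← intPairParityEquiv.tsum_eq]
  refine (HasSum.sum ((summable_thetaTerm_mul 1 0 (x + y) (x - y) h2 h2).hasSum.congr_fun ?_)
    -- In the odd class the two half-integers `1/2 + (p+q+1)` and `1/2 + (p-q)` have half-sum `p +
    -- 1` and half-difference `q + 1/2`, whence the shift of `p` by one.
    ((((Equiv.addRight (1 : ℤ)).prodCongr (Equiv.refl ℤ)).hasSum_iff.2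
      (summable_thetaTerm_mul 0 1 (x + y) (x - y) h2 h2).hasSum).congr_fun ?_)).tsum_eq <;>
  rintro ⟨p, q⟩ <;>
  · simp only [intPairParityEquiv, Equiv.coe_fn_mk, Sum.elim_inl, Sum.elim_inr, thetaTerm,
      ← Complex.exp_add, Equiv.prodCongr_apply, Prod.map, Equiv.refl_apply, Equiv.coe_addRight,
      Function.comp]
    congr 1
    push_cast
    ring

/-- Entire functions form a domain. This removes exceptional parameters: an identity is first proved
after multiplication by a theta function, which is then cancelled although it may vanish at the
point of interest. -/
theorem eq_zero_of_mul_eq_zero_of_differentiable {f g : ℂ → ℂ} (hf : Differentiable ℂ f)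
    (hg : Differentiable ℂ g) (h : ∀ z, f z * g z = 0) {w : ℂ} (hw : g w ≠ 0) (z : ℂ) :
    f z = 0 := by
  have hf' : AnalyticOnNhd ℂ f Set.univ := fun z _ => hf.analyticAt z
  have hg' : AnalyticOnNhd ℂ g Set.univ := fun z _ => hg.analyticAt z
  rcases AnalyticOnNhd.eq_zero_or_eq_zero_of_mul_eq_zero hf' hg' (fun z _ => h z)
    isPreconnected_univ with h | h
  · exact h z trivial
  · exact absurd (h w trivial) hw

namespace Params

variable (D : Params)

/-- `θ₀₀(s;2τ)`. -/
def thG (s : ℂ) : ℂ := theta 0 0 s (2 * D.τ)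

/-- `θ₁₀(s;2τ)`. -/
def thH (s : ℂ) : ℂ := theta 1 0 s (2 * D.τ)

@[fun_prop]
theorem differentiable_th (a b : ℕ) : Differentiable ℂ (D.th a b) :=
  differentiable_theta a b D.τ.im_pos

@[fun_prop]
theorem differentiable_thG : Differentiable ℂ D.thG :=
  differentiable_theta 0 0 (two_mul_im_pos D.τ.im_pos)

@[fun_prop]
theorem differentiable_thH : Differentiable ℂ D.thH :=
  differentiable_theta 1 0 (two_mul_im_pos D.τ.im_pos)

theorem thG_neg (s : ℂ) : D.thG (-s) = D.thG s := theta_neg 0 s _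

theorem thH_neg (s : ℂ) : D.thH (-s) = D.thH s := theta_neg 1 s _

theorem thG_add_one (s : ℂ) : D.thG (s + 1) = D.thG s := theta_zero_add_one s _

theorem thH_add_one (s : ℂ) : D.thH (s + 1) = -D.thH s := theta_one_add_one s _

theorem th_one_eq (a : ℕ) (z : ℂ) : D.th a 1 z = D.th a 0 (z + 1 / 2) := by
  simp only [th, theta]
  refine tsum_congr fun n => ?_
  congr 1
  push_cast
  ring

theorem th00_mul (x y : ℂ) : D.th 0 0 x * D.th 0 0 y =
    D.thG (x + y) * D.thG (x - y) + D.thH (x + y) * D.thH (x - y) :=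
  theta_zero_mul_theta_zero x y D.τ.im_pos

theorem th10_mul (x y : ℂ) : D.th 1 0 x * D.th 1 0 y =
    D.thH (x + y) * D.thG (x - y) + D.thG (x + y) * D.thH (x - y) :=
  theta_one_mul_theta_one x y D.τ.im_pos

theorem th01_mul (x y : ℂ) : D.th 0 1 x * D.th 0 1 y =
    D.thG (x + y) * D.thG (x - y) - D.thH (x + y) * D.thH (x - y) := by
  rw [th_one_eq, th_one_eq, th00_mul, show x + 1 / 2 + (y + 1 / 2) = x + y + 1 by ring,
    show x + 1 / 2 - (y + 1 / 2) = x - y by ring, thG_add_one, thH_add_one]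
  ring

theorem th11_mul (x y : ℂ) : D.th 1 1 x * D.th 1 1 y =
    D.thG (x + y) * D.thH (x - y) - D.thH (x + y) * D.thG (x - y) := by
  rw [th_one_eq, th_one_eq, th10_mul, show x + 1 / 2 + (y + 1 / 2) = x + y + 1 by ring,
    show x + 1 / 2 - (y + 1 / 2) = x - y by ring, thG_add_one, thH_add_one]
  ring

/-- `θ₀₁(s;2τ)`. -/
def thGh (s : ℂ) : ℂ := D.thG (s + 1 / 2)

/-- `θ₁₁(s;2τ)`. -/
def thHh (s : ℂ) : ℂ := D.thH (s + 1 / 2)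

theorem thG_sub_half (s : ℂ) : D.thG (s - 1 / 2) = D.thGh s := by
  rw [thGh, ← thG_add_one]; congr 1; ring

theorem thH_sub_half (s : ℂ) : D.thH (s - 1 / 2) = -D.thHh s := by
  rw [thHh, eq_neg_iff_add_eq_zero, ← neg_eq_iff_add_eq_zero, ← thH_add_one]; congr 1; ring

theorem thGh_neg (s : ℂ) : D.thGh (-s) = D.thGh s := by
  rw [← thG_sub_half, ← thG_neg, thGh]; congr 1; ring

theorem thHh_neg (s : ℂ) : D.thHh (-s) = -D.thHh s := by
  rw [← thH_sub_half, ← thH_neg, thHh]; congr 1; ring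

theorem th00_mul_th01 (x y : ℂ) : D.th 0 0 x * D.th 0 1 y =
    D.thGh (x + y) * D.thGh (x - y) - D.thHh (x + y) * D.thHh (x - y) := by
  rw [th_one_eq, th00_mul, show x + (y + 1 / 2) = x + y + 1 / 2 by ring,
    show x - (y + 1 / 2) = x - y - 1 / 2 by ring, thG_sub_half, thH_sub_half]
  simp only [thGh, thHh]
  ring

theorem th10_mul_th11 (x y : ℂ) : D.th 1 0 x * D.th 1 1 y =
    D.thHh (x + y) * D.thGh (x - y) - D.thGh (x + y) * D.thHh (x - y) := by
  rw [th_one_eq, th10_mul, show x + (y + 1 / 2) = x + y + 1 / 2 by ring,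
    show x - (y + 1 / 2) = x - y - 1 / 2 by ring, thG_sub_half, thH_sub_half]
  simp only [thGh, thHh]
  ring

theorem thHh_zero : D.thHh 0 = 0 := by
  have h := D.thHh_neg 0
  rw [neg_zero] at h
  exact self_eq_neg.1 h

theorem th11_neg (x : ℂ) : D.th 1 1 (-x) = -D.th 1 1 x := by
  have h : D.th 1 0 (x - 1 / 2) = -D.th 1 0 (x + 1 / 2) := by
    rw [eq_neg_iff_add_eq_zero, ← neg_eq_iff_add_eq_zero]
    have := theta_one_add_one (x - 1 / 2) D.τ
    rw [th, ← this, th]; congr 1; ring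
  rw [th_one_eq, th_one_eq, ← h, show -x + 1 / 2 = -(x - 1 / 2) by ring]
  exact theta_neg 1 _ _

theorem th11_zero : D.th 1 1 0 = 0 := by
  have h := D.th11_neg 0
  rw [neg_zero] at h
  exact self_eq_neg.1 h

theorem th10_neg (x : ℂ) : D.th 1 0 (-x) = D.th 1 0 x := theta_neg 1 _ _

theorem th00_neg (x : ℂ) : D.th 0 0 (-x) = D.th 0 0 x := theta_neg 0 _ _

theorem th01_neg (x : ℂ) : D.th 0 1 (-x) = D.th 0 1 x := by
  rw [th_one_eq, th_one_eq, show -x + 1 / 2 = -(x - 1 / 2) by ring, th00_neg]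
  have := theta_zero_add_one (x - 1 / 2) D.τ
  rw [th, ← this, th]; congr 1; ring

/-- Riemann's quartic theta relation. -/
theorem riemann (x₁ x₂ x₃ x₄ y₁ y₂ y₃ y₄ : ℂ) (h₁ : 2 * y₁ = x₁ + x₂ + x₃ - x₄)
    (h₂ : 2 * y₂ = x₁ + x₂ - x₃ + x₄) (h₃ : 2 * y₃ = x₁ - x₂ + x₃ + x₄)
    (h₄ : 2 * y₄ = -x₁ + x₂ + x₃ + x₄) :
    D.th 1 1 x₁ * D.th 1 1 x₂ * (D.th 1 1 x₃ * D.th 1 1 x₄)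
      + D.th 1 0 x₁ * D.th 1 0 x₂ * (D.th 1 0 x₃ * D.th 1 0 x₄)
      - D.th 0 0 x₁ * D.th 0 0 x₂ * (D.th 0 0 x₃ * D.th 0 0 x₄)
      + D.th 0 1 x₁ * D.th 0 1 x₂ * (D.th 0 1 x₃ * D.th 0 1 x₄) =
    2 * (D.th 1 1 y₁ * D.th 1 1 y₂ * (D.th 1 1 y₃ * D.th 1 1 y₄)) := by
  -- With these sums and differences the addition formulas turn both sides into polynomials in the
  -- same eight values of `θ₀₀` and `θ₁₀` of modulus `2τ`.
  have e₁ : y₁ + y₂ = x₁ + x₂ := by linear_combination (h₁ + h₂) / 2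
  have e₂ : y₁ - y₂ = x₃ - x₄ := by linear_combination (h₁ - h₂) / 2
  have e₃ : y₃ + y₄ = x₃ + x₄ := by linear_combination (h₃ + h₄) / 2
  have e₄ : y₃ - y₄ = x₁ - x₂ := by linear_combination (h₃ - h₄) / 2
  simp only [th11_mul, th10_mul, th00_mul, th01_mul, e₁, e₂, e₃, e₄]
  ring

/-! ### Non-vanishing of theta values, from a single point where `θ₁₁` does not vanish -/

variable {D}

/-- Each term of the addition formula for `θ₁₁(w)²` contains a value of `thG` and a value of `thH`,
so neither function can vanish identically. -/
theorem exists_thG_ne_zero {w : ℂ} (hw : D.th 1 1 w ≠ 0) :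
    (∃ s, D.thG s ≠ 0) ∧ ∃ s, D.thH s ≠ 0 := by
  have h := D.th11_mul w w
  constructor <;>
  · by_contra! h'
    rw [h', h'] at h
    apply hw
    simpa using h

/-- Since `θ₁₀(z)θ₁₀(0) = 2 thG(z) thH(z)`, a zero at the origin would kill a product of two nonzero
entire functions. -/
theorem th10_zero_ne_zero {w : ℂ} (hw : D.th 1 1 w ≠ 0) : D.th 1 0 0 ≠ 0 := by
  obtain ⟨-, s, hs⟩ := exists_thG_ne_zero hw
  obtain ⟨⟨s', hs'⟩, -⟩ := exists_thG_ne_zero hw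
  intro h0
  refine hs' (eq_zero_of_mul_eq_zero_of_differentiable D.differentiable_thG D.differentiable_thH
    (fun z => ?_) hs s')
  have h := D.th10_mul z 0
  rw [h0, mul_zero, add_zero, sub_zero] at h
  linear_combination -(1 / 2) * h

/-- `thG` is periodic and `thH` antiperiodic under `z ↦ z + 1`, so proportionality would force `thG`
to vanish. -/
theorem thG_eq_mul_thH_false {w : ℂ} (hw : D.th 1 1 w ≠ 0) (c : ℂ)
    (h : ∀ z, D.thG z - c * D.thH z = 0) : False := by
  obtain ⟨⟨s, hs⟩, -⟩ := exists_thG_ne_zero hw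
  apply hs
  have h1 := h s
  have h2 := h (s + 1)
  rw [thG_add_one, thH_add_one] at h2
  linear_combination (h1 + h2) / 2

/-- The difference of squares factors, and one of the two factors would vanish identically. The
cases `c = i` and `c = 1` exclude `θ₀₀(0) = 0` and `θ₀₁(0) = 0`. -/
theorem sq_add_mul_sq_false {w : ℂ} (hw : D.th 1 1 w ≠ 0) (c : ℂ)
    (h : ∀ z, D.thG z * D.thG z - c ^ 2 * (D.thH z * D.thH z) = 0) : False := by
  have hG := D.differentiable_thG
  have hH := D.differentiable_thH
  by_cases h' : ∃ s, D.thG s - c * D.thH s ≠ 0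
  · obtain ⟨s, hs⟩ := h'
    refine thG_eq_mul_thH_false hw (-c) (eq_zero_of_mul_eq_zero_of_differentiable
      (f := fun z => D.thG z - -c * D.thH z) (g := fun z => D.thG z - c * D.thH z)
      (by fun_prop) (by fun_prop) (fun z => ?_) hs)
    linear_combination h z
  · push Not at h'
    exact thG_eq_mul_thH_false hw c h'

theorem th00_zero_ne_zero {w : ℂ} (hw : D.th 1 1 w ≠ 0) : D.th 0 0 0 ≠ 0 := by
  intro h0
  refine sq_add_mul_sq_false hw Complex.I fun z => ?_
  have h := D.th00_mul z 0
  rw [h0, mul_zero, add_zero, sub_zero] at h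
  rw [Complex.I_sq]
  linear_combination -h

theorem th01_zero_ne_zero {w : ℂ} (hw : D.th 1 1 w ≠ 0) : D.th 0 1 0 ≠ 0 := by
  intro h0
  refine sq_add_mul_sq_false hw 1 fun z => ?_
  have h := D.th01_mul z 0
  rw [h0, mul_zero, add_zero, sub_zero] at h
  linear_combination -h

variable (D) in
/-- The duplication formula for `θ₁₁`. -/
theorem th11_two_mul (x : ℂ) :
    D.th 1 0 0 * D.th 1 1 (2 * x) * (D.th 0 0 0 * D.th 0 1 0) =
      2 * (D.th 1 0 x * D.th 1 1 x) * (D.th 0 0 x * D.th 0 1 x) := by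
  simp only [th10_mul_th11, th00_mul_th01, zero_add, zero_sub, sub_self,
    thHh_zero, thGh_neg, thHh_neg, ← two_mul]
  ring_nf

/-- The four theta functions `θ₁₁, θ₁₀, θ₀₀, θ₀₁`. -/
def vt (D : Params) (a : Fin 4) (z : ℂ) : ℂ := ![D.th 1 1 z, D.th 1 0 z, D.th 0 0 z, D.th 0 1 z] a

/-- By duplication all four theta values at `x` divide `θ₁₁(2x)` up to nonzero constants. At `x = η`
this makes the denominators of the Pauli coefficients of `R` nonzero. -/
theorem vt_ne_zero {x : ℂ} (hx : D.th 1 1 (2 * x) ≠ 0) (a : Fin 4) : D.vt a x ≠ 0 := by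
  have h := D.th11_two_mul x
  have h0 : D.th 1 0 0 * D.th 1 1 (2 * x) * (D.th 0 0 0 * D.th 0 1 0) ≠ 0 :=
    mul_ne_zero (mul_ne_zero (th10_zero_ne_zero hx) hx)
      (mul_ne_zero (th00_zero_ne_zero hx) (th01_zero_ne_zero hx))
  rw [h] at h0
  simp only [ne_eq, mul_eq_zero, not_or] at h0
  obtain ⟨⟨-, h1, h2⟩, h3, h4⟩ := h0
  fin_cases a
  exacts [h2, h1, h3, h4]

end Params

/-! ### The spin `1/2` intertwining relation -/

section SpinHalf

variable (D : Params)

/-- The coordinates of `y ↦ θ₁₀(y+x)θ₁₀(y-x)` in the basis `halfBasis`. -/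
def pv (x : ℂ) : Fin 2 → ℂ :=
  ![-(D.thG (2 * x) - D.thH (2 * x)) / 2, (D.thG (2 * x) + D.thH (2 * x)) / 2]

theorem pv_neg (x : ℂ) : pv D (-x) = pv D x := by
  simp [pv, Params.thG_neg, Params.thH_neg]

theorem pv_halfBasis (x y : ℂ) :
    pv D x 0 * halfBasis D.τ 0 y + pv D x 1 * halfBasis D.τ 1 y =
      D.th 1 0 (y + x) * D.th 1 0 (y - x) := by
  rw [Params.th10_mul, show y + x + (y - x) = 2 * y by ring,
    show y + x - (y - x) = 2 * x by ring]
  simp only [pv, halfBasis, Params.thG, Params.thH, Matrix.cons_val_zero, Matrix.cons_val_one,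
    if_true, Fin.one_eq_zero_iff, OfNat.ofNat_ne_one, if_false]
  ring

@[fun_prop]
theorem differentiable_pv_comp {f : ℂ → ℂ} (hf : Differentiable ℂ f) (i : Fin 2) :
    Differentiable ℂ fun x => pv D (f x) i := by
  have hG := D.differentiable_thG
  have hH := D.differentiable_thH
  have h2 : Differentiable ℂ fun x => 2 * f x := hf.const_mul 2
  have hG' : Differentiable ℂ fun x => D.thG (2 * f x) := hG.comp h2
  have hH' : Differentiable ℂ fun x => D.thH (2 * f x) := hH.comp h2
  fin_cases i
  · exact (((hG'.sub hH').neg).div_const 2)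
  · exact (hG'.add hH').div_const 2

/-- The standard symplectic form on `ℂ²`. -/
def om (v w : Fin 2 → ℂ) : ℂ := v 0 * w 1 - v 1 * w 0

/-- Pairing of a bilinear array with two vectors by the symplectic form. -/
def omTwo (v w : Fin 2 → ℂ) (X : Fin 2 → Fin 2 → ℂ) : ℂ :=
  v 0 * w 0 * X 1 1 - v 0 * w 1 * X 1 0 - v 1 * w 0 * X 0 1 + v 1 * w 1 * X 0 0

theorem omTwo_sub (v w : Fin 2 → ℂ) (X Y : Fin 2 → Fin 2 → ℂ) :
    omTwo v w (X - Y) = omTwo v w X - omTwo v w Y := by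
  simp only [omTwo, Pi.sub_apply]; ring

theorem omTwo_mul (v w : Fin 2 → ℂ) (c : ℂ) (x y : Fin 2 → ℂ) :
    omTwo v w (fun i j => c * (x i * y j)) = c * (om v x * om w y) := by
  simp only [omTwo, om]; ring

theorem omTwo_add (v w : Fin 2 → ℂ) (X Y : Fin 2 → Fin 2 → ℂ) :
    omTwo v w (X + Y) = omTwo v w X + omTwo v w Y := by
  simp only [omTwo, Pi.add_apply]; ring

/-- An array orthogonal to all products of two bases is zero. The determinants of the bases are kept
as factors, since for special parameters the test vectors used below become dependent. -/
theorem om_mul_om_mul_eq_zero {v₁ v₂ w₁ w₂ : Fin 2 → ℂ} {X : Fin 2 → Fin 2 → ℂ}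
    (h₁₁ : omTwo v₁ w₁ X = 0) (h₁₂ : omTwo v₁ w₂ X = 0) (h₂₁ : omTwo v₂ w₁ X = 0)
    (h₂₂ : omTwo v₂ w₂ X = 0) (i j : Fin 2) : X i j * (om v₁ v₂ * om w₁ w₂) = 0 := by
  simp only [omTwo] at h₁₁ h₁₂ h₂₁ h₂₂
  have : ∀ i j, X i j * (om v₁ v₂ * om w₁ w₂) = v₁ i * w₁ j * omTwo v₂ w₂ X
      - v₁ i * w₂ j * omTwo v₂ w₁ X - v₂ i * w₁ j * omTwo v₁ w₂ X
      + v₂ i * w₂ j * omTwo v₁ w₁ X := by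
    intro i j
    fin_cases i <;> fin_cases j <;> simp [om, omTwo] <;> ring
  rw [this]
  simp only [omTwo, h₁₁, h₁₂, h₂₁, h₂₂]
  ring

theorem om_self (v : Fin 2 → ℂ) : om v v = 0 := by simp only [om]; ring

/-- The coefficient of `σ^a ⊗ σ^a` in the `R` matrix with its scalar factor removed. -/
def sCoeff (t : ℂ) (a : Fin 4) : ℂ := D.vt a (t + D.η) / (2 * D.vt a D.η)

/-- The `R` matrix with its scalar factor removed, applied to `v ⊗ w`. -/
def sApply (t : ℂ) (v w : Fin 2 → ℂ) (i j : Fin 2) : ℂ :=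
  ∑ a, sCoeff D t a * ((pauli a).mulVec v i * (pauli a).mulVec w j)

/-- The factors in the pairings of `pv y` with `σ^a pv x`. -/
def omSign : Fin 4 → ℂ := ![-1, -1, Complex.I, 1]

/-- Written out, the pairing with each `σ^a` is one of the four addition formulas. Matrix elements
of `R` thereby become sums of products of theta functions. -/
theorem om_pv_pauli (a : Fin 4) (x y : ℂ) : om (pv D y) ((pauli a).mulVec (pv D x)) =
    omSign a / 2 * (D.vt a (y + x) * D.vt a (y - x)) := by
  have h1 : y + x + (y - x) = 2 * y := by ring
  have h2 : y + x - (y - x) = 2 * x := by ring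
  fin_cases a <;>
  simp [omSign, Params.vt, om, pauli, Params.th11_mul, Params.th10_mul, Params.th00_mul,
    Params.th01_mul, h1, h2, pv, Matrix.mulVec, dotProduct] <;> ring

theorem om_pv (x y : ℂ) : om (pv D y) (pv D x) =
    -(1 / 2) * (D.th 1 1 (y + x) * D.th 1 1 (y - x)) := by
  have h := om_pv_pauli D 0 x y
  have e : (pauli 0).mulVec (pv D x) = pv D x := by
    ext i; fin_cases i <;> simp [pauli, Matrix.mulVec, dotProduct]
  rw [e] at h
  rw [h]
  simp [omSign, Params.vt]
  ring

theorem omTwo_sApply (t : ℂ) (v w x y : Fin 2 → ℂ) : omTwo v w (sApply D t x y) =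
    ∑ a, sCoeff D t a * (om v ((pauli a).mulVec x) * om w ((pauli a).mulVec y)) := by
  simp only [omTwo, sApply, om, Fin.sum_univ_four]
  ring

variable {D}

/-- For `y + x = η` one factor of the pairing cancels the denominator `ϑ_a(η)` of the coefficient.
Since the squares of `omSign` are `1, 1, -1, 1`, what remains is exactly the left side of Riemann's
relation, so the matrix element is a single product. -/
theorem omTwo_sApply_pv_left (hη : D.th 1 1 (2 * D.η) ≠ 0) {t x w y y' : ℂ} (h : y + x = D.η)
    (y₁ y₂ y₃ y₄ : ℂ) (h₁ : 2 * y₁ = (t + D.η) + (y - x) + (y' + w) - (y' - w))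
    (h₂ : 2 * y₂ = (t + D.η) + (y - x) - (y' + w) + (y' - w))
    (h₃ : 2 * y₃ = (t + D.η) - (y - x) + (y' + w) + (y' - w))
    (h₄ : 2 * y₄ = -(t + D.η) + (y - x) + (y' + w) + (y' - w)) :
    omTwo (pv D y) (pv D y') (sApply D t (pv D x) (pv D w)) =
      1 / 4 * (D.th 1 1 y₁ * D.th 1 1 y₂ * (D.th 1 1 y₃ * D.th 1 1 y₄)) := by
  have hR := D.riemann _ _ _ _ _ _ _ _ h₁ h₂ h₃ h₄
  have hn := fun a => Params.vt_ne_zero hη a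
  have key : ∀ a, sCoeff D t a * (om (pv D y) ((pauli a).mulVec (pv D x)) *
      om (pv D y') ((pauli a).mulVec (pv D w))) = omSign a ^ 2 / 8 *
        (D.vt a (t + D.η) * D.vt a (y - x) * (D.vt a (y' + w) * D.vt a (y' - w))) := by
    intro a
    rw [om_pv_pauli, om_pv_pauli, h, sCoeff]
    field_simp [hn a]
    ring
  rw [omTwo_sApply, Finset.sum_congr rfl fun a _ => key a, Fin.sum_univ_four]
  simp only [omSign, Params.vt, Matrix.cons_val_zero, Matrix.cons_val_one, Matrix.cons_val,
    Complex.I_sq]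
  linear_combination hR / 8

theorem sApply_swap (t : ℂ) (x y : Fin 2 → ℂ) (i j : Fin 2) :
    sApply D t x y i j = sApply D t y x j i := by
  simp only [sApply]
  exact Finset.sum_congr rfl fun a _ => by ring

theorem omTwo_sApply_swap (t : ℂ) (v w x y : Fin 2 → ℂ) :
    omTwo v w (sApply D t x y) = omTwo w v (sApply D t y x) := by
  simp only [omTwo, sApply_swap (D := D) t x y]
  ring

/-- The exchange relation on a straight path. Both sides are paired in the first slot with `pv (x +
η)` and `pv (η - x)`, for which `omTwo_sApply_pv_left` applies. These two are independent where
`θ₁₁(2x) ≠ 0`, and the other `x` follow because everything is entire in `x`. -/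
theorem sApply_pv_eq (hη : D.th 1 1 (2 * D.η) ≠ 0) (x w : ℂ) (i j : Fin 2) :
    sApply D (2 * (w - x) - 2 * D.η) (pv D x) (pv D w) i j =
      D.th 1 1 (2 * (w - x)) / D.th 1 1 (2 * D.η) * (pv D (x + D.η) i * pv D (w - D.η) j) := by
  rw [← sub_eq_zero]
  have hvt : ∀ a, Differentiable ℂ (D.vt a) := by
    intro a; fin_cases a
    exacts [D.differentiable_th 1 1, D.differentiable_th 1 0, D.differentiable_th 0 0,
      D.differentiable_th 0 1]
  have hth := D.differentiable_th 1 1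
  refine eq_zero_of_mul_eq_zero_of_differentiable
    (f := fun x => sApply D (2 * (w - x) - 2 * D.η) (pv D x) (pv D w) i j -
      D.th 1 1 (2 * (w - x)) / D.th 1 1 (2 * D.η) * (pv D (x + D.η) i * pv D (w - D.η) j))
    (g := fun x => D.th 1 1 (2 * x)) ?_ ?_ ?_ hη x
  · simp only [sApply, sCoeff, Matrix.mulVec, dotProduct, Fin.sum_univ_two, Fin.sum_univ_four]
    fun_prop
  · fun_prop
  intro x
  set X : Fin 2 → Fin 2 → ℂ := sApply D (2 * (w - x) - 2 * D.η) (pv D x) (pv D w) with hX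
  set Y : Fin 2 → Fin 2 → ℂ := fun i j => D.th 1 1 (2 * (w - x)) / D.th 1 1 (2 * D.η) *
    (pv D (x + D.η) i * pv D (w - D.η) j) with hY
  have h1 : ∀ y', omTwo (pv D (x + D.η)) (pv D y') (X - Y) = 0 := by
    intro y'
    rw [omTwo_sub, hX, hY, omTwo_mul, om_self, ← pv_neg D x,
      omTwo_sApply_pv_left hη (by ring : x + D.η + -x = D.η)
      (2 * w) 0 (y' + w - 2 * x - D.η) (2 * x + y' - w + D.η) (by ring) (by ring) (by ring) (by ring),
      Params.th11_zero]
    ring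
  have h2 : ∀ y', omTwo (pv D (D.η - x)) (pv D y') (X - Y) = 0 := by
    intro y'
    rw [omTwo_sub, hX, hY, omTwo_mul, om_pv, om_pv,
      omTwo_sApply_pv_left hη (by ring : D.η - x + x = D.η)
      (2 * w - 2 * x) (-(2 * x)) (w - D.η + y') (y' - w + D.η) (by ring) (by ring) (by ring)
      (by ring), show D.η - x + (x + D.η) = 2 * D.η by ring,
      show D.η - x - (x + D.η) = -(2 * x) by ring,
      show y' + (w - D.η) = w - D.η + y' by ring, show y' - (w - D.η) = y' - w + D.η by ring,
      show 2 * (w - x) = 2 * w - 2 * x by ring]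
    field_simp
    ring
  -- The second slot is tested against the basis `pv 0`, `pv (2η)`, whose determinant is a multiple
  -- of `θ₁₁(2η)²`.
  have h := om_mul_om_mul_eq_zero (h1 0) (h1 (2 * D.η)) (h2 0) (h2 (2 * D.η)) i j
  rw [om_pv, om_pv, show x + D.η + (D.η - x) = 2 * D.η by ring,
    show x + D.η - (D.η - x) = 2 * x by ring, zero_add, zero_sub, Params.th11_neg] at h
  have h' : (X - Y) i j * D.th 1 1 (2 * x) * D.th 1 1 (2 * D.η) ^ 3 = 0 := by
    linear_combination -4 * h
  simpa [hη, hX, hY] using h'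

/-- The coefficients of the exchange relation on a path returning to its initial height. -/
theorem sApply_pv_return (hη : D.th 1 1 (2 * D.η) ≠ 0) {lam : ℂ} (hlam : D.th 1 1 lam ≠ 0)
    (u v : ℂ) (i j : Fin 2) :
    sApply D (u - v) (pv D ((lam - u + D.η) / 2)) (pv D ((lam + v + D.η) / 2)) i j =
      D.th 1 1 (lam - (u - v)) / D.th 1 1 lam *
        (pv D ((lam + u + D.η) / 2) i * pv D ((lam - v + D.η) / 2) j) +
      D.th 1 1 (u - v) * D.th 1 1 (lam + 2 * D.η) / (D.th 1 1 lam * D.th 1 1 (2 * D.η)) *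
        (pv D ((lam - u - D.η) / 2) i * pv D ((lam + v - D.η) / 2) j) := by
  have hvt : ∀ a, Differentiable ℂ (D.vt a) := by
    intro a; fin_cases a
    exacts [D.differentiable_th 1 1, D.differentiable_th 1 0, D.differentiable_th 0 0,
      D.differentiable_th 0 1]
  have hth := D.differentiable_th 1 1
  set F : ℂ → ℂ → Fin 2 → Fin 2 → ℂ := fun u v =>
    sApply D (u - v) (pv D ((lam - u + D.η) / 2)) (pv D ((lam + v + D.η) / 2)) -
      ((fun i j => D.th 1 1 (lam - (u - v)) / D.th 1 1 lam *
        (pv D ((lam + u + D.η) / 2) i * pv D ((lam - v + D.η) / 2) j)) +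
      fun i j => D.th 1 1 (u - v) * D.th 1 1 (lam + 2 * D.η) /
        (D.th 1 1 lam * D.th 1 1 (2 * D.η)) *
        (pv D ((lam - u - D.η) / 2) i * pv D ((lam + v - D.η) / 2) j)) with hF
  -- The two factors come from the determinants of the test vectors below. They equal `θ₁₁(2η)` at
  -- `u = η` and at `v = η - λ`, hence can be cancelled.
  suffices h : ∀ u v, F u v i j * D.th 1 1 (u + D.η) * D.th 1 1 (lam + v + D.η) = 0 by
    rw [← sub_eq_zero]
    refine eq_zero_of_mul_eq_zero_of_differentiable (f := fun u => F u v i j)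
      (g := fun u => D.th 1 1 (u + D.η)) ?_ (by fun_prop) (fun u => ?_) (w := D.η)
      (by rwa [← two_mul]) u
    · simp only [hF, sApply, sCoeff, Matrix.mulVec, dotProduct, Fin.sum_univ_two,
        Fin.sum_univ_four, Pi.sub_apply, Pi.add_apply]
      fun_prop
    · refine eq_zero_of_mul_eq_zero_of_differentiable
        (f := fun v => F u v i j * D.th 1 1 (u + D.η))
        (g := fun v => D.th 1 1 (lam + v + D.η)) ?_ (by fun_prop) (fun v => h u v)
        (w := D.η - lam) (by rwa [show lam + (D.η - lam) + D.η = 2 * D.η by ring]) v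
      simp only [hF, sApply, sCoeff, Matrix.mulVec, dotProduct, Fin.sum_univ_two,
        Fin.sum_univ_four, Pi.sub_apply, Pi.add_apply]
      fun_prop
  intro u v
  have eB' : pv D ((lam + v - D.η) / 2) = pv D ((D.η - lam - v) / 2) := by
    rw [← pv_neg]; congr 1; ring
  have eB : pv D ((lam - u - D.η) / 2) = pv D ((D.η - lam + u) / 2) := by
    rw [← pv_neg]; congr 1; ring
  -- In the first slot the test vectors are those of the two terms on the right, so each annihilates
  -- one term. In the second slot they are the vector of the second term and a further one at
  -- `(λ+v+3η)/2`. Up to evenness of `pv`, each pair has one slot where the arguments add up to `η`.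
  have hAB : omTwo (pv D ((lam + u + D.η) / 2)) (pv D ((lam + v - D.η) / 2)) (F u v) = 0 := by
    rw [hF, omTwo_sub, omTwo_add, omTwo_mul, omTwo_mul, om_self, om_self, eB',
      omTwo_sApply_swap,
      omTwo_sApply_pv_left hη (by ring : (D.η - lam - v) / 2 + (lam + v + D.η) / 2 = D.η)
        (D.η - v) (u - v - lam) (u + lam + D.η) 0 (by ring) (by ring)
        (by ring) (by ring), Params.th11_zero]
    ring
  have hAE : omTwo (pv D ((lam + u + D.η) / 2)) (pv D ((lam + v + 3 * D.η) / 2)) (F u v) = 0 := by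
    rw [hF, omTwo_sub, omTwo_add, omTwo_mul, omTwo_mul, om_self, om_pv, om_pv, om_pv,
      omTwo_sApply_swap, ← pv_neg D ((lam + v + D.η) / 2),
      omTwo_sApply_pv_left hη (by ring : (lam + v + 3 * D.η) / 2 + -((lam + v + D.η) / 2) = D.η)
        (lam + 2 * D.η) (u + D.η) (u - v) (lam + v + D.η) (by ring) (by ring)
        (by ring) (by ring),
      show (lam + u + D.η) / 2 + (lam - u - D.η) / 2 = lam by ring,
      show (lam + u + D.η) / 2 - (lam - u - D.η) / 2 = u + D.η by ring,
      show (lam + v + 3 * D.η) / 2 + (lam + v - D.η) / 2 = lam + v + D.η by ring,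
      show (lam + v + 3 * D.η) / 2 - (lam + v - D.η) / 2 = 2 * D.η by ring]
    field_simp
    ring
  have hBB : omTwo (pv D ((D.η - lam + u) / 2)) (pv D ((lam + v - D.η) / 2)) (F u v) = 0 := by
    rw [hF, omTwo_sub, omTwo_add, omTwo_mul, omTwo_mul, om_self, om_pv, om_pv,
      omTwo_sApply_pv_left hη (by ring : (D.η - lam + u) / 2 + (lam - u + D.η) / 2 = D.η)
        (u + D.η) (-(lam - (u - v))) lam (v - D.η) (by ring) (by ring)
        (by ring) (by ring),
      show (D.η - lam + u) / 2 + (lam + u + D.η) / 2 = u + D.η by ring,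
      show (D.η - lam + u) / 2 - (lam + u + D.η) / 2 = -lam by ring,
      show (lam + v - D.η) / 2 + (lam - v + D.η) / 2 = lam by ring,
      show (lam + v - D.η) / 2 - (lam - v + D.η) / 2 = v - D.η by ring, Params.th11_neg,
      Params.th11_neg]
    field_simp
    ring
  have hBE : omTwo (pv D ((D.η - lam + u) / 2)) (pv D ((lam + v + 3 * D.η) / 2)) (F u v) = 0 := by
    rw [hF, omTwo_sub, omTwo_add, omTwo_mul, omTwo_mul, eB, om_self, om_pv, om_pv,
      omTwo_sApply_pv_left hη (by ring : (D.η - lam + u) / 2 + (lam - u + D.η) / 2 = D.η)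
        (u + D.η) (-(lam - (u - v))) (lam + 2 * D.η) (v + D.η) (by ring) (by ring)
        (by ring) (by ring),
      show (D.η - lam + u) / 2 + (lam + u + D.η) / 2 = u + D.η by ring,
      show (D.η - lam + u) / 2 - (lam + u + D.η) / 2 = -lam by ring,
      show (lam + v + 3 * D.η) / 2 + (lam - v + D.η) / 2 = lam + 2 * D.η by ring,
      show (lam + v + 3 * D.η) / 2 - (lam - v + D.η) / 2 = v + D.η by ring, Params.th11_neg,
      Params.th11_neg]
    field_simp
    ring
  have h := om_mul_om_mul_eq_zero hAB hAE hBB hBE i j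
  rw [om_pv, om_pv, show (lam + u + D.η) / 2 + (D.η - lam + u) / 2 = u + D.η by ring,
    show (lam + u + D.η) / 2 - (D.η - lam + u) / 2 = lam by ring,
    show (lam + v - D.η) / 2 + (lam + v + 3 * D.η) / 2 = lam + v + D.η by ring,
    show (lam + v - D.η) / 2 - (lam + v + 3 * D.η) / 2 = -(2 * D.η) by ring,
    Params.th11_neg] at h
  have h' : F u v i j * D.th 1 1 (u + D.η) * D.th 1 1 (lam + v + D.η) *
      (D.th 1 1 lam * D.th 1 1 (2 * D.η)) = 0 := by
    linear_combination -4 * h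
  exact (mul_eq_zero.1 h').resolve_right (mul_ne_zero hlam hη)

/-- Neighbouring heights. -/
def HStep (a b : ℤ) : Prop := b = a + 1 ∨ b = a - 1

variable (D) in
/-- The spin `1/2` intertwining vector, in coordinates, for neighbouring heights `a`, `b`. -/
def half (a b : ℤ) (u : ℂ) : Fin 2 → ℂ := pv D ((((b - a : ℤ) : ℂ) * D.height a - u + D.η) / 2)

/-- A straight path has one admissible middle height, a returning path has two. The explicit weights
are forgotten: later arguments need only that they are entire functions of the difference `u - v`.
-/
theorem half_exchange (hη : D.th 1 1 (2 * D.η) ≠ 0) (hlam : ∀ a, D.th 1 1 (D.height a) ≠ 0)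
    {a b c : ℤ} (hab : HStep a b) (hbc : HStep b c) :
    ∃ (s : Finset ℤ) (C : ℤ → ℂ → ℂ), (∀ b' ∈ s, HStep a b' ∧ HStep b' c) ∧
      (∀ b', Differentiable ℂ (C b')) ∧ ∀ u v i j,
      sApply D (u - v) (half D a b u) (half D b c v) i j =
        ∑ b' ∈ s, C b' (u - v) * (half D b' c u i * half D a b' v j) := by
  have hth := D.differentiable_th 1 1
  -- The sign `ε` treats rising and falling paths together; `ε² = 1` gives `ε λ_{a+ε} = ε λ_a + 2η`.
  have key1 : ∀ ε : ℤ, (ε = 1 ∨ ε = -1) → ∀ u v i j,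
      sApply D (u - v) (half D a (a + ε) u) (half D (a + ε) (a + ε + ε) v) i j =
        D.th 1 1 (u - v + 2 * D.η) / D.th 1 1 (2 * D.η) *
          (half D (a + ε) (a + ε + ε) u i * half D a (a + ε) v j) := by
    intro ε hε u v i j
    have h := sApply_pv_eq hη ((ε * D.height a - u + D.η) / 2)
      ((ε * D.height a - v + 3 * D.η) / 2) i j
    have e2 : (ε : ℂ) ^ 2 = 1 := by rcases hε with rfl | rfl <;> norm_num
    simp only [half]
    have hh : ∀ w, ((((a + ε + ε - (a + ε) : ℤ) : ℂ)) * D.height (a + ε) - w + D.η) / 2 =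
        (ε * D.height a - w + 3 * D.η) / 2 := by
      intro w
      simp only [Params.height]; push_cast
      linear_combination e2 * D.η
    rw [hh, hh, show (((a + ε - a : ℤ) : ℂ)) = ε by push_cast; ring]
    rw [show 2 * ((ε * D.height a - v + 3 * D.η) / 2 - (ε * D.height a - u + D.η) / 2) =
        u - v + 2 * D.η by ring, add_sub_cancel_right,
      show (ε * D.height a - u + D.η) / 2 + D.η = (ε * D.height a - u + 3 * D.η) / 2 by ring,
      show (ε * D.height a - v + 3 * D.η) / 2 - D.η = (ε * D.height a - v + D.η) / 2 by ring] at h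
    exact h
  have key2 : ∀ ε : ℤ, (ε = 1 ∨ ε = -1) → ∀ u v i j,
      sApply D (u - v) (half D a (a + ε) u) (half D (a + ε) a v) i j =
        D.th 1 1 (ε * D.height a - (u - v)) / D.th 1 1 (ε * D.height a) *
          (half D (a + ε) a u i * half D a (a + ε) v j) +
        D.th 1 1 (u - v) * D.th 1 1 (ε * D.height a + 2 * D.η) /
            (D.th 1 1 (ε * D.height a) * D.th 1 1 (2 * D.η)) *
          (half D (a - ε) a u i * half D a (a - ε) v j) := by
    intro ε hε u v i j
    have hl : D.th 1 1 (ε * D.height a) ≠ 0 := by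
      rcases hε with rfl | rfl
      · simpa using hlam a
      · simpa [Params.th11_neg] using hlam a
    have e2 : (ε : ℂ) ^ 2 = 1 := by rcases hε with rfl | rfl <;> norm_num
    have h1 : ∀ w, half D (a + ε) a w = pv D ((ε * D.height a + w + D.η) / 2) := by
      intro w
      rw [half, ← pv_neg]; congr 1
      simp only [Params.height]; push_cast
      linear_combination e2 * D.η
    have h2 : ∀ w, half D (a - ε) a w = pv D ((ε * D.height a - w - D.η) / 2) := by
      intro w
      rw [half]; congr 1
      simp only [Params.height]; push_cast
      linear_combination -e2 * D.η
    have h3 : ∀ w, half D a (a + ε) w = pv D ((ε * D.height a - w + D.η) / 2) := by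
      intro w
      rw [half]; congr 1; push_cast; ring
    have h4 : ∀ w, half D a (a - ε) w = pv D ((ε * D.height a + w - D.η) / 2) := by
      intro w
      rw [half, ← pv_neg]; congr 1; push_cast; ring
    rw [h1, h1, h2, h3, h3, h4]
    exact sApply_pv_return hη hl u v i j
  obtain ⟨ε, hε, rfl⟩ : ∃ ε : ℤ, (ε = 1 ∨ ε = -1) ∧ b = a + ε := by
    rcases hab with rfl | rfl
    exacts [⟨1, Or.inl rfl, rfl⟩, ⟨-1, Or.inr rfl, rfl⟩]
  have hc : c = a + ε + ε ∨ c = a := by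
    rcases hbc with rfl | rfl <;> rcases hε with rfl | rfl <;> omega
  rcases hc with rfl | rfl
  · refine ⟨{a + ε}, fun _ t => D.th 1 1 (t + 2 * D.η) / D.th 1 1 (2 * D.η), ?_,
      fun _ => by fun_prop, fun u v i j => by rw [Finset.sum_singleton]; exact key1 ε hε u v i j⟩
    simp only [Finset.mem_singleton, forall_eq]
    exact ⟨hab, hbc⟩
  · refine ⟨{c + ε, c - ε}, fun b' t => if b' = c + ε then
      D.th 1 1 (ε * D.height c - t) / D.th 1 1 (ε * D.height c) else
      D.th 1 1 t * D.th 1 1 (ε * D.height c + 2 * D.η) /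
            (D.th 1 1 (ε * D.height c) * D.th 1 1 (2 * D.η)), ?_, fun b' => ?_, fun u v i j => ?_⟩
    · intro b' hb'
      simp only [Finset.mem_insert, Finset.mem_singleton] at hb'
      simp only [HStep]
      omega
    · dsimp only
      split_ifs <;> fun_prop
    · have hne : c + ε ≠ c - ε := by omega
      rw [Finset.sum_pair hne]
      simp only [if_true, hne.symm, if_false]
      exact key2 ε hε u v i j

end SpinHalf

/-! ### The Yang--Baxter equation and unitarity in terms of Pauli matrices -/

section Pauli

/-- The index of the Pauli matrix proportional to `σ^a σ^b`. -/
def pauliIdx (a b : Fin 4) : Fin 4 :=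
  (![![0, 1, 2, 3], ![1, 0, 3, 2], ![2, 3, 0, 1], ![3, 2, 1, 0]] : Fin 4 → Fin 4 → Fin 4) a b

/-- The scalar in `σ^a σ^b = (scalar) σ^c`. -/
def pauliPhase (a b : Fin 4) : ℂ :=
  (![![1, 1, 1, 1], ![1, 1, Complex.I, -Complex.I], ![1, -Complex.I, 1, Complex.I],
    ![1, Complex.I, -Complex.I, 1]] : Fin 4 → Fin 4 → ℂ) a b

theorem pauli_mul (a b : Fin 4) :
    pauli a * pauli b = pauliPhase a b • pauli (pauliIdx a b) := by
  fin_cases a <;> fin_cases b <;> ext i j <;> fin_cases i <;> fin_cases j <;>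
    simp [pauli, pauliPhase, pauliIdx, Matrix.mul_apply, Fin.sum_univ_two]

theorem pauliIdx_involutive (a : Fin 4) : Function.Involutive (pauliIdx a) := by
  intro b; revert a b; decide

theorem pauliIdx_comm (a b : Fin 4) : pauliIdx a b = pauliIdx b a := by
  revert a b; decide

/-- The index law is that of the Klein four-group, in which `(ab)(ac) = bc`. -/
theorem pauliIdx_idx (a b c : Fin 4) :
    pauliIdx (pauliIdx a b) (pauliIdx a c) = pauliIdx b c := by
  revert a b c; decide

variable {D : Params}

theorem vt_zero_neg (x : ℂ) : D.vt 0 (-x) = -D.vt 0 x := D.th11_neg x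
theorem vt_one_neg (x : ℂ) : D.vt 1 (-x) = D.vt 1 x := D.th10_neg x
theorem vt_two_neg (x : ℂ) : D.vt 2 (-x) = D.vt 2 x := D.th00_neg x
theorem vt_three_neg (x : ℂ) : D.vt 3 (-x) = D.vt 3 x := D.th01_neg x

/-- A quartic theta relation with mixed characteristics. -/
theorem vt_quartic {x₁ x₂ x₃ x₄ : ℂ} (h : x₁ + x₃ = x₂ + x₄) :
    D.vt 0 x₁ * D.vt 1 x₂ * D.vt 2 x₃ * D.vt 3 x₄ - D.vt 1 x₁ * D.vt 0 x₂ * D.vt 3 x₃ * D.vt 2 x₄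
      + D.vt 2 x₁ * D.vt 3 x₂ * D.vt 0 x₃ * D.vt 1 x₄
      - D.vt 3 x₁ * D.vt 2 x₂ * D.vt 1 x₃ * D.vt 0 x₄ = 0 := by
  -- Each term is grouped into a `θ₁₀θ₁₁` pair and a `θ₀₀θ₀₁` pair. Because `x₂ - x₁ = x₃ - x₄`, all
  -- pairs expand in the same values, and the terms cancel.
  have a1 := D.th10_mul_th11 x₂ x₁
  have a2 := D.th10_mul_th11 x₁ x₂
  have a3 := D.th10_mul_th11 x₃ x₄
  have a4 := D.th10_mul_th11 x₄ x₃
  have b1 := D.th00_mul_th01 x₂ x₁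
  have b2 := D.th00_mul_th01 x₁ x₂
  have b3 := D.th00_mul_th01 x₃ x₄
  have b4 := D.th00_mul_th01 x₄ x₃
  rw [show x₂ + x₁ = x₁ + x₂ by ring, show x₂ - x₁ = x₃ - x₄ by linear_combination -h] at a1 b1
  rw [show x₁ - x₂ = -(x₃ - x₄) by linear_combination h, D.thGh_neg, D.thHh_neg] at a2 b2
  rw [show x₄ + x₃ = x₃ + x₄ by ring, show x₄ - x₃ = -(x₃ - x₄) by ring, D.thGh_neg,
    D.thHh_neg] at a4 b4
  have e : ∀ a b c d : ℂ, a * b * c * d = (b * a) * (c * d) := fun a b c d => by ring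
  have e' : ∀ a b c d : ℂ, a * b * c * d = (a * b) * (d * c) := fun a b c d => by ring
  have e1 : D.vt 0 x₁ * D.vt 1 x₂ * D.vt 2 x₃ * D.vt 3 x₄ =
      (D.th 1 0 x₂ * D.th 1 1 x₁) * (D.th 0 0 x₃ * D.th 0 1 x₄) := e _ _ _ _
  have e2 : D.vt 1 x₁ * D.vt 0 x₂ * D.vt 3 x₃ * D.vt 2 x₄ =
      (D.th 1 0 x₁ * D.th 1 1 x₂) * (D.th 0 0 x₄ * D.th 0 1 x₃) := e' _ _ _ _
  have e3 : D.vt 2 x₁ * D.vt 3 x₂ * D.vt 0 x₃ * D.vt 1 x₄ =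
      (D.th 0 0 x₁ * D.th 0 1 x₂) * (D.th 1 0 x₄ * D.th 1 1 x₃) := e' _ _ _ _
  have e4 : D.vt 3 x₁ * D.vt 2 x₂ * D.vt 1 x₃ * D.vt 0 x₄ =
      (D.th 0 0 x₂ * D.th 0 1 x₁) * (D.th 1 0 x₃ * D.th 1 1 x₄) := e _ _ _ _
  rw [e1, e2, e3, e4, a1, a2, a3, a4, b1, b2, b3, b4]
  ring

/-- When `a, b, c, d` are all four indices, the denominator becomes the symmetric one and the
missing factor `ϑ_d(η)` appears in the numerator, as the fourth factor needed in `vt_quartic`. -/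
theorem sCoeff_mul_eq (hη : D.th 1 1 (2 * D.η) ≠ 0) {a b c d : Fin 4} (u v w : ℂ)
    (h : D.vt a D.η * D.vt b D.η * D.vt c D.η * D.vt d D.η =
      D.vt 0 D.η * D.vt 1 D.η * D.vt 2 D.η * D.vt 3 D.η) :
    sCoeff D u a * sCoeff D v b * sCoeff D w c =
      D.vt a (u + D.η) * D.vt b (v + D.η) * D.vt c (w + D.η) * D.vt d D.η /
        (8 * (D.vt 0 D.η * D.vt 1 D.η * D.vt 2 D.η * D.vt 3 D.η)) := by
  have ha := Params.vt_ne_zero hη a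
  have hb := Params.vt_ne_zero hη b
  have hc := Params.vt_ne_zero hη c
  have hd := Params.vt_ne_zero hη d
  rw [← h]
  simp only [sCoeff]
  field_simp
  ring

/-- This is the coefficient of `σ^p ⊗ σ^q ⊗ σ^{pq}` in the Yang-Baxter equation. If `p = 0`, `q = 0`
or `p = q`, the phases on the two sides agree. Each of the six remaining cases is one instance of
`vt_quartic` with suitably permuted and signed arguments. -/
theorem yangBaxter_coeff (hη : D.th 1 1 (2 * D.η) ≠ 0) (u v : ℂ) (p q : Fin 4) :
    ∑ a, sCoeff D u a * sCoeff D (u + v) (pauliIdx a p) * sCoeff D v (pauliIdx a q) *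
      (pauliPhase a (pauliIdx a p) * pauliPhase a (pauliIdx a q) *
          pauliPhase (pauliIdx a p) (pauliIdx a q) -
        pauliPhase (pauliIdx a p) a * pauliPhase (pauliIdx a q) a *
          pauliPhase (pauliIdx a q) (pauliIdx a p)) = 0 := by
  have q1 := vt_quartic (D := D) (x₁ := u + D.η) (x₂ := u + v + D.η) (x₃ := v + D.η) (x₄ := D.η)
    (by ring)
  have q2 := vt_quartic (D := D) (x₁ := u + D.η) (x₂ := -(v + D.η)) (x₃ := -(u + v + D.η))
    (x₄ := D.η) (by ring)
  have q3 := vt_quartic (D := D) (x₁ := u + D.η) (x₂ := u + v + D.η) (x₃ := -D.η)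
    (x₄ := -(v + D.η)) (by ring)
  have q4 := vt_quartic (D := D) (x₁ := u + D.η) (x₂ := -(v + D.η)) (x₃ := -D.η)
    (x₄ := u + v + D.η) (by ring)
  have q5 := vt_quartic (D := D) (x₁ := u + D.η) (x₂ := D.η) (x₃ := -(u + v + D.η))
    (x₄ := -(v + D.η)) (by ring)
  have q6 := vt_quartic (D := D) (x₁ := u + D.η) (x₂ := D.η) (x₃ := v + D.η) (x₄ := u + v + D.η)
    (by ring)
  simp only [vt_zero_neg, vt_one_neg, vt_two_neg, vt_three_neg] at q1 q2 q3 q4 q5 q6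
  set E := 8 * (D.vt 0 D.η * D.vt 1 D.η * D.vt 2 D.η * D.vt 3 D.η) with hE
  have I2 := Complex.I_sq
  have hs : ∀ a b c d : Fin 4, _ → _ := fun a b c d h =>
    sCoeff_mul_eq hη (a := a) (b := b) (c := c) (d := d) u (u + v) v h
  fin_cases p <;> fin_cases q <;> rw [Fin.sum_univ_four] <;>
    simp [pauliIdx, pauliPhase]
  · rw [hs 0 1 2 3 (by ring), hs 1 0 3 2 (by ring), hs 2 3 0 1 (by ring), hs 3 2 1 0 (by ring)]
    linear_combination 2 * Complex.I / E * q1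
  · rw [hs 0 1 3 2 (by ring), hs 1 0 2 3 (by ring), hs 2 3 1 0 (by ring), hs 3 2 0 1 (by ring)]
    linear_combination -2 * Complex.I / E * q3
  · rw [hs 0 2 1 3 (by ring), hs 1 3 0 2 (by ring), hs 2 0 3 1 (by ring), hs 3 1 2 0 (by ring)]
    linear_combination -2 * Complex.I / E * q2
  · rw [hs 0 2 3 1 (by ring), hs 1 3 2 0 (by ring), hs 2 0 1 3 (by ring), hs 3 1 0 2 (by ring)]
    linear_combination 2 * Complex.I / E * q5
  · rw [hs 0 3 1 2 (by ring), hs 1 2 0 3 (by ring), hs 2 1 3 0 (by ring), hs 3 0 2 1 (by ring)]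
    linear_combination 2 * Complex.I / E * q4
  · rw [hs 0 3 2 1 (by ring), hs 1 2 3 0 (by ring), hs 2 1 0 3 (by ring), hs 3 0 1 2 (by ring)]
    linear_combination -2 * Complex.I / E * q6

/-- The coefficient of `σ^p ⊗ σ^p` in `R(-t)R(t)`; again one quartic relation for each `p`. -/
theorem unitarity_coeff (hη : D.th 1 1 (2 * D.η) ≠ 0) (t : ℂ) {p : Fin 4} (hp : p ≠ 0) :
    ∑ a, sCoeff D (-t) a * sCoeff D t (pauliIdx a p) * pauliPhase a (pauliIdx a p) ^ 2 = 0 := by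
  have q1 := vt_quartic (D := D) (x₁ := -t + D.η) (x₂ := -(t + D.η)) (x₃ := -D.η) (x₄ := D.η)
    (by ring)
  have q2 := vt_quartic (D := D) (x₁ := -t + D.η) (x₂ := D.η) (x₃ := t + D.η) (x₄ := D.η)
    (by ring)
  have q3 := vt_quartic (D := D) (x₁ := -t + D.η) (x₂ := D.η) (x₃ := -D.η) (x₄ := -(t + D.η))
    (by ring)
  simp only [vt_zero_neg, vt_one_neg, vt_two_neg, vt_three_neg] at q1 q2 q3
  have h0 := Params.vt_ne_zero hη 0
  have h1 := Params.vt_ne_zero hη 1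
  have h2 := Params.vt_ne_zero hη 2
  have h3 := Params.vt_ne_zero hη 3
  fin_cases p
  · exact absurd rfl hp
  all_goals
    rw [Fin.sum_univ_four]
    simp [pauliIdx, pauliPhase, sCoeff]
    field_simp
  · linear_combination q1
  · linear_combination q2
  · linear_combination q3

theorem sum_sum_pauliIdx {M : Type*} [AddCommMonoid M] (f : Fin 4 → Fin 4 → M) :
    ∑ a, ∑ b, f a b = ∑ p, ∑ a, f a (pauliIdx a p) := by
  rw [Finset.sum_comm (γ := Fin 4) (f := fun p a => f a (pauliIdx a p))]
  exact Finset.sum_congr rfl fun a _ =>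
    (Equiv.sum_comp (pauliIdx_involutive a).toPerm (f a)).symm

variable {M : Type*} [AddCommMonoid M] [Module ℂ M]

/-- The Yang--Baxter equation, for an arbitrary realization of triples of matrices. -/
theorem yangBaxter_sum (hη : D.th 1 1 (2 * D.η) ≠ 0) (u v : ℂ)
    (T : Matrix (Fin 2) (Fin 2) ℂ → Matrix (Fin 2) (Fin 2) ℂ → Matrix (Fin 2) (Fin 2) ℂ → M)
    (hT : ∀ (x y z : ℂ) A B C, T (x • A) (y • B) (z • C) = (x * y * z) • T A B C) :
    ∑ a, ∑ b, ∑ c, (sCoeff D u a * sCoeff D (u + v) b * sCoeff D v c) •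
        T (pauli a * pauli b) (pauli a * pauli c) (pauli b * pauli c) =
      ∑ a, ∑ b, ∑ c, (sCoeff D u a * sCoeff D (u + v) b * sCoeff D v c) •
        T (pauli b * pauli a) (pauli c * pauli a) (pauli c * pauli b) := by
  -- In a `ℂ`-module negatives exist as multiples by `-1`, so the two sides may be subtracted.
  let _ : AddCommGroup M := Module.addCommMonoidToAddCommGroup ℂ
  rw [← sub_eq_zero]
  simp only [← Finset.sum_sub_distrib, pauli_mul, hT, smul_smul]
  have e : ∀ a b c : Fin 4,
      (sCoeff D u a * sCoeff D (u + v) b * sCoeff D v c *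
          (pauliPhase a b * pauliPhase a c * pauliPhase b c)) •
        T (pauli (pauliIdx a b)) (pauli (pauliIdx a c)) (pauli (pauliIdx b c)) -
      (sCoeff D u a * sCoeff D (u + v) b * sCoeff D v c *
          (pauliPhase b a * pauliPhase c a * pauliPhase c b)) •
        T (pauli (pauliIdx b a)) (pauli (pauliIdx c a)) (pauli (pauliIdx c b)) =
      (sCoeff D u a * sCoeff D (u + v) b * sCoeff D v c *
          (pauliPhase a b * pauliPhase a c * pauliPhase b c -
            pauliPhase b a * pauliPhase c a * pauliPhase c b)) •
        T (pauli (pauliIdx a b)) (pauli (pauliIdx a c)) (pauli (pauliIdx b c)) := by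
    intro a b c
    rw [pauliIdx_comm b a, pauliIdx_comm c a, pauliIdx_comm c b, ← sub_smul, ← mul_sub]
  simp only [e]
  rw [sum_sum_pauliIdx]
  refine Finset.sum_eq_zero fun p _ => ?_
  rw [sum_sum_pauliIdx]
  refine Finset.sum_eq_zero fun q _ => ?_
  simp only [pauliIdx_involutive _ _, pauliIdx_idx]
  rw [← Finset.sum_smul, yangBaxter_coeff hη, zero_smul]

/-- Substituting `b = a·p` sorts the product by the resulting `σ^p ⊗ σ^p`; only `p = 0` survives. -/
theorem unitarity_sum_aux (hη : D.th 1 1 (2 * D.η) ≠ 0) (t : ℂ)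
    (T : Matrix (Fin 2) (Fin 2) ℂ → Matrix (Fin 2) (Fin 2) ℂ → M)
    (hT : ∀ (x y : ℂ) A B, T (x • A) (y • B) = (x * y) • T A B) :
    ∑ a, ∑ b, (sCoeff D (-t) a * sCoeff D t b) • T (pauli a * pauli b) (pauli a * pauli b) =
      (∑ a, sCoeff D (-t) a * sCoeff D t a) • T 1 1 := by
  simp only [pauli_mul, hT, smul_smul]
  rw [sum_sum_pauliIdx]
  simp only [pauliIdx_involutive _ _, ← pow_two]
  rw [Finset.sum_eq_single 0]
  · rw [← Finset.sum_smul]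
    congr 1
    · refine Finset.sum_congr rfl fun a _ => ?_
      fin_cases a <;> simp [pauliIdx, pauliPhase]
    · have : pauli 0 = 1 := by
        ext i j; fin_cases i <;> fin_cases j <;> simp [pauli]
      rw [this]
  · intro p _ hp
    rw [← Finset.sum_smul, unitarity_coeff hη t hp, zero_smul]
  · simp

theorem pv_ne_zero (hη : D.th 1 1 (2 * D.η) ≠ 0) (x : ℂ) : ∃ i, pv D x i ≠ 0 := by
  by_contra! h
  have hth := D.differentiable_th 1 1
  refine hη ?_
  have := eq_zero_of_mul_eq_zero_of_differentiable (f := fun y => D.th 1 1 (x + y))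
    (g := fun y => D.th 1 1 (x - y)) (by fun_prop) (by fun_prop) (fun y => ?_)
    (w := x - 2 * D.η) (by simpa using hη) (2 * D.η - x)
  · simpa using this
  · have h2 := om_pv D y x
    rw [om, h 0, h 1] at h2
    linear_combination 2 * h2

/-- The scalar `R(-t)R(t)` is found on one vector: for `w = x + t/2 + η` the tensor `pv x ⊗ pv w` is
sent by `R(t)` to a multiple of `pv (x+η) ⊗ pv (w-η)` and by `R(-t)` back, both times by
`sApply_pv_eq`. -/
theorem sum_sCoeff_mul (hη : D.th 1 1 (2 * D.η) ≠ 0) (t : ℂ) :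
    ∑ a, sCoeff D (-t) a * sCoeff D t a =
      D.th 1 1 (t + 2 * D.η) / D.th 1 1 (2 * D.η) *
        (D.th 1 1 (-t + 2 * D.η) / D.th 1 1 (2 * D.η)) := by
  obtain ⟨x, w, hw⟩ : ∃ x w : ℂ, w = x + t / 2 + D.η := ⟨0, _, rfl⟩
  obtain ⟨i, hi⟩ := pv_ne_zero hη x
  obtain ⟨j, hj⟩ := pv_ne_zero hη w
  have h := unitarity_sum_aux (D := D) hη t
    (fun A B => A.mulVec (pv D x) i * B.mulVec (pv D w) j) (fun a b A B => by
      simp only [Matrix.smul_mulVec, Pi.smul_apply, smul_eq_mul]; ring)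
  have e1 := fun i j => sApply_pv_eq hη x w i j
  have e2 := fun i j => sApply_pv_eq hη (w - D.η) (x + D.η) i j
  rw [show 2 * (w - x) - 2 * D.η = t by rw [hw]; ring,
    show 2 * (w - x) = t + 2 * D.η by rw [hw]; ring] at e1
  rw [show 2 * (x + D.η - (w - D.η)) - 2 * D.η = -t by rw [hw]; ring,
    show 2 * (x + D.η - (w - D.η)) = -t + 2 * D.η by rw [hw]; ring, sub_add_cancel,
    add_sub_cancel_right] at e2
  have key : ∑ a, ∑ b, (sCoeff D (-t) a * sCoeff D t b) •
      ((pauli a * pauli b).mulVec (pv D x) i * (pauli a * pauli b).mulVec (pv D w) j) =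
      ∑ a, sCoeff D (-t) a * ∑ k, ∑ l, pauli a i k * pauli a j l *
        sApply D t (pv D x) (pv D w) k l := by
    refine Finset.sum_congr rfl fun a _ => ?_
    simp only [← Matrix.mulVec_mulVec, sApply, smul_eq_mul]
    simp only [Matrix.mulVec, dotProduct, Fin.sum_univ_two, Fin.sum_univ_four]
    ring
  have key2 : ∑ a, sCoeff D (-t) a * ∑ k, ∑ l, pauli a i k * pauli a j l *
        sApply D t (pv D x) (pv D w) k l = D.th 1 1 (t + 2 * D.η) / D.th 1 1 (2 * D.η) *
        sApply D (-t) (pv D (x + D.η)) (pv D (w - D.η)) i j := by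
    simp only [e1]
    rw [sApply, Finset.mul_sum]
    refine Finset.sum_congr rfl fun a _ => ?_
    simp only [Matrix.mulVec, dotProduct, Fin.sum_univ_two]
    ring
  rw [key, key2, sApply_swap, e2] at h
  simp only [Matrix.one_mulVec, smul_eq_mul] at h
  have hne : pv D x i * pv D w j ≠ 0 := mul_ne_zero hi hj
  apply mul_right_cancel₀ hne
  linear_combination -h

/-- Unitarity of the `R` matrix, for an arbitrary realization of pairs of matrices. -/
theorem unitarity_sum (hη : D.th 1 1 (2 * D.η) ≠ 0) (t : ℂ)
    (T : Matrix (Fin 2) (Fin 2) ℂ → Matrix (Fin 2) (Fin 2) ℂ → M)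
    (hT : ∀ (x y : ℂ) A B, T (x • A) (y • B) = (x * y) • T A B) :
    ∑ a, ∑ b, (sCoeff D (-t) a * sCoeff D t b) • T (pauli a * pauli b) (pauli a * pauli b) =
      (D.th 1 1 (t + 2 * D.η) / D.th 1 1 (2 * D.η) *
        (D.th 1 1 (-t + 2 * D.η) / D.th 1 1 (2 * D.η))) • T 1 1 := by
  rw [unitarity_sum_aux hη t T hT, sum_sCoeff_mul hη]

section Algebra

variable {E : Type*} [Semiring E] [Algebra ℂ E]

/-- As the three realizations commute with one another, every triple product regroups into a value
of the trilinear map `(A, B, C) ↦ p₁ A * p₂ B * p₃ C`, to which `yangBaxter_sum` applies. -/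
theorem yangBaxter_algebra (hη : D.th 1 1 (2 * D.η) ≠ 0) (u v : ℂ)
    (p₁ p₂ p₃ : Matrix (Fin 2) (Fin 2) ℂ → E)
    (hm₁ : ∀ A B, p₁ (A * B) = p₁ A * p₁ B) (hm₂ : ∀ A B, p₂ (A * B) = p₂ A * p₂ B)
    (hm₃ : ∀ A B, p₃ (A * B) = p₃ A * p₃ B) (hs₁ : ∀ (c : ℂ) A, p₁ (c • A) = c • p₁ A)
    (hs₂ : ∀ (c : ℂ) A, p₂ (c • A) = c • p₂ A) (hs₃ : ∀ (c : ℂ) A, p₃ (c • A) = c • p₃ A)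
    (h₁₂ : ∀ A B, Commute (p₁ A) (p₂ B)) (h₁₃ : ∀ A B, Commute (p₁ A) (p₃ B))
    (h₂₃ : ∀ A B, Commute (p₂ A) (p₃ B)) :
    (∑ a, sCoeff D u a • (p₁ (pauli a) * p₂ (pauli a))) *
        (∑ b, sCoeff D (u + v) b • (p₁ (pauli b) * p₃ (pauli b))) *
        (∑ c, sCoeff D v c • (p₂ (pauli c) * p₃ (pauli c))) =
      (∑ c, sCoeff D v c • (p₂ (pauli c) * p₃ (pauli c))) *
        (∑ b, sCoeff D (u + v) b • (p₁ (pauli b) * p₃ (pauli b))) *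
        (∑ a, sCoeff D u a • (p₁ (pauli a) * p₂ (pauli a))) := by
  have h := yangBaxter_sum (D := D) hη u v (fun A B C => p₁ A * p₂ B * p₃ C)
    (fun x y z A B C => by
      simp only [hs₁, hs₂, hs₃, smul_mul_assoc, mul_smul_comm, smul_smul]
      congr 1; ring)
  have sum3 : ∀ F : Fin 4 → Fin 4 → Fin 4 → E,
      ∑ c, ∑ b, ∑ a, F a b c = ∑ a, ∑ b, ∑ c, F a b c := fun F => by
    rw [Finset.sum_congr rfl fun c _ => Finset.sum_comm, Finset.sum_comm]
    exact Finset.sum_congr rfl fun a _ => Finset.sum_comm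
  simp only [Finset.sum_mul, Finset.mul_sum, smul_mul_assoc, mul_smul_comm,
      Finset.smul_sum, smul_smul]
  convert h using 1
  · refine Eq.trans ?_ (sum3 _)
    refine Finset.sum_congr rfl fun c _ => Finset.sum_congr rfl fun b _ =>
      Finset.sum_congr rfl fun a _ => ?_
    rw [hm₁, hm₂, hm₃, (h₁₂ (pauli b) (pauli a)).symm.mul_mul_mul_comm, mul_assoc,
        (h₂₃ (pauli c) (pauli b)).symm.mul_mul_mul_comm]
    simp only [mul_assoc]
    congr 1; ring
  · refine Finset.sum_congr rfl fun a _ => Finset.sum_congr rfl fun b _ =>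
      Finset.sum_congr rfl fun c _ => ?_
    have c1 : Commute (p₃ (pauli c) * p₃ (pauli b)) (p₁ (pauli a) * p₂ (pauli a)) :=
      (((h₁₃ _ _).symm.mul_right (h₂₃ _ _).symm)).mul_left
        (((h₁₃ _ _).symm.mul_right (h₂₃ _ _).symm))
    rw [hm₁, hm₂, hm₃, (h₁₃ (pauli b) (pauli c)).symm.mul_mul_mul_comm, mul_assoc, c1.eq,
      ← mul_assoc, ← (h₁₂ (pauli b) (pauli c)).eq,
      ← mul_assoc (p₁ (pauli b) * p₂ (pauli c)),
      (h₁₂ (pauli a) (pauli c)).symm.mul_mul_mul_comm]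

theorem unitarity_algebra (hη : D.th 1 1 (2 * D.η) ≠ 0) (t : ℂ)
    (p₁ p₂ : Matrix (Fin 2) (Fin 2) ℂ → E)
    (hm₁ : ∀ A B, p₁ (A * B) = p₁ A * p₁ B) (hm₂ : ∀ A B, p₂ (A * B) = p₂ A * p₂ B)
    (hs₁ : ∀ (c : ℂ) A, p₁ (c • A) = c • p₁ A) (hs₂ : ∀ (c : ℂ) A, p₂ (c • A) = c • p₂ A)
    (ho₁ : p₁ 1 = 1) (ho₂ : p₂ 1 = 1) (h₁₂ : ∀ A B, Commute (p₁ A) (p₂ B)) :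
    (∑ a, sCoeff D (-t) a • (p₁ (pauli a) * p₂ (pauli a))) *
        (∑ a, sCoeff D t a • (p₁ (pauli a) * p₂ (pauli a))) =
      (D.th 1 1 (t + 2 * D.η) / D.th 1 1 (2 * D.η) *
        (D.th 1 1 (-t + 2 * D.η) / D.th 1 1 (2 * D.η))) • 1 := by
  have h1 := unitarity_sum (D := D) hη t (fun A B => p₁ A * p₂ B)
    (fun x y A B => by
      simp only [hs₁, hs₂, smul_mul_assoc, mul_smul_comm, smul_smul]
      congr 1; ring)
  rw [ho₁, ho₂, mul_one] at h1
  rw [← h1]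
  simp only [Finset.sum_mul, Finset.mul_sum, smul_mul_assoc, mul_smul_comm, Finset.smul_sum,
    smul_smul]
  rw [Finset.sum_comm]
  refine Finset.sum_congr rfl fun a _ => Finset.sum_congr rfl fun b _ => ?_
  rw [hm₁, hm₂, (h₁₂ (pauli b) (pauli a)).symm.mul_mul_mul_comm, mul_comm (sCoeff D t b)]

end Algebra

/-- At `t = -2η` the coefficients are `ϑ_a(-η) / 2ϑ_a(η) = ±1/2`, with the minus sign only for the
odd function `θ₁₁`, and half of `-1 + ∑ σ^a ⊗ σ^a` is the flip minus the identity. This degeneration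
is what makes fusion possible. -/
theorem sApply_neg_two_eta (hη : D.th 1 1 (2 * D.η) ≠ 0) (v w : Fin 2 → ℂ) (i j : Fin 2) :
    sApply D (-(2 * D.η)) v w i j = w i * v j - v i * w j := by
  have h0 := Params.vt_ne_zero hη 0
  have h1 := Params.vt_ne_zero hη 1
  have h2 := Params.vt_ne_zero hη 2
  have h3 := Params.vt_ne_zero hη 3
  have e : ∀ x y : ℂ, y ≠ 0 → x / (2 * y) = 1 / 2 * (x / y) := fun x y _ => by ring
  simp only [sApply, sCoeff, Fin.sum_univ_four, show -(2 * D.η) + D.η = -D.η by ring,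
    vt_zero_neg, vt_one_neg, vt_two_neg, vt_three_neg, e _ _ h0, e _ _ h1, e _ _ h2, e _ _ h3,
    neg_div, div_self h0, div_self h1, div_self h2, div_self h3]
  have I2 := Complex.I_mul_I
  fin_cases i <;> fin_cases j <;> simp [pauli, Matrix.mulVec, dotProduct] <;> ring_nf <;>
    simp only [Complex.I_sq] <;> ring

end Pauli

/-! ### Operators on the tensor product of all copies of `ℂ²` -/

section Sites

/-- The labels of all copies of `ℂ²`. -/
abbrev Site {N : ℕ} (n : Fin N → ℕ) : Type := Σ i, Fin (n i)

variable {N : ℕ} {n : Fin N → ℕ}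

/-- The pure tensor with the components `f`. -/
def tpr (f : Site n → Fin 2 → ℂ) : BigSpace n :=
  PiTensorProduct.tprod ℂ fun i => PiTensorProduct.tprod ℂ fun x => f ⟨i, x⟩

theorem tpr_update (f : Site n → Fin 2 → ℂ) (s : Site n) (v : Fin 2 → ℂ) :
    tpr (Function.update f s v) = PiTensorProduct.tprod ℂ
      (Function.update (fun i => PiTensorProduct.tprod ℂ fun x => f ⟨i, x⟩) s.1
        (PiTensorProduct.tprod ℂ (Function.update (fun x => f ⟨s.1, x⟩) s.2 v))) := by
  rw [tpr]
  congr 1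
  funext i
  obtain ⟨k, y⟩ := s
  by_cases h : i = k
  · subst h
    rw [Function.update_self]
    congr 1
    funext x
    by_cases hx : x = y
    · subst hx; simp
    · rw [Function.update_of_ne hx, Function.update_of_ne]
      simpa using hx
  · rw [Function.update_of_ne h]
    congr 1
    funext x
    rw [Function.update_of_ne]
    intro h'
    exact h (congrArg Sigma.fst h')

/-- `tpr` as a linear function of one component. -/
def tprLin (f : Site n → Fin 2 → ℂ) (s : Site n) : (Fin 2 → ℂ) →ₗ[ℂ] BigSpace n :=
  ((PiTensorProduct.tprod ℂ).toLinearMap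
      (fun i => PiTensorProduct.tprod ℂ fun x => f ⟨i, x⟩) s.1) ∘ₗ
    ((PiTensorProduct.tprod ℂ).toLinearMap (fun x => f ⟨s.1, x⟩) s.2)

theorem tprLin_apply (f : Site n → Fin 2 → ℂ) (s : Site n) (v : Fin 2 → ℂ) :
    tprLin f s v = tpr (Function.update f s v) := by
  rw [tpr_update]; rfl

theorem bigSpace_ext {M : Type*} [AddCommMonoid M] [Module ℂ M] {φ ψ : BigSpace n →ₗ[ℂ] M}
    (h : ∀ f, φ (tpr f) = ψ (tpr f)) : φ = ψ := by
  refine (Basis.piTensorProduct fun i => Basis.piTensorProduct fun _ : Fin (n i) =>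
    Pi.basisFun ℂ (Fin 2)).ext fun p => ?_
  rw [Basis.piTensorProduct_apply]
  simp only [Basis.piTensorProduct_apply]
  exact h fun s => Pi.basisFun ℂ (Fin 2) (p s.1 s.2)

/-- The matrix `A` acting on the copy `s` of `ℂ²`. -/
def sOp (s : Site n) (A : Matrix (Fin 2) (Fin 2) ℂ) : Module.End ℂ (BigSpace n) :=
  siteOp n s.1 s.2 A

theorem sOp_tpr (s : Site n) (A : Matrix (Fin 2) (Fin 2) ℂ) (f : Site n → Fin 2 → ℂ) :
    sOp s A (tpr f) = tpr (Function.update f s (A.mulVec (f s))) := by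
  rw [tpr_update, sOp, siteOp, tpr, PiTensorProduct.map_tprod]
  congr 1
  funext i
  by_cases h : i = s.1
  · subst h
    simp only [Function.update_self, PiTensorProduct.map_tprod]
    congr 1
    funext x
    by_cases hx : x = s.2
    · subst hx; simp
    · simp [Function.update_of_ne hx]
  · simp [Function.update_of_ne h]

theorem sOp_mul (s : Site n) (A B : Matrix (Fin 2) (Fin 2) ℂ) :
    sOp s (A * B) = sOp s A * sOp s B := by
  refine bigSpace_ext fun f => ?_
  rw [Module.End.mul_apply, sOp_tpr, sOp_tpr, sOp_tpr, Function.update_self,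
    Function.update_idem, Matrix.mulVec_mulVec]

theorem sOp_one (s : Site n) : sOp s 1 = 1 := by
  refine bigSpace_ext fun f => ?_
  rw [sOp_tpr]
  simp

theorem sOp_smul (s : Site n) (c : ℂ) (A : Matrix (Fin 2) (Fin 2) ℂ) :
    sOp s (c • A) = c • sOp s A := by
  refine bigSpace_ext fun f => ?_
  rw [LinearMap.smul_apply, sOp_tpr, sOp_tpr, Matrix.smul_mulVec, ← tprLin_apply, map_smul,
    tprLin_apply]

theorem sOp_commute {s s' : Site n} (h : s ≠ s') (A B : Matrix (Fin 2) (Fin 2) ℂ) :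
    Commute (sOp s A) (sOp s' B) := by
  refine bigSpace_ext fun f => ?_
  rw [Module.End.mul_apply, Module.End.mul_apply, sOp_tpr, sOp_tpr, sOp_tpr, sOp_tpr,
    Function.update_of_ne h, Function.update_of_ne h.symm, Function.update_comm h]

variable (D : Params)

/-- The `R` matrix without its scalar factor, acting on the copies `s` and `s'` of `ℂ²`. -/
def sR (s s' : Site n) (t : ℂ) : Module.End ℂ (BigSpace n) :=
  ∑ a, sCoeff D t a • (sOp s (pauli a) * sOp s' (pauli a))

variable {D}

theorem commute_sR {s₁ s₂ s₃ s₄ : Site n} (h₁₃ : s₁ ≠ s₃) (h₁₄ : s₁ ≠ s₄) (h₂₃ : s₂ ≠ s₃)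
    (h₂₄ : s₂ ≠ s₄) (t t' : ℂ) : Commute (sR D s₁ s₂ t) (sR D s₃ s₄ t') := by
  refine Commute.sum_left _ _ _ fun a _ => Commute.sum_right _ _ _ fun b _ => ?_
  refine (Commute.smul_left ?_ _).smul_right _
  exact ((sOp_commute h₁₃ _ _).mul_right (sOp_commute h₁₄ _ _)).mul_left
    ((sOp_commute h₂₃ _ _).mul_right (sOp_commute h₂₄ _ _))

theorem sR_symm {s s' : Site n} (h : s ≠ s') (t : ℂ) : sR D s s' t = sR D s' s t :=
  Finset.sum_congr rfl fun a _ => by rw [sOp_commute h]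

theorem sR_yangBaxter (hη : D.th 1 1 (2 * D.η) ≠ 0) {s₁ s₂ s₃ : Site n} (h₁₂ : s₁ ≠ s₂)
    (h₁₃ : s₁ ≠ s₃) (h₂₃ : s₂ ≠ s₃) (u v : ℂ) :
    sR D s₁ s₂ u * sR D s₁ s₃ (u + v) * sR D s₂ s₃ v =
      sR D s₂ s₃ v * sR D s₁ s₃ (u + v) * sR D s₁ s₂ u := by
  exact yangBaxter_algebra hη u v (sOp s₁) (sOp s₂) (sOp s₃) (sOp_mul s₁) (sOp_mul s₂) (sOp_mul s₃)
    (sOp_smul s₁) (sOp_smul s₂) (sOp_smul s₃) (sOp_commute h₁₂) (sOp_commute h₁₃)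
    (sOp_commute h₂₃)

theorem sR_unitarity (hη : D.th 1 1 (2 * D.η) ≠ 0) {s s' : Site n} (h : s ≠ s') (t : ℂ) :
    sR D s' s (-t) * sR D s s' t = (D.th 1 1 (t + 2 * D.η) / D.th 1 1 (2 * D.η) *
        (D.th 1 1 (-t + 2 * D.η) / D.th 1 1 (2 * D.η))) • 1 := by
  rw [sR_symm h.symm]
  exact unitarity_algebra hη t (sOp s) (sOp s') (sOp_mul s) (sOp_mul s') (sOp_smul s) (sOp_smul s')
    (sOp_one s) (sOp_one s') (sOp_commute h)

/-- A bilinear form on pairs of components, evaluated through its coordinates. -/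
theorem tpr_update_update (f : Site n → Fin 2 → ℂ) {s s' : Site n} (h : s ≠ s')
    (v w : Fin 2 → ℂ) : tpr (Function.update (Function.update f s v) s' w) =
      ∑ i, ∑ j, (v i * w j) • tpr (Function.update (Function.update f s (Pi.single i 1)) s'
        (Pi.single j 1)) := by
  have e : ∀ v : Fin 2 → ℂ, v = ∑ i, v i • Pi.single i (1 : ℂ) := fun v => by
    ext k; fin_cases k <;> simp
  conv_lhs => rw [e w, ← tprLin_apply, map_sum]
  rw [Finset.sum_comm]
  refine Finset.sum_congr rfl fun j _ => ?_
  rw [map_smul, tprLin_apply, Function.update_comm h, ← tprLin_apply]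
  conv_lhs => rw [e v, map_sum]
  rw [Finset.smul_sum]
  refine Finset.sum_congr rfl fun i _ => ?_
  rw [map_smul, tprLin_apply, Function.update_comm h.symm, smul_smul, mul_comm]

theorem sR_tpr (f : Site n → Fin 2 → ℂ) {s s' : Site n} (h : s ≠ s') (t : ℂ) :
    sR D s s' t (tpr f) = ∑ i, ∑ j, sApply D t (f s) (f s') i j •
      tpr (Function.update (Function.update f s (Pi.single i 1)) s' (Pi.single j 1)) := by
  simp only [sR, LinearMap.sum_apply, LinearMap.smul_apply, Module.End.mul_apply, sOp_tpr,
    sApply, Finset.sum_smul]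
  have e : ∀ a, sCoeff D t a • tpr (Function.update (Function.update f s' ((pauli a).mulVec (f s')))
      s ((pauli a).mulVec (Function.update f s' ((pauli a).mulVec (f s')) s))) =
      ∑ i, ∑ j, (sCoeff D t a * ((pauli a).mulVec (f s) i * (pauli a).mulVec (f s') j)) •
      tpr (Function.update (Function.update f s (Pi.single i 1)) s' (Pi.single j 1)) := by
    intro a
    rw [Function.update_of_ne h, Function.update_comm h.symm, tpr_update_update f h,
      Finset.smul_sum]
    simp only [Finset.smul_sum, smul_smul]
  simp only [e]
  rw [Finset.sum_comm]
  exact Finset.sum_congr rfl fun i _ => Finset.sum_comm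

/-- Interchanging two components. -/
theorem sR_neg_two_eta_tpr (hη : D.th 1 1 (2 * D.η) ≠ 0) (f : Site n → Fin 2 → ℂ) {s s' : Site n}
    (h : s ≠ s') :
    sR D s s' (-(2 * D.η)) (tpr f) + tpr f = tpr (f ∘ Equiv.swap s s') := by
  have e1 : f ∘ Equiv.swap s s' = Function.update (Function.update f s (f s')) s' (f s) := by
    funext k
    by_cases hk' : k = s'
    · subst hk'; simp
    · by_cases hk : k = s
      · subst hk; simp [Function.update_of_ne hk']
      · simp [Function.update_of_ne hk, Function.update_of_ne hk',
          Equiv.swap_apply_of_ne_of_ne hk hk']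
  have e2 : tpr f = tpr (Function.update (Function.update f s (f s)) s' (f s')) := by simp
  conv_lhs => rw [sR_tpr f h, e2, tpr_update_update f h]
  rw [e1, tpr_update_update f h]
  simp only [← Finset.sum_add_distrib, ← add_smul, sApply_neg_two_eta hη, sub_add_cancel]

theorem halfR_eq (hη : D.th 1 1 (2 * D.η) ≠ 0) (j k : Fin N) (x : Fin (n j)) (y : Fin (n k))
    (t : ℂ) : halfR D n j k x y t =
      (D.th 1 1 (2 * D.η) / D.th 1 1 (t + 2 * D.η)) • sR D ⟨j, x⟩ ⟨k, y⟩ t := by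
  rw [halfR, sR, Finset.smul_sum]
  refine Finset.sum_congr rfl fun a _ => ?_
  rw [smul_smul]
  have h : rCoeff D t a = D.th 1 1 (2 * D.η) / D.th 1 1 (t + 2 * D.η) * sCoeff D t a := by
    rw [rCoeff, sCoeff]
    congr 1
    fin_cases a <;> simp [WL, Params.vt] <;> field_simp
  rw [h]
  rfl

end Sites

/-! ### Ordered products over rectangular grids -/

section Grid

variable {ι M : Type*} [Monoid M] (r : ι → ι → M)

/-- `r(x₁,y) r(x₂,y) ⋯` for `A = [x₁, x₂, …]`. -/
def gridCol (A : List ι) (y : ι) : M := (A.map fun x => r x y).prod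

/-- `⋯ r(x,y₂) r(x,y₁)` for `B = [y₁, y₂, …]`. -/
def gridRow (x : ι) (B : List ι) : M := (B.map fun y => r x y).reverse.prod

/-- The ordered product of all `r(x,y)` with `x` in `A` and `y` in `B`. -/
def grid (A : List ι) : List ι → M
  | [] => 1
  | y :: B => grid A B * gridCol r A y

variable {r}

theorem gridCol_cons (x : ι) (A : List ι) (y : ι) :
    gridCol r (x :: A) y = r x y * gridCol r A y := by simp [gridCol]

theorem gridRow_cons (x y : ι) (B : List ι) :
    gridRow r x (y :: B) = gridRow r x B * r x y := by simp [gridRow]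

theorem gridRow_append (x : ι) (B C : List ι) :
    gridRow r x (B ++ C) = gridRow r x C * gridRow r x B := by simp [gridRow]

theorem grid_eq_prod (A B : List ι) :
    grid r A B = (B.map fun y => gridCol r A y).reverse.prod := by
  induction B with
  | nil => simp [grid]
  | cons y B ih => simp [grid, ih]

theorem grid_nil_left (B : List ι) : grid r [] B = 1 := by
  induction B with
  | nil => rfl
  | cons y B ih => simp [grid, ih, gridCol]

theorem grid_singleton (x : ι) (B : List ι) : grid r [x] B = gridRow r x B := by
  induction B with
  | nil => rfl
  | cons y B ih => simp [grid, ih, gridCol, gridRow]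

theorem commute_gridCol {m : M} {A : List ι} {y : ι} (h : ∀ x ∈ A, Commute m (r x y)) :
    Commute m (gridCol r A y) := by
  refine Commute.list_prod_right _ _ fun a ha => ?_
  obtain ⟨x, hx, rfl⟩ := List.mem_map.1 ha
  exact h x hx

theorem commute_gridRow {m : M} {x : ι} {B : List ι} (h : ∀ y ∈ B, Commute m (r x y)) :
    Commute m (gridRow r x B) := by
  refine Commute.list_prod_right _ _ fun a ha => ?_
  obtain ⟨y, hy, rfl⟩ := List.mem_map.1 (List.mem_reverse.1 ha)
  exact h y hy

theorem commute_grid {m : M} {A B : List ι} (h : ∀ x ∈ A, ∀ y ∈ B, Commute m (r x y)) :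
    Commute m (grid r A B) := by
  induction B with
  | nil => exact Commute.one_right m
  | cons y B ih =>
    exact (ih fun x hx y' hy' => h x hx y' (List.mem_cons_of_mem _ hy')).mul_right
      (commute_gridCol fun x hx => h x hx y List.mem_cons_self)

/-- Factors without common indices commute. -/
def DisjointCommute (r : ι → ι → M) : Prop :=
  ∀ x y x' y', x ≠ x' → x ≠ y' → y ≠ x' → y ≠ y' → Commute (r x y) (r x' y')

/-- A grid is defined column by column. Factors with disjoint indices commute, so it can also be
built row by row, and the inductions below may run over either list. -/
theorem grid_cons_left (hr : DisjointCommute r) {x : ι} {A B : List ι} (hx : x ∉ A)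
    (hxB : x ∉ B) (hB : B.Nodup) (hAB : A.Disjoint B) :
    grid r (x :: A) B = gridRow r x B * grid r A B := by
  induction B with
  | nil => simp [grid, gridRow]
  | cons y B ih =>
    have hB' := List.nodup_cons.1 hB
    have hA := List.disjoint_cons_right.1 hAB
    have hxB' : x ∉ B := fun h => hxB (List.mem_cons_of_mem _ h)
    have hc : Commute (r x y) (grid r A B) := commute_grid fun x' hx' y' hy' =>
      hr x y x' y' (fun h => hx (h ▸ hx')) (fun h => hxB' (h ▸ hy')) (fun h => hA.1 (h ▸ hx'))
        (fun h => hB'.1 (h ▸ hy'))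
    rw [grid, grid, ih hxB' hB'.2 hA.2, gridCol_cons, gridRow_cons]
    simp only [mul_assoc]
    rw [← mul_assoc (grid r A B), ← hc.eq, mul_assoc]

/-- The Yang–Baxter equation. -/
def YangBaxter (r : ι → ι → M) : Prop :=
  ∀ x y w, x ≠ y → x ≠ w → y ≠ w → r x y * r x w * r y w = r y w * r x w * r x y

theorem not_mem_cons_iff {a b : ι} {C : List ι} : a ∉ b :: C ↔ a ≠ b ∧ a ∉ C := by simp

/-- The usual train argument: `r a b` is pushed past one element of `C` at a time. The next two
lemmas let `a`, then `b`, run through a list as well. -/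
theorem yangBaxter_gridRow (hr : DisjointCommute r) (hY : YangBaxter r) {a b : ι} {C : List ι}
    (hab : a ≠ b) (ha : a ∉ C) (hb : b ∉ C) (hC : C.Nodup) :
    r a b * gridRow r a C * gridRow r b C = gridRow r b C * gridRow r a C * r a b := by
  induction C with
  | nil => simp [gridRow]
  | cons c C ih =>
    have hC' := List.nodup_cons.1 hC
    have ha' := not_mem_cons_iff.1 ha
    have hb' := not_mem_cons_iff.1 hb
    have h1 : Commute (r a c) (gridRow r b C) := commute_gridRow fun y hy =>
      hr _ _ _ _ hab (fun h => ha'.2 (h ▸ hy)) (fun h => hb'.1 h.symm) (fun h => hC'.1 (h ▸ hy))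
    have h2 : Commute (r b c) (gridRow r a C) := commute_gridRow fun y hy =>
      hr _ _ _ _ hab.symm (fun h => hb'.2 (h ▸ hy)) (fun h => ha'.1 h.symm)
        (fun h => hC'.1 (h ▸ hy))
    have ih := ih ha'.2 hb'.2 hC'.2
    have hy := hY a b c hab ha'.1 hb'.1
    rw [gridRow_cons, gridRow_cons]
    calc r a b * (gridRow r a C * r a c) * (gridRow r b C * r b c)
        = r a b * gridRow r a C * (r a c * gridRow r b C) * r b c := by simp only [mul_assoc]
      _ = (r a b * gridRow r a C * gridRow r b C) * r a c * r b c := by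
        rw [h1.eq]; simp only [mul_assoc]
      _ = gridRow r b C * gridRow r a C * (r a b * r a c * r b c) := by
        rw [ih]; simp only [mul_assoc]
      _ = gridRow r b C * (gridRow r a C * r b c) * r a c * r a b := by
        rw [hy]; simp only [mul_assoc]
      _ = _ := by rw [← h2.eq]; simp only [mul_assoc]

theorem yangBaxter_gridCol (hr : DisjointCommute r) (hY : YangBaxter r) {b : ι} {A C : List ι}
    (hA : A.Nodup) (hbA : b ∉ A) (hbC : b ∉ C) (hC : C.Nodup) (hAC : A.Disjoint C) :
    gridCol r A b * grid r A C * gridRow r b C = gridRow r b C * grid r A C * gridCol r A b := by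
  induction A with
  | nil => simp [gridCol, grid_nil_left]
  | cons a A ih =>
    have hA' := List.nodup_cons.1 hA
    have hbA' := not_mem_cons_iff.1 hbA
    have hAC' := List.disjoint_cons_left.1 hAC
    have h1 : Commute (gridRow r a C) (gridCol r A b) := commute_gridCol fun x hx =>
      (commute_gridRow fun y hy => hr x b a y (fun h => hA'.1 (h ▸ hx))
        (fun h => hAC'.2 hx (h ▸ hy)) hbA'.1 (fun h => hbC (h ▸ hy))).symm
    have h2 : Commute (r a b) (grid r A C) := commute_grid fun x hx y hy =>
      hr _ _ _ _ (fun h => hA'.1 (h ▸ hx)) (fun h => hAC'.1 (h ▸ hy)) (fun h => hbA'.2 (h ▸ hx))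
        (fun h => hbC (h ▸ hy))
    have ih := ih hA'.2 hbA'.2 hAC'.2
    have hy := yangBaxter_gridRow hr hY hbA'.1.symm hAC'.1 hbC hC
    rw [gridCol_cons, grid_cons_left hr hA'.1 hAC'.1 hC hAC'.2]
    calc r a b * gridCol r A b * (gridRow r a C * grid r A C) * gridRow r b C
        = r a b * (gridCol r A b * gridRow r a C) * grid r A C * gridRow r b C := by
          simp only [mul_assoc]
      _ = r a b * gridRow r a C * (gridCol r A b * grid r A C * gridRow r b C) := by
        rw [← h1.eq]; simp only [mul_assoc]
      _ = (r a b * gridRow r a C * gridRow r b C) * grid r A C * gridCol r A b := by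
        rw [ih]; simp only [mul_assoc]
      _ = gridRow r b C * gridRow r a C * (r a b * grid r A C) * gridCol r A b := by
        rw [hy]; simp only [mul_assoc]
      _ = _ := by rw [h2.eq]; simp only [mul_assoc]

theorem yangBaxter_grid (hr : DisjointCommute r) (hY : YangBaxter r) {A B C : List ι}
    (hA : A.Nodup) (hB : B.Nodup) (hC : C.Nodup) (hAB : A.Disjoint B) (hAC : A.Disjoint C)
    (hBC : B.Disjoint C) :
    grid r A B * grid r A C * grid r B C = grid r B C * grid r A C * grid r A B := by
  induction B with
  | nil => simp [grid, grid_nil_left]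
  | cons b B ih =>
    have hB' := List.nodup_cons.1 hB
    have hAB' := List.disjoint_cons_right.1 hAB
    have hBC' := List.disjoint_cons_left.1 hBC
    have h1 : Commute (gridRow r b C) (grid r A B) := commute_grid fun x hx y hy =>
      (commute_gridRow fun c hc => hr x y b c (fun h => hAB'.1 (h ▸ hx))
        (fun h => hAC hx (h ▸ hc)) (fun h => hB'.1 (h ▸ hy)) (fun h => hBC'.2 hy (h ▸ hc))).symm
    have h2 : Commute (grid r B C) (gridCol r A b) := commute_gridCol fun x hx =>
      (commute_grid fun y hy c hc => hr x b y c (fun h => hAB'.2 hx (h ▸ hy))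
        (fun h => hAC hx (h ▸ hc)) (fun h => hB'.1 (h ▸ hy)) (fun h => hBC'.1 (h ▸ hc))).symm
    have ih := ih hB'.2 hAB'.2 hBC'.2
    have hy := yangBaxter_gridCol hr hY hA hAB'.1 hBC'.1 hC hAC
    rw [grid, grid_cons_left hr hB'.1 hBC'.1 hC hBC'.2]
    calc grid r A B * gridCol r A b * grid r A C * (gridRow r b C * grid r B C)
        = grid r A B * (gridCol r A b * grid r A C * gridRow r b C) * grid r B C := by
          simp only [mul_assoc]
      _ = (grid r A B * gridRow r b C) * grid r A C * (gridCol r A b * grid r B C) := by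
        rw [hy]; simp only [mul_assoc]
      _ = gridRow r b C * (grid r A B * grid r A C * grid r B C) * gridCol r A b := by
        rw [← h1.eq, ← h2.eq]; simp only [mul_assoc]
      _ = _ := by rw [ih]; simp only [mul_assoc]

theorem gridRow_mul_gridCol {y : ι} {A : List ι} (h : ∀ x ∈ A, r y x * r x y = 1) :
    gridRow r y A * gridCol r A y = 1 := by
  induction A with
  | nil => simp [gridRow, gridCol]
  | cons x A ih =>
    rw [gridRow_cons, gridCol_cons, mul_assoc, ← mul_assoc (r y x), h x List.mem_cons_self, one_mul,
      ih fun x' hx' => h x' (List.mem_cons_of_mem _ hx')]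

/-- Expanding the left grid by rows and the right one by columns puts the smaller grids next to each
other in the middle, where they cancel; the outer row and column then cancel pair by pair. -/
theorem grid_mul_grid (hr : DisjointCommute r) {A B : List ι} (hA : A.Nodup) (hB : B.Nodup)
    (hAB : A.Disjoint B) (h : ∀ x ∈ A, ∀ y ∈ B, r y x * r x y = 1) :
    grid r B A * grid r A B = 1 := by
  induction B with
  | nil => simp [grid, grid_nil_left]
  | cons y B ih =>
    have hB' := List.nodup_cons.1 hB
    have hAB' := List.disjoint_cons_right.1 hAB
    have ih := ih hB'.2 hAB'.2 fun x hx y' hy' => h x hx y' (List.mem_cons_of_mem _ hy')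
    rw [grid, grid_cons_left hr hB'.1 hAB'.1 hA hAB'.2.symm]
    calc gridRow r y A * grid r B A * (grid r A B * gridCol r A y)
        = gridRow r y A * (grid r B A * grid r A B) * gridCol r A y := by simp only [mul_assoc]
      _ = 1 := by
        rw [ih, mul_one, gridRow_mul_gridCol fun x hx => h x hx y List.mem_cons_self]

/-- The elements `m` for which `m e` is a right multiple of `e`. -/
def rightMultiples (e : M) : Submonoid M where
  carrier := {m | ∃ m', m * e = e * m'}
  one_mem' := ⟨1, by simp⟩
  mul_mem' := by
    rintro a b ⟨a', ha⟩ ⟨b', hb⟩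
    exact ⟨a' * b', by rw [mul_assoc, hb, ← mul_assoc, ha, mul_assoc]⟩

theorem mem_rightMultiples_of_commute {e m : M} (h : Commute m e) : m ∈ rightMultiples e :=
  ⟨m, h.eq⟩

theorem gridCol_mem {S : Submonoid M} {A : List ι} {y : ι} (h : ∀ x ∈ A, r x y ∈ S) :
    gridCol r A y ∈ S :=
  S.list_prod_mem fun m hm => by obtain ⟨x, hx, rfl⟩ := List.mem_map.1 hm; exact h x hx

theorem gridRow_mem {S : Submonoid M} {x : ι} {B : List ι} (h : ∀ y ∈ B, r x y ∈ S) :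
    gridRow r x B ∈ S :=
  S.list_prod_mem fun m hm => by
    obtain ⟨y, hy, rfl⟩ := List.mem_map.1 (List.mem_reverse.1 hm); exact h y hy

theorem grid_mem_of_gridCol_mem {S : Submonoid M} {A B : List ι}
    (h : ∀ y ∈ B, gridCol r A y ∈ S) : grid r A B ∈ S := by
  rw [grid_eq_prod]
  refine S.list_prod_mem fun m hm => ?_
  obtain ⟨y, hy, rfl⟩ := List.mem_map.1 (List.mem_reverse.1 hm)
  exact h y hy

theorem grid_mem_of_gridRow_mem (hr : DisjointCommute r) {S : Submonoid M} {A B : List ι}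
    (hA : A.Nodup) (hB : B.Nodup) (hAB : A.Disjoint B)
    (h : ∀ x ∈ A, gridRow r x B ∈ S) : grid r A B ∈ S := by
  induction A with
  | nil => rw [grid_nil_left]; exact S.one_mem
  | cons x A ih =>
    have hA' := List.nodup_cons.1 hA
    have hAB' := List.disjoint_cons_left.1 hAB
    rw [grid_cons_left hr hA'.1 hAB'.1 hB hAB'.2]
    exact S.mul_mem (h x List.mem_cons_self)
      (ih hA'.2 hAB'.2 fun x' hx' => h x' (List.mem_cons_of_mem _ hx'))

/-- For `S` the right multiples of `P - 1` the factors at the two flipped copies need not lie in `S`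
separately; only their product does. -/
theorem gridCol_mem_of_pair {S : Submonoid M} {A₁ A₂ : List ι} {x x' y : ι}
    (h : r x y * r x' y ∈ S) (h₁ : ∀ a ∈ A₁, r a y ∈ S) (h₂ : ∀ a ∈ A₂, r a y ∈ S) :
    gridCol r (A₁ ++ x :: x' :: A₂) y ∈ S := by
  have e : gridCol r (A₁ ++ x :: x' :: A₂) y =
      gridCol r A₁ y * ((r x y * r x' y) * gridCol r A₂ y) := by simp [gridCol, mul_assoc]
  rw [e]
  exact S.mul_mem (gridCol_mem h₁) (S.mul_mem h (gridCol_mem h₂))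

theorem gridRow_mem_of_pair {S : Submonoid M} {B₁ B₂ : List ι} {x y y' : ι}
    (h : r x y' * r x y ∈ S) (h₁ : ∀ b ∈ B₁, r x b ∈ S) (h₂ : ∀ b ∈ B₂, r x b ∈ S) :
    gridRow r x (B₁ ++ y :: y' :: B₂) ∈ S := by
  have e : gridRow r x (B₁ ++ y :: y' :: B₂) =
      gridRow r x B₂ * ((r x y' * r x y) * gridRow r x B₁) := by simp [gridRow, mul_assoc]
  rw [e]
  exact S.mul_mem (gridRow_mem h₂) (S.mul_mem h (gridRow_mem h₁))

end Grid

/-! ### Spectral parameters of the copies of `ℂ²` and products of `R` matrices over blocks -/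

section SiteR

variable {N : ℕ} {n : Fin N → ℕ} {D : Params}

/-- The spectral parameter of a copy of `ℂ²`. -/
def zeta (D : Params) (z : Fin N → ℂ) (s : Site n) : ℂ :=
  z s.1 + ((n s.1 : ℂ) + 1 - 2 * ((s.2 : ℂ) + 1)) * D.η

/-- The `R` matrix on two copies of `ℂ²` at the difference of their spectral parameters. -/
def rS (D : Params) (z : Fin N → ℂ) (s s' : Site n) : Module.End ℂ (BigSpace n) :=
  (D.th 1 1 (2 * D.η) / D.th 1 1 (zeta D z s - zeta D z s' + 2 * D.η)) •
    sR D s s' (zeta D z s - zeta D z s')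

/-- The copies of `ℂ²` in the block `j`. -/
def sites (n : Fin N → ℕ) (j : Fin N) : List (Site n) := List.ofFn fun x => ⟨j, x⟩

theorem mem_sites {j : Fin N} {s : Site n} : s ∈ sites n j ↔ s.1 = j := by
  rw [sites, List.mem_ofFn]
  constructor
  · rintro ⟨x, rfl⟩; rfl
  · rintro rfl; exact ⟨s.2, rfl⟩

theorem nodup_sites (j : Fin N) : (sites n j).Nodup := by
  rw [sites, List.nodup_ofFn]
  intro x y h
  simpa using h

theorem disjoint_sites {j k : Fin N} (h : j ≠ k) : (sites n j).Disjoint (sites n k) :=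
  fun _ hs hs' => h ((mem_sites.1 hs).symm.trans (mem_sites.1 hs'))

theorem disjointCommute_rS (z : Fin N → ℂ) : DisjointCommute (rS (n := n) D z) :=
  fun _ _ _ _ h₁ h₂ h₃ h₄ => ((commute_sR h₁ h₂ h₃ h₄ _ _).smul_left _).smul_right _

theorem smul_mul_mul_smul {E : Type*} [Semiring E] [Algebra ℂ E] (a b c : ℂ) {x y w : E}
    (h : x * y * w = w * y * x) :
    (a • x) * (b • y) * (c • w) = (c • w) * (b • y) * (a • x) := by
  simp only [smul_mul_assoc, mul_smul_comm, h, smul_smul]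
  congr 1
  ring

theorem yangBaxter_rS (hη : D.th 1 1 (2 * D.η) ≠ 0) (z : Fin N → ℂ) :
    YangBaxter (rS (n := n) D z) := by
  intro s₁ s₂ s₃ h₁₂ h₁₃ h₂₃
  have h := sR_yangBaxter hη h₁₂ h₁₃ h₂₃ (zeta D z s₁ - zeta D z s₂) (zeta D z s₂ - zeta D z s₃)
  rw [sub_add_sub_cancel] at h
  exact smul_mul_mul_smul _ _ _ h

theorem unitary_smul {E : Type*} [Semiring E] [Algebra ℂ E] {a b d : ℂ} (ha : a ≠ 0)
    (hb : b ≠ 0) (hd : d ≠ 0) {x y : E} (h : x * y = (a / d * (b / d)) • 1) :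
    ((d / b) • x) * ((d / a) • y) = 1 := by
  rw [smul_mul_assoc, mul_smul_comm, h, smul_smul, smul_smul]
  have : d / b * (d / a) * (a / d * (b / d)) = 1 := by field_simp
  rw [← mul_assoc] at *
  simp only [mul_assoc] at this ⊢
  rw [this, one_smul]

theorem rS_mul_rS (hη : D.th 1 1 (2 * D.η) ≠ 0) {z : Fin N → ℂ} {s s' : Site n}
    (h : s ≠ s') (h₁ : D.th 1 1 (zeta D z s - zeta D z s' + 2 * D.η) ≠ 0)
    (h₂ : D.th 1 1 (zeta D z s' - zeta D z s + 2 * D.η) ≠ 0) :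
    rS D z s' s * rS D z s s' = 1 := by
  have e := sR_unitarity hη h (zeta D z s - zeta D z s')
  rw [neg_sub] at e
  exact unitary_smul h₁ h₂ hη e

/-- The argument of every elementary factor is a difference of parameters attached to the individual
copies, so the fused product is a grid and inherits Yang-Baxter and unitarity from the general grid
lemmas. -/
theorem prodR_eq (hη : D.th 1 1 (2 * D.η) ≠ 0) (z : Fin N → ℂ) (j k : Fin N) :
    prodR D n j k (z j - z k) = grid (rS D z) (sites n j) (sites n k) := by
  rw [grid_eq_prod, prodR, sites, sites, List.map_ofFn]
  congr 3
  funext y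
  simp only [Function.comp, gridCol, List.map_ofFn]
  congr 2
  funext x
  rw [Function.comp, halfR_eq hη, rS, zeta, zeta]
  have e : (z j - z k + ((n j : ℂ) + 1 - 2 * ((x : ℂ) + 1)) * D.η)
      - ((n k : ℂ) + 1 - 2 * ((y : ℂ) + 1)) * D.η =
      (z j + ((n j : ℂ) + 1 - 2 * ((x : ℂ) + 1)) * D.η)
      - (z k + ((n k : ℂ) + 1 - 2 * ((y : ℂ) + 1)) * D.η) := by ring
  rw [e]

/-- Arguments of the denominators differ from `z_j - z_k` by integer multiples of `η`, which is why
regularity of `z` excludes poles between different blocks. -/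
theorem zeta_sub (z : Fin N → ℂ) (s s' : Site n) : ∃ m : ℤ,
    zeta D z s - zeta D z s' + 2 * D.η = z s.1 - z s'.1 + m * D.η := by
  refine ⟨(n s.1 - 2 * s.2) - (n s'.1 - 2 * s'.2) + 2, ?_⟩
  rw [zeta, zeta]
  push_cast
  ring

theorem th_zeta_sub_ne_zero {z : Fin N → ℂ} (hz : z ∈ regular D N) {s s' : Site n}
    (h : s.1 ≠ s'.1) : D.th 1 1 (zeta D z s - zeta D z s' + 2 * D.η) ≠ 0 := by
  obtain ⟨m, hm⟩ := zeta_sub (D := D) z s s'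
  rw [hm]
  exact (hz m).2 _ _ h

/-- The products of `R` matrices for two blocks. -/
def blockR (D : Params) (n : Fin N → ℕ) (z : Fin N → ℂ) (j k : Fin N) :
    Module.End ℂ (BigSpace n) := prodR D n j k (z j - z k)

theorem disjointCommute_blockR (hη : D.th 1 1 (2 * D.η) ≠ 0) (z : Fin N → ℂ) :
    DisjointCommute (blockR D n z) := by
  intro j k j' k' h₁ h₂ h₃ h₄
  rw [blockR, blockR, prodR_eq hη, prodR_eq hη]
  refine commute_grid fun x hx y hy => (commute_grid fun x' hx' y' hy' => ?_).symm
  rw [mem_sites] at hx hy hx' hy'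
  subst hx hy hx' hy'
  refine (disjointCommute_rS z _ _ _ _ ?_ ?_ ?_ ?_).symm <;> rintro rfl <;> contradiction

theorem yangBaxter_blockR (hη : D.th 1 1 (2 * D.η) ≠ 0) (z : Fin N → ℂ) :
    YangBaxter (blockR D n z) := by
  intro j k l h₁ h₂ h₃
  simp only [blockR, prodR_eq hη]
  exact yangBaxter_grid (disjointCommute_rS z) (yangBaxter_rS hη z) (nodup_sites _) (nodup_sites _)
    (nodup_sites _) (disjoint_sites h₁) (disjoint_sites h₂) (disjoint_sites h₃)

theorem blockR_mul_blockR (hη : D.th 1 1 (2 * D.η) ≠ 0) {z : Fin N → ℂ} (hz : z ∈ regular D N)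
    {j k : Fin N} (h : j ≠ k) : blockR D n z k j * blockR D n z j k = 1 := by
  rw [blockR, blockR, prodR_eq hη, prodR_eq hη]
  refine grid_mul_grid (disjointCommute_rS z) (nodup_sites _) (nodup_sites _) (disjoint_sites h)
    fun x hx y hy => ?_
  rw [mem_sites] at hx hy
  subst hx hy
  exact rS_mul_rS hη (fun e => h (congrArg Sigma.fst e)) (th_zeta_sub_ne_zero hz h)
    (th_zeta_sub_ne_zero hz h.symm)

end SiteR

/-! ### Independence of products of theta functions -/

section Independence

variable {D : Params}

/-- The function `θ₁₀(y ± x)` of `y`. -/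
def qf (D : Params) (x y : ℂ) : ℂ := D.th 1 0 (y + x) * D.th 1 0 (y - x)

theorem differentiable_qf (x : ℂ) : Differentiable ℂ (qf D x) := by
  have h := D.differentiable_th 1 0
  unfold qf
  fun_prop

theorem th10_add_half (x : ℂ) : D.th 1 0 (x + 1 / 2) = D.th 1 1 x := (D.th_one_eq 1 x).symm

theorem qf_add_half (x w : ℂ) : qf D w (x + 1 / 2) = D.th 1 1 (x + w) * D.th 1 1 (x - w) := by
  rw [qf, add_right_comm, add_sub_right_comm, th10_add_half, th10_add_half]

/-- Neither theta factor of `qf D x` vanishes identically: with argument `2η + 1/2` each takes the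
value `θ₁₁(2η)`. -/
theorem eq_zero_of_qf_mul (hη : D.th 1 1 (2 * D.η) ≠ 0) {x : ℂ} {f : ℂ → ℂ}
    (hf : Differentiable ℂ f) (h : ∀ y, qf D x y * f y = 0) (y : ℂ) : f y = 0 := by
  have h10 := D.differentiable_th 1 0
  refine eq_zero_of_mul_eq_zero_of_differentiable hf
    (by fun_prop : Differentiable ℂ fun y => D.th 1 0 (y - x)) (w := 2 * D.η + x + 1 / 2)
    (fun y => ?_) ?_ y
  · refine eq_zero_of_mul_eq_zero_of_differentiable
      (f := fun y => f y * D.th 1 0 (y - x)) (by fun_prop)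
      (by fun_prop : Differentiable ℂ fun y => D.th 1 0 (y + x)) (w := 2 * D.η - x + 1 / 2)
      (fun y => ?_) ?_ y
    · rw [← h y, qf]; ring
    · rwa [show 2 * D.η - x + 1 / 2 + x = 2 * D.η + 1 / 2 by ring, th10_add_half]
  · rwa [show 2 * D.η + x + 1 / 2 - x = 2 * D.η + 1 / 2 by ring, th10_add_half]

/-- The product of `θ₁₀(y ± x_j)` for `j < k` and `θ₁₀(y ± w_i)` for `k ≤ i < n`. -/
def qprod (D : Params) (n : ℕ) (x w : ℕ → ℂ) (k : ℕ) (y : ℂ) : ℂ :=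
  (∏ j ∈ Finset.range k, qf D (x j) y) * ∏ i ∈ Finset.Ico k n, qf D (w i) y

theorem differentiable_qprod (n : ℕ) (x w : ℕ → ℂ) (k : ℕ) :
    Differentiable ℂ (qprod D n x w k) := by
  unfold qprod
  refine Differentiable.mul ?_ ?_ <;>
  exact Differentiable.fun_finsetProd fun i _ => differentiable_qf _

theorem qprod_succ (n : ℕ) (x w : ℕ → ℂ) (k : ℕ) (y : ℂ) : qprod D (n + 1) x w (k + 1) y =
    qf D (x 0) y * qprod D n (fun j => x (j + 1)) (fun j => w (j + 1)) k y := by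
  rw [qprod, qprod, Finset.prod_range_succ', ← Finset.prod_Ico_add' _ k n 1]
  ring

/-- A triangular argument. At `y = x₀ + 1/2` every product with `k ≥ 1` vanishes while the one with
`k = 0` does not, so `c₀ = 0`. The common factor `qf D (x 0)` of the rest is divided out and the
sequences are shifted by one. -/
theorem qprod_independent (hη : D.th 1 1 (2 * D.η) ≠ 0) {n : ℕ} {x w : ℕ → ℂ}
    (h : ∀ j i, j ≤ i → i < n → D.th 1 1 (x j + w i) ≠ 0 ∧ D.th 1 1 (x j - w i) ≠ 0) {c : ℕ → ℂ}
    (hc : ∀ y, ∑ k ∈ Finset.range (n + 1), c k * qprod D n x w k y = 0) :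
    ∀ k ≤ n, c k = 0 := by
  induction n generalizing x w c with
  | zero =>
    intro k hk
    obtain rfl : k = 0 := by omega
    simpa [qprod] using hc 0
  | succ n ih =>
    simp only [Finset.sum_range_succ' _ (n + 1), qprod_succ] at hc
    have h0 : c 0 = 0 := by
      have e := hc (x 0 + 1 / 2)
      have e0 : qf D (x 0) (x 0 + 1 / 2) = 0 := by rw [qf_add_half, sub_self, D.th11_zero, mul_zero]
      simp only [e0, zero_mul, mul_zero, Finset.sum_const_zero, zero_add] at e
      refine (mul_eq_zero.1 e).resolve_right ?_
      rw [qprod, Finset.prod_range_zero, one_mul]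
      refine Finset.prod_ne_zero_iff.2 fun i hi => ?_
      rw [qf_add_half]
      have := h 0 i (Nat.zero_le i) (Finset.mem_Ico.1 hi).2
      exact mul_ne_zero this.1 this.2
    have hs := ih (x := fun j => x (j + 1)) (w := fun j => w (j + 1)) (c := fun k => c (k + 1))
      (fun j i hji hi => h _ _ (by omega) (by omega)) (eq_zero_of_qf_mul hη (x := x 0) ?_ fun y => ?_)
    · intro k hk
      cases k with
      | zero => exact h0
      | succ k => exact hs k (by omega)
    · refine Differentiable.fun_sum fun k _ => ?_
      exact (differentiable_qprod _ _ _ _).const_mul _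
    · rw [← hc y, h0, Finset.mul_sum]
      simp only [zero_mul, add_zero]
      exact Finset.sum_congr rfl fun k _ => by ring

theorem linearIndependent_qprod (hη : D.th 1 1 (2 * D.η) ≠ 0) {n : ℕ} {x w : ℕ → ℂ}
    (h : ∀ j i, j ≤ i → i < n → D.th 1 1 (x j + w i) ≠ 0 ∧ D.th 1 1 (x j - w i) ≠ 0) :
    LinearIndependent ℂ fun k : Fin (n + 1) => qprod D n x w k := by
  rw [Fintype.linearIndependent_iff]
  intro g hg k
  have := qprod_independent hη h (c := fun k => if hk : k < n + 1 then g ⟨k, hk⟩ else 0)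
    (fun y => ?_) k (by omega)
  · simpa only [k.isLt, dif_pos] using this
  · rw [Finset.sum_range]
    simpa [-Order.lt_add_one_iff] using congrFun hg y

/-! ### The kernel of the multiplication map -/

theorem mulMap_tprod (τ : UpperHalfPlane) (n : ℕ) (v : Fin n → Fin 2 → ℂ) (y : ℂ) :
    (mulMap τ n (PiTensorProduct.tprod ℂ v) : ℂ → ℂ) y =
      ∏ i, (v i 0 * halfBasis τ 0 y + v i 1 * halfBasis τ 1 y) := by
  rw [mulMap, PiTensorProduct.lift.tprod]
  rfl

theorem mulMap_tprod_pv (n : ℕ) (x : Fin n → ℂ) (y : ℂ) :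
    (mulMap D.τ n (PiTensorProduct.tprod ℂ fun i => pv D (x i)) : ℂ → ℂ) y =
      ∏ i, qf D (x i) y := by
  rw [mulMap_tprod]
  exact Finset.prod_congr rfl fun i _ => pv_halfBasis D _ _

theorem mulMap_mulSection (τ : UpperHalfPlane) (n : ℕ) (v : HalfTensor n) :
    mulMap τ n (mulSection τ n (mulMap τ n v)) = mulMap τ n v :=
  (exists_section (mulMap τ n)).choose_spec v

theorem linearIndependent_pv (hη : D.th 1 1 (2 * D.η) ≠ 0) :
    LinearIndependent ℂ ![pv D (2 * D.η), pv D 0] := by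
  have h := om_pv D 0 (2 * D.η)
  rw [add_zero, sub_zero] at h
  have h' : om (pv D (2 * D.η)) (pv D 0) ≠ 0 := by
    rw [h]; exact mul_ne_zero (by norm_num) (mul_ne_zero hη hη)
  rw [LinearIndependent.pair_iff]
  intro s t hst
  have h0 := congrFun hst 0
  have h1 := congrFun hst 1
  simp only [Pi.add_apply, Pi.smul_apply, smul_eq_mul, Pi.zero_apply] at h0 h1
  rw [om] at h'
  constructor
  · refine (mul_eq_zero.1 (?_ : s * _ = 0)).resolve_right h'
    linear_combination pv D 0 1 * h0 - pv D 0 0 * h1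
  · refine (mul_eq_zero.1 (?_ : t * _ = 0)).resolve_right h'
    linear_combination pv D (2 * D.η) 0 * h1 - pv D (2 * D.η) 1 * h0

/-- Linear maps extend from linearly independent families. -/
theorem exists_linearMap_of_linearIndependent {ι V W : Type*} [AddCommGroup V] [Module ℂ V]
    [AddCommMonoid W] [Module ℂ W] {v : ι → V} (hv : LinearIndependent ℂ v) (t : ι → W) :
    ∃ L : V →ₗ[ℂ] W, ∀ i, L (v i) = t i := by
  obtain ⟨g, hg⟩ := (Finsupp.linearCombination ℂ v).exists_leftInverse_of_injective
    (LinearMap.ker_eq_bot.2 hv)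
  refine ⟨Finsupp.linearCombination ℂ t ∘ₗ g, fun i => ?_⟩
  have h : g (v i) = Finsupp.single i 1 := by
    have := LinearMap.congr_fun hg (Finsupp.single i 1)
    simpa using this
  rw [LinearMap.comp_apply, h]
  simp

theorem exists_perm_of_card_eq {n : ℕ} {s t : Fin n → Fin 2}
    (h : (Finset.univ.filter fun i => s i = 0).card = (Finset.univ.filter fun i => t i = 0).card) :
    ∃ σ : Equiv.Perm (Fin n), t ∘ σ = s := by
  have e : ∀ c : Fin 2, Fintype.card {i // s i = c} = Fintype.card {i // t i = c} := by
    intro c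
    rw [Fintype.card_subtype, Fintype.card_subtype]
    fin_cases c
    · exact h
    · have h1 := Finset.card_filter_add_card_filter_not (s := Finset.univ) fun i => s i = 0
      have h2 := Finset.card_filter_add_card_filter_not (s := Finset.univ) fun i => t i = 0
      have e : ∀ x : Fin 2, ¬x = 0 ↔ x = 1 := by decide
      simp only [e] at h1 h2
      simp only [Fin.mk_one]
      omega
  refine ⟨Equiv.ofFiberEquiv fun c => Fintype.equivOfCardEq (e c), ?_⟩
  funext i
  exact Equiv.ofFiberEquiv_map _ i

/-- The permutations leaving `T` invariant form a submonoid, and adjacent transpositions generate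
the symmetric group. -/
theorem perm_invariant_of_swap_invariant {n : ℕ} {W : Type*} (T : (Fin n → Fin 2 → ℂ) → W)
    (hT : ∀ (v : Fin n → Fin 2 → ℂ) (x y : Fin n), (x : ℕ) + 1 = y → T (v ∘ Equiv.swap x y) = T v)
    (σ : Equiv.Perm (Fin n)) (v : Fin n → Fin 2 → ℂ) : T (v ∘ σ) = T v := by
  let S : Submonoid (Equiv.Perm (Fin n)) :=
    { carrier := {σ | ∀ v, T (v ∘ σ) = T v}
      one_mem' := fun v => rfl
      mul_mem' := fun {a b} ha hb v => by
        rw [Equiv.Perm.coe_mul, ← Function.comp_assoc, hb, ha] }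
  suffices h : S = ⊤ by
    have : σ ∈ S := h ▸ Submonoid.mem_top σ
    exact this v
  cases n with
  | zero =>
    refine eq_top_iff.2 fun σ _ v => ?_
    congr 1
    exact Subsingleton.elim _ _
  | succ m =>
    rw [eq_top_iff, ← Equiv.Perm.mclosure_swap_castSucc_succ, Submonoid.closure_le]
    rintro _ ⟨i, rfl⟩ v
    exact hT v _ _ (by simp)

/-- A linear map on `(ℂ²)^{⊗ n}` that is invariant under the transpositions of neighbouring
factors factors through the multiplication map. -/
theorem apply_mulSection_mulMap (hη : D.th 1 1 (2 * D.η) ≠ 0) {n : ℕ} {W : Type*}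
    [AddCommMonoid W] [Module ℂ W] (T : HalfTensor n →ₗ[ℂ] W)
    (hT : ∀ (v : Fin n → Fin 2 → ℂ) (x y : Fin n), (x : ℕ) + 1 = y →
      T (PiTensorProduct.tprod ℂ (v ∘ Equiv.swap x y)) = T (PiTensorProduct.tprod ℂ v))
    (v : HalfTensor n) : T (mulSection D.τ n (mulMap D.τ n v)) = T v := by
  have hperm := perm_invariant_of_swap_invariant (fun v => T (PiTensorProduct.tprod ℂ v)) hT
  let cnt : (Fin n → Fin 2) → ℕ := fun s => (Finset.univ.filter fun i => s i = 0).card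
  have hcnt : ∀ s, cnt s < n + 1 := fun s => Nat.lt_succ_of_le
    ((Finset.card_le_univ _).trans_eq (Fintype.card_fin n))
  -- In the basis `pv (2η)`, `pv 0` the image of a basis tensor under multiplication, as well as its
  -- image under the invariant `T`, depends only on the number `cnt` of indices `0`.
  let b : Module.Basis (Fin 2) ℂ (Fin 2 → ℂ) :=
    basisOfLinearIndependentOfCardEqFinrank (linearIndependent_pv hη) (by simp)
  have hb : ∀ i, b i = pv D (if i = 0 then 2 * D.η else 0) := by
    intro i
    rw [coe_basisOfLinearIndependentOfCardEqFinrank]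
    fin_cases i <;> rfl
  have hprod : ∀ s : Fin n → Fin 2, ((mulMap D.τ n (PiTensorProduct.tprod ℂ fun i => b (s i)) :
      thetaSpace D.τ n) : ℂ → ℂ) = qprod D n (fun _ => 2 * D.η) (fun _ => 0) (cnt s) := by
    intro s
    funext y
    simp only [hb]
    rw [mulMap_tprod_pv, qprod]
    simp only [Finset.prod_const, Finset.card_range, Nat.card_Ico, cnt]
    have e : ∀ i, qf D (if s i = 0 then 2 * D.η else 0) y =
        if s i = 0 then qf D (2 * D.η) y else qf D 0 y := fun i => by split <;> rfl
    simp only [e, Finset.prod_ite, Finset.prod_const]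
    congr 2
    have h1 := Finset.card_filter_add_card_filter_not (s := Finset.univ) fun i => s i = 0
    rw [Finset.card_univ, Fintype.card_fin] at h1
    omega
  let st : Fin (n + 1) → Fin n → Fin 2 := fun k i => if (i : ℕ) < k then 0 else 1
  have hst : ∀ k : Fin (n + 1), cnt (st k) = k := by
    intro k
    have e : ∀ i : Fin n, st k i = 0 ↔ (i : ℕ) < k := fun i => by
      simp only [st]; split <;> simp_all
    simp only [cnt, e]
    rw [Fin.card_filter_val_lt]
    omega
  have hind : LinearIndependent ℂ fun k : Fin (n + 1) =>
      mulMap D.τ n (PiTensorProduct.tprod ℂ fun i => b (st k i)) := by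
    refine LinearIndependent.of_comp (thetaSpace D.τ n).subtype ?_
    have e : ((thetaSpace D.τ n).subtype ∘ fun k : Fin (n + 1) =>
        mulMap D.τ n (PiTensorProduct.tprod ℂ fun i => b (st k i))) =
        fun k : Fin (n + 1) => qprod D n (fun _ => 2 * D.η) (fun _ => 0) k := by
      funext k
      rw [Function.comp, Submodule.subtype_apply, hprod, hst]
    rw [e]
    -- All `x_j` equal `2η` and all `w_i` equal `0`, so both conditions read `θ₁₁(2η) ≠ 0`.
    exact linearIndependent_qprod hη fun j i _ _ => by simpa using hη
  obtain ⟨L, hL⟩ := exists_linearMap_of_linearIndependent hind fun k =>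
    T (PiTensorProduct.tprod ℂ fun i => b (st k i))
  -- Every basis tensor is a permutation of a standard one, with all indices `0` in front, and `L`
  -- was prescribed on the independent images of the standard ones.
  have key : T = L ∘ₗ mulMap D.τ n := by
    refine (Basis.piTensorProduct fun _ : Fin n => b).ext fun s => ?_
    rw [Basis.piTensorProduct_apply, LinearMap.comp_apply]
    obtain ⟨σ, hσ⟩ := exists_perm_of_card_eq (s := s) (t := st ⟨cnt s, hcnt s⟩)
      (hst ⟨cnt s, hcnt s⟩).symm
    have h1 : T (PiTensorProduct.tprod ℂ fun i => b (s i)) =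
        T (PiTensorProduct.tprod ℂ fun i => b (st ⟨cnt s, hcnt s⟩ i)) := by
      have e : (fun i => b (s i)) = (fun i => b (st ⟨cnt s, hcnt s⟩ i)) ∘ σ :=
        funext fun i => congrArg b (congrFun hσ i).symm
      rw [e]
      exact hperm σ _
    have h2 : mulMap D.τ n (PiTensorProduct.tprod ℂ fun i => b (s i)) =
        mulMap D.τ n (PiTensorProduct.tprod ℂ fun i => b (st ⟨cnt s, hcnt s⟩ i)) := by
      apply Subtype.ext
      rw [hprod, hprod, hst]
    rw [h1, h2, hL]
  rw [key, LinearMap.comp_apply, mulMap_mulSection, LinearMap.comp_apply]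

end Independence

/-! ### Fusion -/

section Fusion

variable {N : ℕ} {n : Fin N → ℕ} {D : Params}

/-- The multiplication map in every block. -/
def mulAll (D : Params) (n : Fin N → ℕ) : BigSpace n →ₗ[ℂ] StateSpace D n :=
  PiTensorProduct.map fun i => mulMap D.τ (n i)

theorem sites_eq_append (j : Fin N) (x : ℕ) (hx : x + 1 < n j) :
    ∃ A₁ A₂, sites n j = A₁ ++ ⟨j, ⟨x, by omega⟩⟩ :: ⟨j, ⟨x + 1, hx⟩⟩ :: A₂ := by
  have hl : (sites n j).length = n j := by simp [sites]
  refine ⟨(sites n j).take x, (sites n j).drop (x + 2), ?_⟩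
  conv_lhs => rw [← List.take_append_drop x (sites n j)]
  rw [List.drop_eq_getElem_cons (by omega), List.drop_eq_getElem_cons (by omega)]
  simp [sites]

/-- `(P - 1)` for the interchange `P` of two neighbouring copies of `ℂ²` in the block `i`. -/
def antisym (D : Params) (n : Fin N → ℕ) (i : Fin N) (x : ℕ) (hx : x + 1 < n i) :
    Module.End ℂ (BigSpace n) :=
  sR D ⟨i, ⟨x + 1, hx⟩⟩ ⟨i, ⟨x, by omega⟩⟩ (-(2 * D.η))

theorem site_succ_ne (i : Fin N) (x : ℕ) (hx : x + 1 < n i) :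
    (⟨i, ⟨x + 1, hx⟩⟩ : Site n) ≠ ⟨i, ⟨x, by omega⟩⟩ := by
  intro h; simp at h

theorem zeta_succ_sub (z : Fin N → ℂ) (i : Fin N) (x : ℕ) (hx : x + 1 < n i) :
    zeta D z (⟨i, ⟨x + 1, hx⟩⟩ : Site n) - zeta D z (⟨i, ⟨x, by omega⟩⟩ : Site n) =
      -(2 * D.η) := by
  simp only [zeta]; push_cast; ring

theorem smul_mul_smul_mul {E : Type*} [Semiring E] [Algebra ℂ E] (a b : ℂ) {x y w x' y' : E}
    (h : x * y * w = w * y' * x') :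
    (a • x) * (b • y) * w = w * ((a * b) • (y' * x')) := by
  rw [smul_mul_smul_comm, smul_mul_assoc, h, mul_smul_comm, mul_assoc]

/-- The parameters of neighbouring copies differ by `-2η`, so the Yang-Baxter equation with its
degenerate factor `R(-2η)` moves the pair of `R` matrices, in reversed order, through `P - 1`. -/
theorem rS_mul_rS_mem_col (hη : D.th 1 1 (2 * D.η) ≠ 0) (z : Fin N → ℂ) (i : Fin N) (x : ℕ)
    (hx : x + 1 < n i) {y : Site n} (hy : y.1 ≠ i) :
    rS D z ⟨i, ⟨x, by omega⟩⟩ y * rS D z ⟨i, ⟨x + 1, hx⟩⟩ y ∈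
      rightMultiples (antisym D n i x hx) := by
  have h := sR_yangBaxter hη (s₃ := y) (site_succ_ne i x hx) (fun e => hy (congrArg Sigma.fst e).symm)
    (fun e => hy (congrArg Sigma.fst e).symm) (-(2 * D.η))
    (zeta D z (⟨i, ⟨x, by omega⟩⟩ : Site n) - zeta D z y)
  rw [← zeta_succ_sub (D := D) z i x hx, sub_add_sub_cancel, zeta_succ_sub] at h
  exact ⟨_, smul_mul_smul_mul _ _ h.symm⟩

theorem rS_mul_rS_mem_row (hη : D.th 1 1 (2 * D.η) ≠ 0) (z : Fin N → ℂ) (i : Fin N) (y : ℕ)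
    (hy : y + 1 < n i) {x : Site n} (hx : x.1 ≠ i) :
    rS D z x ⟨i, ⟨y + 1, hy⟩⟩ * rS D z x ⟨i, ⟨y, by omega⟩⟩ ∈
      rightMultiples (antisym D n i y hy) := by
  have h := sR_yangBaxter hη (s₁ := x) (fun e => hx (congrArg Sigma.fst e))
    (fun e => hx (congrArg Sigma.fst e)) (site_succ_ne i y hy)
    (zeta D z x - zeta D z (⟨i, ⟨y + 1, hy⟩⟩ : Site n)) (-(2 * D.η))
  rw [← zeta_succ_sub (D := D) z i y hy, sub_add_sub_cancel, zeta_succ_sub] at h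
  exact ⟨_, smul_mul_smul_mul _ _ h⟩

theorem rS_mem_of_ne (z : Fin N → ℂ) (i : Fin N) (x : ℕ) (hx : x + 1 < n i) {s s' : Site n}
    (h₁ : s ≠ ⟨i, ⟨x + 1, hx⟩⟩) (h₂ : s ≠ ⟨i, ⟨x, by omega⟩⟩) (h₃ : s' ≠ ⟨i, ⟨x + 1, hx⟩⟩)
    (h₄ : s' ≠ ⟨i, ⟨x, by omega⟩⟩) : rS D z s s' ∈ rightMultiples (antisym D n i x hx) :=
  mem_rightMultiples_of_commute ((commute_sR h₁ h₂ h₃ h₄ _ _).smul_left _)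

/-- The fused product maps the image of `P - 1` into itself. The block `i` of the flipped copies may
be `j`, where the grid is read by columns, or `k`, where it is read by rows, or neither, where
everything commutes. -/
theorem prodR_mem_rightMultiples (hη : D.th 1 1 (2 * D.η) ≠ 0) (z : Fin N → ℂ) {j k : Fin N}
    (hjk : j ≠ k) (i : Fin N) (x : ℕ) (hx : x + 1 < n i) :
    prodR D n j k (z j - z k) ∈ rightMultiples (antisym D n i x hx) := by
  rw [prodR_eq hη]
  have hfst : ∀ {s : Site n} {x : Fin (n i)}, s.1 ≠ i → s ≠ ⟨i, x⟩ :=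
    fun h e => h (congrArg Sigma.fst e)
  by_cases hi : i = j
  · subst hi
    obtain ⟨A₁, A₂, hA⟩ := sites_eq_append (n := n) i x hx
    have hnd := nodup_sites (n := n) i
    rw [hA, List.nodup_append] at hnd
    obtain ⟨-, hnd2, hnd3⟩ := hnd
    simp only [List.nodup_cons, List.mem_cons, not_or] at hnd2
    refine grid_mem_of_gridCol_mem fun y hy => ?_
    have hy' : y.1 ≠ i := by rw [mem_sites.1 hy]; exact hjk.symm
    rw [hA]
    refine gridCol_mem_of_pair (rS_mul_rS_mem_col hη z i x hx hy') (fun a ha => ?_) fun a ha => ?_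
    · refine rS_mem_of_ne z i x hx ?_ ?_ (hfst hy') (hfst hy')
      · exact hnd3 a ha _ (by simp)
      · exact hnd3 a ha _ (by simp)
    · refine rS_mem_of_ne z i x hx ?_ ?_ (hfst hy') (hfst hy')
      · rintro rfl; exact hnd2.2.1 ha
      · rintro rfl; exact hnd2.1.2 ha
  · by_cases hi' : i = k
    · subst hi'
      obtain ⟨A₁, A₂, hA⟩ := sites_eq_append (n := n) i x hx
      have hnd := nodup_sites (n := n) i
      rw [hA, List.nodup_append] at hnd
      obtain ⟨-, hnd2, hnd3⟩ := hnd
      simp only [List.nodup_cons, List.mem_cons, not_or] at hnd2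
      refine grid_mem_of_gridRow_mem (disjointCommute_rS z) (nodup_sites _) (nodup_sites _)
        (disjoint_sites hjk) fun y hy => ?_
      have hy' : y.1 ≠ i := by rw [mem_sites.1 hy]; exact hjk
      rw [hA]
      refine gridRow_mem_of_pair (rS_mul_rS_mem_row hη z i x hx hy') (fun a ha => ?_)
        fun a ha => ?_
      · refine rS_mem_of_ne z i x hx (hfst hy') (hfst hy') ?_ ?_
        · exact hnd3 a ha _ (by simp)
        · exact hnd3 a ha _ (by simp)
      · refine rS_mem_of_ne z i x hx (hfst hy') (hfst hy') ?_ ?_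
        · rintro rfl; exact hnd2.2.1 ha
        · rintro rfl; exact hnd2.1.2 ha
    · refine mem_rightMultiples_of_commute (commute_grid fun s hs s' hs' => ?_).symm
      rw [mem_sites] at hs hs'
      subst hs hs'
      exact ((commute_sR (hfst (Ne.symm hi)) (hfst (Ne.symm hi)) (hfst (Ne.symm hi'))
        (hfst (Ne.symm hi')) _ _).smul_left _).symm

theorem mulAll_tpr (f : Site n → Fin 2 → ℂ) : mulAll D n (tpr f) =
    PiTensorProduct.tprod ℂ fun i => mulMap D.τ (n i) (PiTensorProduct.tprod ℂ fun x => f ⟨i, x⟩) := by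
  rw [mulAll, tpr, PiTensorProduct.map_tprod]

theorem mulMap_tprod_comp_perm (τ : UpperHalfPlane) (m : ℕ) (v : Fin m → Fin 2 → ℂ)
    (σ : Equiv.Perm (Fin m)) : mulMap τ m (PiTensorProduct.tprod ℂ fun x => v (σ x)) =
      mulMap τ m (PiTensorProduct.tprod ℂ v) := by
  apply Subtype.ext
  funext y
  rw [mulMap_tprod, mulMap_tprod]
  exact Equiv.prod_comp σ fun i => v i 0 * halfBasis τ 0 y + v i 1 * halfBasis τ 1 y

theorem comp_swap_site (f : Site n → Fin 2 → ℂ) (i : Fin N) (x y : Fin (n i)) :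
    tpr (f ∘ Equiv.swap (⟨i, x⟩ : Site n) ⟨i, y⟩) = PiTensorProduct.tprod ℂ
      (Function.update (fun i => PiTensorProduct.tprod ℂ fun x => f ⟨i, x⟩) i
        (PiTensorProduct.tprod ℂ fun w => f ⟨i, Equiv.swap x y w⟩)) := by
  rw [tpr]
  congr 1
  funext k
  by_cases h : k = i
  · subst h
    rw [Function.update_self]
    congr 1
    funext w
    simp only [Function.comp]
    congr 1
    by_cases hx : w = x
    · subst hx; simp
    · by_cases hy : w = y
      · subst hy; simp
      · rw [Equiv.swap_apply_of_ne_of_ne hx hy, Equiv.swap_apply_of_ne_of_ne] <;> simpa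
  · rw [Function.update_of_ne h]
    congr 1
    funext w
    simp only [Function.comp]
    congr 1
    refine Equiv.swap_apply_of_ne_of_ne ?_ ?_ <;> exact fun e => h (congrArg Sigma.fst e)

theorem eq_zero_of_add_eq_right {M : Type*} [AddCommMonoid M] [Module ℂ M] {a b : M}
    (h : a + b = b) : a = 0 := by
  let _ : AddCommGroup M := Module.addCommMonoidToAddCommGroup ℂ
  exact add_eq_right.1 h

/-- Multiplication of functions is commutative, so it does not see the flip `P` and kills `P - 1`.
-/
theorem mulAll_antisym (hη : D.th 1 1 (2 * D.η) ≠ 0) (i : Fin N) (x : ℕ) (hx : x + 1 < n i)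
    (v : BigSpace n) : mulAll D n (antisym D n i x hx v) = 0 := by
  have h : mulAll D n ∘ₗ antisym D n i x hx = 0 := by
    refine bigSpace_ext fun f => ?_
    have e := congrArg (mulAll D n) (sR_neg_two_eta_tpr hη f (site_succ_ne i x hx))
    have e' : mulAll D n (tpr (f ∘ Equiv.swap (⟨i, ⟨x + 1, hx⟩⟩ : Site n) ⟨i, ⟨x, by omega⟩⟩)) =
        mulAll D n (tpr f) := by
      rw [comp_swap_site, mulAll, PiTensorProduct.map_tprod, tpr, PiTensorProduct.map_tprod]
      congr 1
      funext k
      by_cases h : k = i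
      · subst h
        rw [Function.update_self, mulMap_tprod_comp_perm _ _ fun w => f ⟨k, w⟩]
      · rw [Function.update_of_ne h]
    rw [map_add, e'] at e
    exact eq_zero_of_add_eq_right e
  exact LinearMap.congr_fun h v

/-- A linear map invariant under the transpositions of neighbouring copies of `ℂ²` in every block
factors through the multiplication map. -/
theorem apply_map_mulSection (hη : D.th 1 1 (2 * D.η) ≠ 0) {W : Type*} [AddCommMonoid W]
    [Module ℂ W] (P : BigSpace n →ₗ[ℂ] W)
    (hP : ∀ (i : Fin N) (x y : Fin (n i)) (f : Site n → Fin 2 → ℂ), (x : ℕ) + 1 = y →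
      P (tpr (f ∘ Equiv.swap (⟨i, x⟩ : Site n) ⟨i, y⟩)) = P (tpr f)) (v : BigSpace n) :
    P (PiTensorProduct.map (fun i => mulSection D.τ (n i)) (mulAll D n v)) = P v := by
  have step : ∀ (i : Fin N) (v : ∀ i, HalfTensor (n i)),
      P (PiTensorProduct.tprod ℂ (Function.update v i
        (mulSection D.τ (n i) (mulMap D.τ (n i) (v i))))) = P (PiTensorProduct.tprod ℂ v) := by
    intro i v
    have h := apply_mulSection_mulMap hη (P ∘ₗ (PiTensorProduct.tprod ℂ).toLinearMap v i)
      (fun w x y hxy => ?_) (v i)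
    · simpa using h
    -- Invariance is given on pure tensors of vectors of `ℂ²` only. As an identity of linear maps it
    -- holds for arbitrary tensors in the other blocks, some of which may already have been
    -- replaced.
    · have hsw : P ∘ₗ PiTensorProduct.map (Function.update (fun _ => LinearMap.id) i
          ((PiTensorProduct.reindex ℂ (fun _ => Fin 2 → ℂ) (Equiv.swap x y)).toLinearMap)) = P := by
        refine bigSpace_ext fun f => ?_
        rw [LinearMap.comp_apply, ← hP i x y f hxy, comp_swap_site, tpr, PiTensorProduct.map_tprod]
        congr 2
        funext k
        by_cases h : k = i
        · subst h
          rw [Function.update_self, Function.update_self, LinearEquiv.coe_coe,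
            PiTensorProduct.reindex_tprod]
          rfl
        · rw [Function.update_of_ne h, Function.update_of_ne h, LinearMap.id_apply]
      have e := LinearMap.congr_fun hsw (PiTensorProduct.tprod ℂ
        (Function.update v i (PiTensorProduct.tprod ℂ w)))
      rw [LinearMap.comp_apply, PiTensorProduct.map_tprod] at e
      change P (PiTensorProduct.tprod ℂ (Function.update v i _)) =
        P (PiTensorProduct.tprod ℂ (Function.update v i _))
      rw [← e]
      congr 2
      funext k
      by_cases h : k = i
      · subst h
        simp only [Function.update_self, LinearEquiv.coe_coe]
        rw [PiTensorProduct.reindex_tprod]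
        rfl
      · simp only [Function.update_of_ne h, LinearMap.id_apply]
  have all : ∀ (S : Finset (Fin N)) (v : ∀ i, HalfTensor (n i)),
      P (PiTensorProduct.tprod ℂ fun i => if i ∈ S then mulSection D.τ (n i)
        (mulMap D.τ (n i) (v i)) else v i) = P (PiTensorProduct.tprod ℂ v) := by
    intro S v
    induction S using Finset.induction_on with
    | empty => simp
    | insert i S hi ih =>
      rw [← ih, ← step i fun k => if k ∈ S then _ else _]
      congr 2
      funext k
      by_cases h : k = i
      · subst h; simp [hi]
      · simp [h]
  suffices h : P ∘ₗ PiTensorProduct.map (fun i => mulSection D.τ (n i)) ∘ₗ mulAll D n = P from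
    LinearMap.congr_fun h v
  refine PiTensorProduct.ext (MultilinearMap.ext fun v => ?_)
  have := all Finset.univ v
  simp only [Finset.mem_univ, if_true] at this
  simp only [LinearMap.compMultilinearMap_apply, LinearMap.comp_apply, mulAll,
    PiTensorProduct.map_tprod]
  exact this

/-- On the range of `mulAll` the choice of section is immaterial: the product of `R` matrices
followed by multiplication is invariant under the flips within the blocks. -/
theorem fusedR_mulAll (hη : D.th 1 1 (2 * D.η) ≠ 0) (z : Fin N → ℂ) {j k : Fin N}
    (hjk : j ≠ k) (v : BigSpace n) :
    fusedR D n j k (z j - z k) (mulAll D n v) = mulAll D n (blockR D n z j k v) := by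
  refine apply_map_mulSection hη (mulAll D n ∘ₗ prodR D n j k (z j - z k))
    (fun i x y f hxy => ?_) v
  obtain ⟨x, hx⟩ := x
  obtain ⟨y, hy⟩ := y
  obtain rfl : x + 1 = y := hxy
  obtain ⟨m, hm⟩ := prodR_mem_rightMultiples hη z hjk i x hy
  rw [Equiv.swap_comm, ← sR_neg_two_eta_tpr hη f (site_succ_ne i x hy), map_add]
  have e := congrArg (mulAll D n) (LinearMap.congr_fun hm (tpr f))
  rw [Module.End.mul_apply, Module.End.mul_apply, mulAll_antisym hη] at e
  rw [LinearMap.comp_apply, ← antisym, e, zero_add]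

end Fusion

/-! ### Families of path vectors -/

section PathFamilies

variable {N : ℕ} {n : Fin N → ℕ} {D : Params} {S : Type*}

/-- The algebra `𝓜` of functions of a parameter contains the entire functions of the difference of
the spectral parameters `w` with the labels `j` and `k`, and the denominators of the `R` matrices
are invertible in it. -/
structure IsCoeffAlg (D : Params) (w : S → Fin N → ℂ) (𝓜 : Subalgebra ℂ (S → ℂ)) (j k : Fin N) :
    Prop where
  entire : ∀ P : ℂ → ℂ, Differentiable ℂ P → (fun σ => P (w σ j - w σ k)) ∈ 𝓜
  inv : ∀ m : ℤ, (fun σ => (D.th 1 1 (w σ j - w σ k + m * D.η))⁻¹) ∈ 𝓜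

/-- The components of `f` at the copies of `ℂ²` in the list are spin `1/2` intertwining vectors
along a path of heights from `a` to `b`. -/
def PathFam (D : Params) (w : S → Fin N → ℂ) (f : S → Site n → Fin 2 → ℂ) :
    List (Site n) → ℤ → ℤ → Prop
  | [], a, b => a = b
  | s :: L, a, b => ∃ b', HStep a b' ∧ (∀ σ, f σ s = half D a b' (zeta D (w σ) s)) ∧
      PathFam D w f L b' b

theorem pathFam_append {w : S → Fin N → ℂ} {f : S → Site n → Fin 2 → ℂ} {L L' : List (Site n)}
    {a b : ℤ} : PathFam D w f (L ++ L') a b ↔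
      ∃ c, PathFam D w f L a c ∧ PathFam D w f L' c b := by
  induction L generalizing a with
  | nil => simp [PathFam]
  | cons s L ih =>
    simp only [List.cons_append, PathFam, ih]
    constructor
    · rintro ⟨b', h1, h2, c, h3, h4⟩; exact ⟨c, ⟨b', h1, h2, h3⟩, h4⟩
    · rintro ⟨c, ⟨b', h1, h2, h3⟩, h4⟩; exact ⟨b', h1, h2, c, h3, h4⟩

theorem PathFam.congr {w : S → Fin N → ℂ} {f f' : S → Site n → Fin 2 → ℂ} {L : List (Site n)}
    {a b : ℤ} (h : PathFam D w f L a b) (hf : ∀ s ∈ L, ∀ σ, f' σ s = f σ s) :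
    PathFam D w f' L a b := by
  induction L generalizing a with
  | nil => exact h
  | cons s L ih =>
    obtain ⟨b', h1, h2, h3⟩ := h
    exact ⟨b', h1, fun σ => (hf s List.mem_cons_self σ).trans (h2 σ),
      ih h3 fun s' hs' => hf s' (List.mem_cons_of_mem _ hs')⟩

/-- The span of the families `p(σ) ⊗_s f_σ(s)` with `p` in `𝓜` and `f` given by a path along `L`, and
by `f₀` outside `L`. -/
def pathSpan (D : Params) (𝓜 : Subalgebra ℂ (S → ℂ)) (w : S → Fin N → ℂ)
    (f₀ : S → Site n → Fin 2 → ℂ) (L : List (Site n)) (a b : ℤ) : Submodule ℂ (S → BigSpace n) :=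
  Submodule.span ℂ {X | ∃ p ∈ 𝓜, ∃ f : S → Site n → Fin 2 → ℂ, PathFam D w f L a b ∧
    (∀ s ∉ L, ∀ σ, f σ s = f₀ σ s) ∧ X = fun σ => p σ • tpr (f σ)}

/-- Linear operators depending on the parameter, as operators on families. -/
def famMap {V W : Type*} [AddCommMonoid V] [Module ℂ V] [AddCommMonoid W] [Module ℂ W]
    (T : S → V →ₗ[ℂ] W) : (S → V) →ₗ[ℂ] (S → W) where
  toFun X σ := T σ (X σ)
  map_add' X Y := by funext σ; simp
  map_smul' c X := by funext σ; simp

theorem famMap_mem {V W : Type*} [AddCommMonoid V] [Module ℂ V] [AddCommMonoid W] [Module ℂ W]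
    {T : S → V →ₗ[ℂ] W} {s : Set (S → V)} {p : Submodule ℂ (S → W)}
    (h : ∀ X ∈ s, (fun σ => T σ (X σ)) ∈ p) {X : S → V} (hX : X ∈ Submodule.span ℂ s) :
    (fun σ => T σ (X σ)) ∈ p := by
  have : Submodule.span ℂ s ≤ p.comap (famMap T) := Submodule.span_le.2 h
  exact this hX

variable {𝓜 : Subalgebra ℂ (S → ℂ)} {w : S → Fin N → ℂ}

/-- This is `half_exchange` at two neighbouring copies of a path. The weights are entire in the
difference of the block parameters and the scalar of `R` has an admitted denominator, so the
coefficients remain in `𝓜`. -/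
theorem rS_pathSpan (hη : D.th 1 1 (2 * D.η) ≠ 0) (hlam : ∀ a : ℤ, D.th 1 1 (D.height a) ≠ 0)
    {f₀ : S → Site n → Fin 2 → ℂ} {L₁ L₂ : List (Site n)} {s s' : Site n}
    (hM : IsCoeffAlg D w 𝓜 s.1 s'.1) (hs : s.1 ≠ s'.1) (hL : (L₁ ++ s :: s' :: L₂).Nodup) {a b : ℤ} {X : S → BigSpace n}
    (hX : X ∈ pathSpan D 𝓜 w f₀ (L₁ ++ s :: s' :: L₂) a b) :
    (fun σ => rS D (w σ) s s' (X σ)) ∈ pathSpan D 𝓜 w f₀ (L₁ ++ s' :: s :: L₂) a b := by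
  have hss : s ≠ s' := fun e => hs (congrArg Sigma.fst e)
  refine famMap_mem ?_ hX
  rintro _ ⟨p, hp, f, hf, hf₀, rfl⟩
  obtain ⟨c₁, h₁, c₂, hst, hfs, c₃, hst', hfs', h₂⟩ := pathFam_append.1 hf
  obtain ⟨t, C, ht, hC, hCe⟩ := half_exchange hη hlam hst hst'
  obtain ⟨m, hm⟩ : ∃ m : ℂ, ∀ σ, zeta D (w σ) s - zeta D (w σ) s' = w σ s.1 - w σ s'.1 + m :=
    ⟨((n s.1 : ℂ) + 1 - 2 * ((s.2 : ℂ) + 1)) * D.η - ((n s'.1 : ℂ) + 1 - 2 * ((s'.2 : ℂ) + 1)) * D.η,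
      fun σ => by simp only [zeta]; ring⟩
  have hden : (fun σ => D.th 1 1 (2 * D.η) / D.th 1 1 (zeta D (w σ) s - zeta D (w σ) s' + 2 * D.η))
      ∈ 𝓜 := by
    have e : ∃ k : ℤ, ∀ σ, zeta D (w σ) s - zeta D (w σ) s' + 2 * D.η =
        w σ s.1 - w σ s'.1 + k * D.η := by
      refine ⟨(n s.1 - 2 * s.2) - (n s'.1 - 2 * s'.2) + 2, fun σ => ?_⟩
      simp only [zeta]
      push_cast
      ring
    obtain ⟨k, hk⟩ := e
    simp only [hk, div_eq_mul_inv]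
    exact 𝓜.smul_mem (hM.inv k) _
  let F : ℤ → S → Site n → Fin 2 → ℂ := fun c σ =>
    Function.update (Function.update (f σ) s (half D c c₃ (zeta D (w σ) s))) s'
      (half D c₁ c (zeta D (w σ) s'))
  have key : (fun σ => rS D (w σ) s s' (p σ • tpr (f σ))) = ∑ c ∈ t, fun σ =>
      (p σ * (D.th 1 1 (2 * D.η) / D.th 1 1 (zeta D (w σ) s - zeta D (w σ) s' + 2 * D.η)) *
        C c (w σ s.1 - w σ s'.1 + m)) • tpr (F c σ) := by
    funext σ
    rw [Finset.sum_apply, rS, LinearMap.smul_apply, map_smul, sR_tpr _ hss]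
    have eF : ∀ c, tpr (F c σ) = _ := fun c => tpr_update_update (f σ) hss _ _
    simp only [hfs, hfs', hCe, eF, Finset.sum_smul, Finset.smul_sum, smul_smul]
    rw [← hm]
    simp only [Finset.sum_comm (s := (Finset.univ : Finset (Fin 2))) (t := t)]
    refine Finset.sum_congr rfl fun c _ => Finset.sum_congr rfl fun i _ =>
      Finset.sum_congr rfl fun j _ => ?_
    congr 1
    ring
  rw [key]
  refine Submodule.sum_mem _ fun c hc => Submodule.subset_span ⟨_, ?_, F c, ?_, ?_, rfl⟩
  · refine 𝓜.mul_mem (𝓜.mul_mem hp hden) ?_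
    have := hM.entire (fun x => C c (x + m)) ((hC c).comp (by fun_prop))
    exact this
  · have hnd := List.nodup_append.1 hL
    have hnd₂ : s ∉ L₂ ∧ s' ∉ L₂ := by
      have := hnd.2.1
      simp only [List.nodup_cons, List.mem_cons, not_or] at this
      exact ⟨this.1.2, this.2.1⟩
    have hF : ∀ u, u ≠ s → u ≠ s' → ∀ σ, F c σ u = f σ u := fun u h h' σ => by
      simp only [F, Function.update_of_ne h, Function.update_of_ne h']
    refine pathFam_append.2 ⟨c₁, h₁.congr fun u hu => hF u ?_ ?_, c, (ht c hc).1, fun σ => ?_, c₃,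
      (ht c hc).2, fun σ => ?_, h₂.congr fun u hu => hF u ?_ ?_⟩
    · exact hnd.2.2 u hu s (by simp)
    · exact hnd.2.2 u hu s' (by simp)
    · simp only [F, Function.update_self]
    · simp only [F, Function.update_of_ne hss, Function.update_self]
    · rintro rfl; exact hnd₂.1 hu
    · rintro rfl; exact hnd₂.2 hu
  · intro u hu σ
    simp only [List.mem_append, List.mem_cons, not_or] at hu
    simp only [F, Function.update_of_ne hu.2.1, Function.update_of_ne hu.2.2.1]
    refine hf₀ u ?_ σ
    simp only [List.mem_append, List.mem_cons, not_or]
    tauto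

theorem gridCol_pathSpan (hη : D.th 1 1 (2 * D.η) ≠ 0)
    (hlam : ∀ a : ℤ, D.th 1 1 (D.height a) ≠ 0)
    {f₀ : S → Site n → Fin 2 → ℂ} {L₁ A L₂ : List (Site n)} {y : Site n}
    (hM : ∀ x ∈ A, IsCoeffAlg D w 𝓜 x.1 y.1)
    (hA : ∀ x ∈ A, x.1 ≠ y.1) (hL : (L₁ ++ A ++ y :: L₂).Nodup) {a b : ℤ} {X : S → BigSpace n}
    (hX : X ∈ pathSpan D 𝓜 w f₀ (L₁ ++ A ++ y :: L₂) a b) :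
    (fun σ => gridCol (rS D (w σ)) A y (X σ)) ∈ pathSpan D 𝓜 w f₀ (L₁ ++ y :: A ++ L₂) a b := by
  induction A generalizing L₁ with
  | nil => simpa [gridCol] using hX
  | cons x A ih =>
    simp only [gridCol_cons, Module.End.mul_apply]
    have e : L₁ ++ x :: A ++ y :: L₂ = (L₁ ++ [x]) ++ A ++ y :: L₂ := by simp
    rw [e] at hL hX
    have h := ih (fun x' hx' => hM x' (List.mem_cons_of_mem _ hx'))
      (fun x' hx' => hA x' (List.mem_cons_of_mem _ hx')) hL hX
    have e' : L₁ ++ [x] ++ y :: A ++ L₂ = L₁ ++ x :: y :: (A ++ L₂) := by simp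
    rw [e'] at h
    have := rS_pathSpan hη hlam (hM x List.mem_cons_self) (hA x List.mem_cons_self) ?_ h
    · simpa using this
    · refine (List.Perm.nodup_iff ?_).1 hL
      simpa using (List.perm_middle.cons x).append_left L₁

theorem grid_pathSpan (hη : D.th 1 1 (2 * D.η) ≠ 0)
    (hlam : ∀ a : ℤ, D.th 1 1 (D.height a) ≠ 0)
    {f₀ : S → Site n → Fin 2 → ℂ} {L₁ A B L₂ : List (Site n)}
    (hM : ∀ x ∈ A, ∀ y ∈ B, IsCoeffAlg D w 𝓜 x.1 y.1)
    (hA : ∀ x ∈ A, ∀ y ∈ B, x.1 ≠ y.1) (hL : (L₁ ++ A ++ (B ++ L₂)).Nodup) {a b : ℤ}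
    {X : S → BigSpace n} (hX : X ∈ pathSpan D 𝓜 w f₀ (L₁ ++ A ++ (B ++ L₂)) a b) :
    (fun σ => grid (rS D (w σ)) A B (X σ)) ∈ pathSpan D 𝓜 w f₀ (L₁ ++ B ++ (A ++ L₂)) a b := by
  induction B generalizing L₁ X with
  | nil => simpa [grid] using hX
  | cons y B ih =>
    simp only [grid, Module.End.mul_apply]
    have h := gridCol_pathSpan hη hlam (L₂ := B ++ L₂) (fun x hx => hM x hx y List.mem_cons_self)
      (fun x hx => hA x hx y List.mem_cons_self) hL hX
    have e : L₁ ++ y :: A ++ (B ++ L₂) = (L₁ ++ [y]) ++ A ++ (B ++ L₂) := by simp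
    rw [e] at h
    have := ih (fun x hx y' hy' => hM x hx y' (List.mem_cons_of_mem _ hy'))
      (fun x hx y' hy' => hA x hx y' (List.mem_cons_of_mem _ hy')) ?_ h
    · simpa using this
    · refine (List.Perm.nodup_iff ?_).1 hL
      simpa using List.perm_middle.append_left L₁

end PathFamilies

/-! ### Intertwining vectors as products along paths -/

section BlockPaths

variable {N : ℕ} {n : Fin N → ℕ} {D : Params} {S : Type*}

/-- The zeros of the intertwining vectors of the first kind. -/
def upX (D : Params) (m : ℕ) (a : ℤ) (u : ℂ) (j : ℕ) : ℂ :=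
  (D.height a - u) / 2 + (2 * (j : ℂ) + 1 - (m : ℂ) / 2) * D.η

/-- The zeros of the intertwining vectors of the second kind. -/
def dnX (D : Params) (m : ℕ) (a : ℤ) (u : ℂ) (i : ℕ) : ℂ :=
  (D.height a + u) / 2 + (2 * (i : ℂ) + 1 - 3 * (m : ℂ) / 2) * D.η

/-- The zeros of the second kind are expressed through the initial height `a` and indexed from `k`
on. Then the vectors for all final heights `a'` use the same two sequences, as
`linearIndependent_qprod` requires. -/
theorem coe_intVec {m k : ℕ} (hk : k ≤ m) {a a' : ℤ} (h : a' = a + 2 * k - m) (u : ℂ) :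
    (intVec D m a a' u : ℂ → ℂ) = qprod D m (upX D m a u) (dnX D m a u) k := by
  funext y
  have e : (Fin.ofNat (m + 1) (((m : ℤ) + a' - a) / 2).toNat : ℕ) = k := by
    have : (((m : ℤ) + a' - a) / 2).toNat = k := by omega
    rw [this, Fin.val_ofNat, Nat.mod_eq_of_lt (by omega)]
  rw [intVec]
  simp only [intVecFun, e, qprod]
  have hI : ∀ t, Finset.Icc 1 t = Finset.Ico 1 (t + 1) := fun t => rfl
  rw [hI, hI, Finset.prod_Ico_eq_prod_range, Finset.prod_Ico_eq_prod_range,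
    Finset.prod_Ico_eq_prod_range _ k m, Nat.add_sub_cancel, Nat.add_sub_cancel]
  congr 1
  · refine Finset.prod_congr rfl fun j _ => ?_
    have : (D.height a - u) / 2 + (2 * ((1 + j : ℕ) : ℂ) - (m : ℂ) / 2 - 1) * D.η =
        upX D m a u j := by
      rw [upX]; push_cast; ring
    rw [this, qf]
  · refine Finset.prod_congr rfl fun j _ => ?_
    have : (D.height a' + u) / 2 + (2 * ((1 + j : ℕ) : ℂ) - (m : ℂ) / 2 - 1) * D.η =
        dnX D m a u (k + j) := by
      rw [dnX, h, Params.height, Params.height]; push_cast; ring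
    rw [this, qf]

theorem qf_neg (x y : ℂ) : qf D (-x) y = qf D x y := by
  rw [qf, qf, sub_neg_eq_add, ← sub_eq_add_neg, mul_comm]

theorem half_halfBasis (a b : ℤ) (u y : ℂ) :
    half D a b u 0 * halfBasis D.τ 0 y + half D a b u 1 * halfBasis D.τ 1 y =
      qf D ((((b - a : ℤ) : ℂ) * D.height a - u + D.η) / 2) y := pv_halfBasis D _ _

theorem take_succ_sites (j : Fin N) (t : ℕ) (ht : t < n j) :
    (sites n j).take (t + 1) = (sites n j).take t ++ [⟨j, ⟨t, ht⟩⟩] := by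
  have hl : (sites n j).length = n j := by simp [sites]
  rw [List.take_succ_eq_append_getElem (by omega)]
  simp [sites]

/-- Heights change by `±2η` per step and the spectral parameter by `-2η`. For a rising step these
combine so that earlier falling steps have no effect, and conversely. Hence the factors depend only
on the numbers of steps of each kind, not on their order. -/
theorem pathFam_take_sites {w : S → Fin N → ℂ} {f : S → Site n → Fin 2 → ℂ} {j : Fin N} {t : ℕ}
    (ht : t ≤ n j) {a b : ℤ} (h : PathFam D w f ((sites n j).take t) a b) :
    ∃ k ≤ t, b = a + 2 * k - t ∧ ∀ σ y, (((sites n j).take t).map fun s =>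
      f σ s 0 * halfBasis D.τ 0 y + f σ s 1 * halfBasis D.τ 1 y).prod =
      (∏ i ∈ Finset.range k, qf D (upX D (n j) a (w σ j) i) y) *
        ∏ i ∈ Finset.range (t - k),
          qf D ((D.height a + w σ j) / 2 + ((n j : ℂ) / 2 - 1 - 2 * i) * D.η) y := by
  induction t generalizing b with
  | zero =>
    rw [List.take_zero] at h
    have h : a = b := h
    exact ⟨0, le_rfl, by simp [h], by simp⟩
  | succ t ih =>
    have htl : t < n j := ht
    rw [take_succ_sites j t htl] at h ⊢
    obtain ⟨c, h1, b', hst, hf, h2⟩ := pathFam_append.1 h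
    obtain rfl : b' = b := h2
    obtain ⟨k, hk, hc, hp⟩ := ih (by omega) h1
    have hc' : (c : ℂ) = a + 2 * k - t := by exact_mod_cast congrArg (Int.cast : ℤ → ℂ) hc
    rcases hst with hst | hst
    · refine ⟨k + 1, by omega, by rw [hst, hc]; push_cast; ring, fun σ y => ?_⟩
      rw [List.map_append, List.prod_append, hp, Finset.prod_range_succ,
        show t + 1 - (k + 1) = t - k by omega]
      simp only [List.map_cons, List.map_nil, List.prod_singleton, hf, half_halfBasis]
      have : (((b' - c : ℤ) : ℂ) * D.height c - zeta D (w σ) (⟨j, ⟨t, htl⟩⟩ : Site n) + D.η) / 2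
          = upX D (n j) a (w σ j) k := by
        rw [hst, upX, zeta, Params.height, Params.height]
        push_cast
        rw [hc']
        ring
      rw [this]
      ring
    · refine ⟨k, by omega, by rw [hst, hc]; push_cast; ring, fun σ y => ?_⟩
      rw [List.map_append, List.prod_append, hp, show t + 1 - k = (t - k) + 1 by omega,
        Finset.prod_range_succ]
      simp only [List.map_cons, List.map_nil, List.prod_singleton, hf, half_halfBasis]
      have : (((b' - c : ℤ) : ℂ) * D.height c - zeta D (w σ) (⟨j, ⟨t, htl⟩⟩ : Site n) + D.η) / 2
          = -((D.height a + w σ j) / 2 + ((n j : ℂ) / 2 - 1 - 2 * ((t - k : ℕ) : ℂ)) * D.η) := by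
        rw [hst, zeta, Params.height, Params.height]
        push_cast [Nat.cast_sub hk]
        rw [hc']
        ring
      rw [this, qf_neg]
      ring

/-- `a - b ∈ {-m, -m + 2, …, m}`. -/
def Adm (m : ℕ) (a b : ℤ) : Prop := ∃ k : ℕ, k ≤ m ∧ a - b = 2 * (k : ℤ) - (m : ℤ)

theorem Adm.exists_up {m : ℕ} {a b : ℤ} (h : Adm m a b) : ∃ k : ℕ, k ≤ m ∧ b = a + 2 * k - m := by
  obtain ⟨k, hk, e⟩ := h
  exact ⟨m - k, by omega, by omega⟩

theorem sites_take_self (j : Fin N) : (sites n j).take (n j) = sites n j :=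
  List.take_of_length_le (by simp [sites])

/-- All paths between two given heights multiply to the same spin `l` vector, so after fusion only
the heights at the ends of a block are remembered. -/
theorem PathFam.mulMap_eq {w : S → Fin N → ℂ} {f : S → Site n → Fin 2 → ℂ} {j : Fin N} {a b : ℤ}
    (h : PathFam D w f (sites n j) a b) : Adm (n j) a b ∧
      ∀ σ, mulMap D.τ (n j) (PiTensorProduct.tprod ℂ fun x => f σ ⟨j, x⟩) =
        intVec D (n j) a b (w σ j) := by
  rw [← sites_take_self] at h
  obtain ⟨k, hk, hb, hp⟩ := pathFam_take_sites le_rfl h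
  refine ⟨⟨n j - k, by omega, by omega⟩, fun σ => Subtype.ext (funext fun y => ?_)⟩
  rw [mulMap_tprod, coe_intVec hk hb, qprod]
  have := hp σ y
  rw [sites_take_self, sites, List.map_ofFn, List.prod_ofFn] at this
  refine this.trans ?_
  congr 1
  -- The path produces the zeros of the second kind in descending order, whereas `dnX` lists them
  -- ascending.
  rw [Finset.prod_Ico_eq_prod_range, ← Finset.prod_range_reflect]
  refine Finset.prod_congr rfl fun i hi => ?_
  rw [Finset.mem_range] at hi
  obtain ⟨q, hq, hq'⟩ : ∃ q, n j - k - 1 - i = q ∧ n j = k + q + 1 + i := ⟨_, rfl, by omega⟩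
  have e : (n j : ℂ) = k + q + 1 + i := by exact_mod_cast congrArg (Nat.cast : ℕ → ℂ) hq'
  congr 1
  rw [dnX, hq, e]
  push_cast
  ring

theorem Adm.exists_heights {m : ℕ} {a b : ℤ} (h : Adm m a b) :
    ∃ c : ℕ → ℤ, c 0 = a ∧ c m = b ∧ ∀ x, HStep (c x) (c (x + 1)) := by
  obtain ⟨k, hk, rfl⟩ := h.exists_up
  -- First `k` steps up, then only steps down.
  refine ⟨fun x => if x ≤ k then a + x else a + 2 * k - x, by simp, ?_, fun x => ?_⟩
  · simp only
    split <;> omega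
  · unfold HStep
    simp only
    split <;> split <;> omega

theorem pathFam_of_heights {w : S → Fin N → ℂ} {f : S → Site n → Fin 2 → ℂ} {j : Fin N}
    {c : ℕ → ℤ} (hc : ∀ x, HStep (c x) (c (x + 1)))
    (hf : ∀ σ x, f σ ⟨j, x⟩ = half D (c x) (c (x + 1)) (zeta D (w σ) (⟨j, x⟩ : Site n))) :
    PathFam D w f (sites n j) (c 0) (c (n j)) := by
  rw [← sites_take_self]
  have : ∀ t ≤ n j, PathFam D w f ((sites n j).take t) (c 0) (c t) := by
    intro t ht
    induction t with
    | zero => rw [List.take_zero]; rfl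
    | succ t ih =>
      rw [take_succ_sites j t (by omega)]
      exact pathFam_append.2 ⟨c t, ih (by omega), c (t + 1), hc t, fun σ => hf σ _, rfl⟩
  exact this _ le_rfl

/-! ### Families of vectors in the state space -/

/-- The tensor product of the intertwining vectors for the pairs of heights `g`. -/
def gvec (D : Params) (n : Fin N → ℕ) (z : Fin N → ℂ) (g : Fin N → ℤ × ℤ) : StateSpace D n :=
  PiTensorProduct.tprod ℂ fun i => intVec D (n i) (g i).1 (g i).2 (z i)

theorem exists_lift (w : S → Fin N → ℂ) {g : Fin N → ℤ × ℤ}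
    (hg : ∀ i, Adm (n i) (g i).1 (g i).2) : ∃ f : S → Site n → Fin 2 → ℂ,
      ∀ i, PathFam D w f (sites n i) (g i).1 (g i).2 := by
  choose c hc₀ hc₁ hc using fun i => (hg i).exists_heights
  refine ⟨fun σ s => half D (c s.1 s.2) (c s.1 (s.2 + 1)) (zeta D (w σ) s), fun i => ?_⟩
  rw [← hc₀, ← hc₁]
  exact pathFam_of_heights (hc i) fun σ x => rfl

theorem mulAll_tpr_eq_gvec {w : S → Fin N → ℂ} {f : S → Site n → Fin 2 → ℂ} {g : Fin N → ℤ × ℤ}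
    (h : ∀ i, PathFam D w f (sites n i) (g i).1 (g i).2) (σ : S) :
    mulAll D n (tpr (f σ)) = gvec D n (w σ) g := by
  rw [mulAll_tpr, gvec]
  congr 1
  funext i
  exact (h i).mulMap_eq.2 σ

theorem gvec_mem_range {g : Fin N → ℤ × ℤ} (hg : ∀ i, Adm (n i) (g i).1 (g i).2)
    (z : Fin N → ℂ) : ∃ v, mulAll D n v = gvec D n z g := by
  obtain ⟨f, hf⟩ := exists_lift (D := D) (fun _ : Unit => z) hg
  exact ⟨_, mulAll_tpr_eq_gvec hf ()⟩

variable {𝓜 : Subalgebra ℂ (S → ℂ)} {w : S → Fin N → ℂ}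

/-- The fused exchange relation: the vectors are lifted to paths of spin 1/2 vectors, block `j` is
moved past block `k` one copy at a time, and multiplication leaves only the new middle height `μ`.
-/
theorem fusedR_gvec (hη : D.th 1 1 (2 * D.η) ≠ 0) (hlam : ∀ a : ℤ, D.th 1 1 (D.height a) ≠ 0)
    {g : Fin N → ℤ × ℤ} (hg : ∀ i, Adm (n i) (g i).1 (g i).2)
    {j k : Fin N} (hM : IsCoeffAlg D w 𝓜 j k) (hjk : j ≠ k) (h : (g j).2 = (g k).1) :
    (fun σ => fusedR D n j k (w σ j - w σ k) (gvec D n (w σ) g)) ∈ Submodule.span ℂ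
      {X | ∃ p ∈ 𝓜, ∃ μ, Adm (n k) (g j).1 μ ∧ Adm (n j) μ (g k).2 ∧
        X = fun σ => p σ • gvec D n (w σ)
          (Function.update (Function.update g j (μ, (g k).2)) k ((g j).1, μ))} := by
  obtain ⟨f, hf⟩ := exists_lift (D := D) w hg
  have h0 : (fun σ => tpr (f σ)) ∈
      pathSpan D 𝓜 w f ([] ++ sites n j ++ (sites n k ++ [])) (g j).1 (g k).2 := by
    refine Submodule.subset_span ⟨1, 𝓜.one_mem, f, ?_, fun _ _ _ => rfl, by simp⟩
    simp only [List.nil_append, List.append_nil]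
    exact pathFam_append.2 ⟨_, hf j, h ▸ hf k⟩
  have h1 := grid_pathSpan hη hlam (fun x hx y hy => by rwa [mem_sites.1 hx, mem_sites.1 hy])
    (fun x hx y hy => ?_) ?_ h0
  · have e : (fun σ => fusedR D n j k (w σ j - w σ k) (gvec D n (w σ) g)) = fun σ =>
        mulAll D n (grid (rS D (w σ)) (sites n j) (sites n k) (tpr (f σ))) := by
      funext σ
      rw [← mulAll_tpr_eq_gvec hf, fusedR_mulAll hη _ hjk, blockR, prodR_eq hη]
    rw [e]
    refine famMap_mem (T := fun _ => mulAll D n) ?_ h1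
    rintro _ ⟨p, hp, f', hf', hff', rfl⟩
    simp only [List.nil_append, List.append_nil] at hf' hff'
    obtain ⟨μ, hμ, hμ'⟩ := pathFam_append.1 hf'
    refine Submodule.subset_span ⟨p, hp, μ, hμ.mulMap_eq.1, hμ'.mulMap_eq.1, ?_⟩
    funext σ
    rw [map_smul, mulAll_tpr_eq_gvec (g := Function.update (Function.update g j (μ, (g k).2)) k
      ((g j).1, μ)) fun i => ?_]
    by_cases hi : i = k
    · subst hi; simpa using hμ
    · rw [Function.update_of_ne hi]
      by_cases hi' : i = j
      · subst hi'; simpa using hμ'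
      · rw [Function.update_of_ne hi']
        refine (hf i).congr fun s hs σ => hff' s ?_ σ
        rw [List.mem_append, mem_sites, mem_sites, mem_sites.1 hs]
        tauto
  · rw [mem_sites.1 hx, mem_sites.1 hy]; exact hjk
  · simp only [List.nil_append, List.append_nil]
    exact (nodup_sites j).append (nodup_sites k) (disjoint_sites hjk)

end BlockPaths

/-! ### Chains of heights and the functions attached to them -/

section Chains

variable {N : ℕ} {n : Fin N → ℕ} {D : Params}

/-- The value `e^{2πi a ν η}`. -/
def phase (D : Params) (a : ℤ) (ν : ZMod D.r) : ℂ :=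
  Complex.exp (2 * Real.pi * Complex.I * (a : ℂ) * (ν.val : ℂ) * D.η)

/-- The map `v ↦ (ν ↦ e^{2πi a ν η} v)`. -/
def embed (D : Params) (n : Fin N → ℕ) (a : ℤ) : StateSpace D n →ₗ[ℂ] FunSpace D n :=
  LinearMap.pi fun ν => phase D a ν • LinearMap.id

theorem embed_apply (a : ℤ) (v : StateSpace D n) (ν : ZMod D.r) :
    embed D n a v ν = phase D a ν • v := rfl

/-- The function `ν ↦ e^{2πi a ν η} ⊗_i φ_{g_i}(z_i)`. -/
def gfun (D : Params) (n : Fin N → ℕ) (z : Fin N → ℂ) (a : ℤ) (g : Fin N → ℤ × ℤ) :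
    FunSpace D n := embed D n a (gvec D n z g)

/-- The pairs `g_i`, for the labels `i` in the list, form an admissible path from `a` to `b`. -/
def Chain (n : Fin N → ℕ) (g : Fin N → ℤ × ℤ) : List (Fin N) → ℤ → ℤ → Prop
  | [], a, b => a = b
  | i :: l, a, b => (g i).1 = a ∧ Adm (n i) (g i).1 (g i).2 ∧ Chain n g l (g i).2 b

theorem chain_append {g : Fin N → ℤ × ℤ} {l l' : List (Fin N)} {a b : ℤ} :
    Chain n g (l ++ l') a b ↔ ∃ c, Chain n g l a c ∧ Chain n g l' c b := by
  induction l generalizing a with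
  | nil => simp [Chain]
  | cons i l ih =>
    simp only [List.cons_append, Chain, ih]
    constructor
    · rintro ⟨h1, h2, c, h3, h4⟩; exact ⟨c, ⟨h1, h2, h3⟩, h4⟩
    · rintro ⟨c, ⟨h1, h2, h3⟩, h4⟩; exact ⟨h1, h2, c, h3, h4⟩

theorem Chain.congr {g g' : Fin N → ℤ × ℤ} {l : List (Fin N)} {a b : ℤ} (h : Chain n g l a b)
    (hg : ∀ i ∈ l, g' i = g i) : Chain n g' l a b := by
  induction l generalizing a with
  | nil => exact h
  | cons i l ih =>
    obtain ⟨h1, h2, h3⟩ := h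
    have e := hg i List.mem_cons_self
    simp only [Chain, e]
    exact ⟨h1, h2, ih h3 fun i' hi' => hg i' (List.mem_cons_of_mem _ hi')⟩

theorem Chain.adm {g : Fin N → ℤ × ℤ} {l : List (Fin N)} {a b : ℤ} (h : Chain n g l a b) :
    ∀ i ∈ l, Adm (n i) (g i).1 (g i).2 := by
  induction l generalizing a with
  | nil => simp
  | cons i l ih =>
    obtain ⟨h1, h2, h3⟩ := h
    intro i' hi'
    rcases List.mem_cons.1 hi' with rfl | hi'
    · exact h2
    · exact ih h3 i' hi'

/-- The list is an arrangement of all labels. -/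
def Full (l : List (Fin N)) : Prop := l.Nodup ∧ ∀ i, i ∈ l

theorem Full.perm {l l' : List (Fin N)} (h : Full l) (hl : l.Perm l') : Full l' :=
  ⟨hl.nodup_iff.1 h.1, fun i => hl.mem_iff.1 (h.2 i)⟩

/-! ### Periodicity in the heights -/

/-- All heights are raised by `m`. -/
def raise (m : ℤ) (g : Fin N → ℤ × ℤ) (i : Fin N) : ℤ × ℤ := ((g i).1 + m, (g i).2 + m)

theorem adm_add {m : ℕ} {a b c : ℤ} : Adm m (a + c) (b + c) ↔ Adm m a b := by
  simp [Adm]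

theorem Chain.raise {g : Fin N → ℤ × ℤ} {l : List (Fin N)} {a b : ℤ} (h : Chain n g l a b) (m : ℤ) :
    Chain n (raise m g) l (a + m) (b + m) := by
  induction l generalizing a with
  | nil => exact congrArg (· + m) h
  | cons i l ih =>
    obtain ⟨h1, h2, h3⟩ := h
    exact ⟨congrArg (· + m) h1, adm_add.2 h2, ih h3⟩

theorem th10_add_int (x : ℂ) (k : ℤ) : D.th 1 0 (x + k) = (-1) ^ k * D.th 1 0 x := by
  have h1 : ∀ x, D.th 1 0 (x + 1) = -D.th 1 0 x := fun x => theta_one_add_one x _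
  induction k with
  | zero => simp
  | succ k ih =>
    push_cast at ih ⊢
    rw [← add_assoc, h1, ih, zpow_add_one₀ (by norm_num)]
    ring
  | pred k ih =>
    have e := h1 (x + (-(k : ℤ) - 1 : ℤ))
    have e' : x + ((-(k : ℤ) - 1 : ℤ) : ℂ) + 1 = x + ((-(k : ℤ) : ℤ) : ℂ) := by push_cast; ring
    rw [e', ih] at e
    rw [zpow_sub_one₀ (by norm_num)]
    linear_combination e

theorem th10_add_int_mul (x y : ℂ) (k : ℤ) :
    D.th 1 0 (y + (x + k)) * D.th 1 0 (y - (x + k)) = D.th 1 0 (y + x) * D.th 1 0 (y - x) := by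
  have e := D.th10_neg (y - (x + k))
  rw [← e, ← add_assoc, neg_sub, show x + k - y = (x - y) + k by ring, th10_add_int, th10_add_int,
    ← D.th10_neg (x - y), neg_sub]
  have : ((-1 : ℂ) ^ k) * (-1) ^ k = 1 := by
    rw [← mul_zpow]; simp
  linear_combination (D.th 1 0 (y + x) * D.th 1 0 (y - x)) * this

theorem height_add_mul (hr : 0 < D.r) (a m : ℤ) :
    D.height (a + m * D.r) = D.height a + 2 * ((m * D.r' : ℤ) : ℂ) := by
  have : (D.r : ℂ) ≠ 0 := by exact_mod_cast hr.ne'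
  rw [Params.height, Params.height, Params.η]
  push_cast
  field_simp
  ring

/-- Raising heights by a multiple of `r` changes `λ/2` by an integer, and `θ₁₀(y+x)θ₁₀(y-x)` has
period one in `x`. -/
theorem intVec_raise (hr : 0 < D.r) (m : ℕ) (a b k : ℤ) (u : ℂ) :
    intVec D m (a + k * D.r) (b + k * D.r) u = intVec D m a b u := by
  apply Subtype.ext
  funext y
  have e : (m : ℤ) + (b + k * D.r) - (a + k * D.r) = m + b - a := by ring
  simp only [intVec, e, intVecFun, height_add_mul hr]
  have e1 : ∀ (s t : ℂ), (s + 2 * ((k * D.r' : ℤ) : ℂ) - u) / 2 + t =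
      ((s - u) / 2 + t) + ((k * D.r' : ℤ) : ℂ) := fun s t => by ring
  have e2 : ∀ (s t : ℂ), (s + 2 * ((k * D.r' : ℤ) : ℂ) + u) / 2 + t =
      ((s + u) / 2 + t) + ((k * D.r' : ℤ) : ℂ) := fun s t => by ring
  simp only [e1, e2, th10_add_int_mul]

theorem phase_add_mul (hr : 0 < D.r) (a k : ℤ) (ν : ZMod D.r) :
    phase D (a + k * D.r) ν = phase D a ν := by
  have : (D.r : ℂ) ≠ 0 := by exact_mod_cast hr.ne'
  rw [phase, phase, Complex.exp_eq_exp_iff_exists_int]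
  refine ⟨k * D.r' * ν.val, ?_⟩
  rw [Params.η]
  push_cast
  field_simp

/-- Thanks to this periodicity closed chains with any initial height may be used. Rotation needs it,
since `a_{N-1}` may lie outside `{0, …, r-1}`. -/
theorem gfun_raise (hr : 0 < D.r) (z : Fin N → ℂ) (a k : ℤ) (g : Fin N → ℤ × ℤ) :
    gfun D n z (a + k * D.r) (raise (k * D.r) g) = gfun D n z a g := by
  have e : gvec D n z (raise (k * D.r) g) = gvec D n z g := by
    rw [gvec, gvec]
    congr 1
    funext i
    exact intVec_raise hr _ _ _ _ _
  rw [gfun, gfun, e]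
  funext ν
  rw [embed_apply, embed_apply, phase_add_mul hr]

/-- Every closed chain may be brought into the fundamental range of heights. -/
theorem exists_raise (hr : 0 < D.r) (a : ℤ) : ∃ k : ℤ, 0 ≤ a + k * D.r ∧ a + k * D.r < D.r := by
  have hr' : (0 : ℤ) < D.r := by exact_mod_cast hr
  refine ⟨-(a / D.r), ?_⟩
  have h1 := Int.emod_nonneg a hr'.ne'
  have h2 := Int.emod_lt_of_pos a hr'
  have h3 := Int.mul_ediv_add_emod a D.r
  constructor <;> nlinarith

/-! ### Linear independence -/

/-- The sums of zeros of the two kinds are heights and the differences are `-(u + kη)`; the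
hypotheses on the heights and on `u` are exactly what `linearIndependent_qprod` needs. -/
theorem linearIndependent_intVec (hη : D.th 1 1 (2 * D.η) ≠ 0)
    (hlam : ∀ a : ℤ, D.th 1 1 (D.height a) ≠ 0) (m : ℕ) (a : ℤ) {u : ℂ}
    (hu : ∀ k : ℤ, D.th 1 1 (u + k * D.η) ≠ 0) :
    LinearIndependent ℂ fun k : Fin (m + 1) => intVec D m a (a + 2 * (k : ℕ) - m) u := by
  refine LinearIndependent.of_comp (thetaSpace D.τ m).subtype ?_
  have e : ((thetaSpace D.τ m).subtype ∘ fun k : Fin (m + 1) =>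
      intVec D m a (a + 2 * (k : ℕ) - m) u) =
      fun k : Fin (m + 1) => qprod D m (upX D m a u) (dnX D m a u) k := by
    funext k
    exact coe_intVec (by omega) rfl u
  rw [e]
  refine linearIndependent_qprod hη fun j i _ _ => ⟨?_, ?_⟩
  · have : upX D m a u j + dnX D m a u i = D.height (a + j + i + 1 - m) := by
      rw [upX, dnX, Params.height, Params.height]; push_cast; ring
    rw [this]
    exact hlam _
  · have : upX D m a u j - dnX D m a u i = -(u + ((2 * i - 2 * j - m : ℤ) : ℂ) * D.η) := by
      rw [upX, dnX]; push_cast; ring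
    rw [this, D.th11_neg]
    exact neg_ne_zero.2 (hu _)

theorem exists_dual_intVec (hη : D.th 1 1 (2 * D.η) ≠ 0)
    (hlam : ∀ a : ℤ, D.th 1 1 (D.height a) ≠ 0) (m : ℕ) (a b : ℤ) {u : ℂ}
    (hu : ∀ k : ℤ, D.th 1 1 (u + k * D.η) ≠ 0) :
    ∃ ψ : thetaSpace D.τ m →ₗ[ℂ] ℂ, ∀ b', Adm m a b' →
      ψ (intVec D m a b' u) = if b' = b then 1 else 0 := by
  obtain ⟨L, hL⟩ := exists_linearMap_of_linearIndependent (linearIndependent_intVec hη hlam m a hu)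
    fun k => if a + 2 * ((k : ℕ) : ℤ) - m = b then (1 : ℂ) else 0
  refine ⟨L, fun b' hb' => ?_⟩
  obtain ⟨k, hk, rfl⟩ := hb'.exists_up
  exact hL ⟨k, by omega⟩

-- The functional of a factor separates final heights only for the prescribed initial height. Along
-- a chain this suffices: while the factors are `1` the heights agree, so the next initial height is
-- the prescribed one, and the first disagreement contributes a `0`.
open Classical in
theorem prod_dual_chain {R : Type*} [CommMonoidWithZero R] {g g₀ : Fin N → ℤ × ℤ}
    {x : Fin N → R} (hx : ∀ i, (g i).1 = (g₀ i).1 → Adm (n i) (g i).1 (g i).2 →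
      x i = if (g i).2 = (g₀ i).2 then 1 else 0) {l : List (Fin N)} {a b b₀ : ℤ}
    (h : Chain n g l a b) (h₀ : Chain n g₀ l a b₀) :
    (l.map x).prod = if ∀ i ∈ l, g i = g₀ i then 1 else 0 := by
  induction l generalizing a with
  | nil => simp
  | cons i l ih =>
    obtain ⟨h1, h2, h3⟩ := h
    obtain ⟨h1', h2', h3'⟩ := h₀
    rw [List.map_cons, List.prod_cons, hx i (h1.trans h1'.symm) h2]
    by_cases e : (g i).2 = (g₀ i).2
    · rw [if_pos e, one_mul, ih h3 (e ▸ h3')]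
      have e' : g i = g₀ i := Prod.ext (h1.trans h1'.symm) e
      simp [e']
    · rw [if_neg e, zero_mul, if_neg]
      intro h
      exact e (by rw [h i List.mem_cons_self])

/-- Functionals separating the chains starting at `a`. -/
theorem exists_dual_gvec (hη : D.th 1 1 (2 * D.η) ≠ 0)
    (hlam : ∀ a : ℤ, D.th 1 1 (D.height a) ≠ 0) {z : Fin N → ℂ} (hz : z ∈ regular D N)
    {l : List (Fin N)} (hl : Full l) {g₀ : Fin N → ℤ × ℤ} {a b₀ : ℤ} (h₀ : Chain n g₀ l a b₀) :
    ∃ Ψ : StateSpace D n →ₗ[ℂ] ℂ, ∀ g b, Chain n g l a b →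
      Ψ (gvec D n z g) = if g = g₀ then 1 else 0 := by
  choose ψ hψ using fun i => exists_dual_intVec hη hlam (n i) (g₀ i).1 (g₀ i).2 (u := z i)
    fun k => (hz k).1 i
  refine ⟨PiTensorProduct.lift ((MultilinearMap.mkPiAlgebra ℂ (Fin N) ℂ).compLinearMap ψ),
    fun g b h => ?_⟩
  rw [gvec, PiTensorProduct.lift.tprod, MultilinearMap.compLinearMap_apply,
    MultilinearMap.mkPiAlgebra_apply]
  have hu : (Finset.univ : Finset (Fin N)) = l.toFinset := by
    ext i; simp [hl.2 i]
  rw [hu, List.prod_toFinset _ hl.1, prod_dual_chain (g := g) (g₀ := g₀) ?_ h h₀]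
  · congr 1
    rw [funext_iff]
    exact propext ⟨fun h i => h i (hl.2 i), fun h i _ => h i⟩
  · intro i hi hadm
    rw [hi] at hadm ⊢
    exact hψ i _ hadm

/-- Orthogonality of the characters of `ℤ/rℤ`. -/
theorem sum_phase (hr : 0 < D.r) (hcop : IsCoprime D.r' (D.r : ℤ)) [Fintype (ZMod D.r)] {a b : ℤ}
    (h : ¬(D.r : ℤ) ∣ a - b) : ∑ ν : ZMod D.r, phase D (-b) ν * phase D a ν = 0 := by
  have hr0 : (D.r : ℂ) ≠ 0 := by exact_mod_cast hr.ne'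
  have : NeZero D.r := ⟨hr.ne'⟩
  set x : ℂ := Complex.exp (2 * Real.pi * Complex.I * ((a - b : ℤ) : ℂ) * D.η) with hx
  have e : ∀ ν : ZMod D.r, phase D (-b) ν * phase D a ν = x ^ ν.val := by
    intro ν
    rw [phase, phase, ← Complex.exp_add, hx, ← Complex.exp_nat_mul]
    congr 1
    push_cast
    ring
  have hsum : ∑ ν : ZMod D.r, x ^ ν.val = ∑ k ∈ Finset.range D.r, x ^ k := by
    refine Finset.sum_bij (fun ν _ => ν.val) (fun ν _ => Finset.mem_range.2 ν.val_lt)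
      (fun ν _ ν' _ h => ZMod.val_injective _ h) (fun k hk => ⟨(k : ZMod D.r), Finset.mem_univ _, ?_⟩)
      (fun _ _ => rfl)
    exact ZMod.val_cast_of_lt (Finset.mem_range.1 hk)
  have hxr : x ^ D.r = 1 := by
    rw [hx, ← Complex.exp_nat_mul, Complex.exp_eq_one_iff]
    refine ⟨(a - b) * D.r', ?_⟩
    rw [Params.η]
    push_cast
    field_simp
  -- `x = exp(2πi (a-b) r'/r)` equals `1` only if `r` divides `(a-b) r'`, hence `a - b` by
  -- coprimality.
  have hx1 : x ≠ 1 := by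
    rw [hx, Ne, Complex.exp_eq_one_iff]
    rintro ⟨k, hk⟩
    refine h ?_
    have h2 : (2 * Real.pi * Complex.I : ℂ) ≠ 0 := Complex.two_pi_I_ne_zero
    have h3 : ((a - b : ℤ) : ℂ) * D.r' = k * D.r := by
      rw [Params.η] at hk
      field_simp at hk
      linear_combination hk
    have h4 : (a - b) * D.r' = k * D.r := by exact_mod_cast h3
    exact (hcop.symm.dvd_of_dvd_mul_right ⟨k, by rw [h4, mul_comm]⟩)
  simp only [e]
  rw [hsum]
  have := mul_geom_sum x D.r
  rw [hxr, sub_self] at this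
  exact (mul_eq_zero.1 this).resolve_left (sub_ne_zero.2 hx1)

theorem phase_neg_mul_phase (a : ℤ) (ν : ZMod D.r) : phase D (-a) ν * phase D a ν = 1 := by
  rw [phase, phase, ← Complex.exp_add, ← Complex.exp_zero]
  congr 1
  push_cast
  ring

/-- Functionals separating the closed chains. -/
theorem exists_dual_gfun (hr : 0 < D.r) (hcop : IsCoprime D.r' (D.r : ℤ))
    (hη : D.th 1 1 (2 * D.η) ≠ 0)
    (hlam : ∀ a : ℤ, D.th 1 1 (D.height a) ≠ 0) {z : Fin N → ℂ} (hz : z ∈ regular D N)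
    {l : List (Fin N)} (hl : Full l) {g₀ : Fin N → ℤ × ℤ} {a₀ : ℤ} (h₀ : Chain n g₀ l a₀ a₀)
    (ha₀ : 0 ≤ a₀) (ha₀' : a₀ < D.r) :
    ∃ Ψ : FunSpace D n →ₗ[ℂ] ℂ, ∀ g a, Chain n g l a a → 0 ≤ a → a < D.r →
      Ψ (gfun D n z a g) = if a = a₀ ∧ g = g₀ then 1 else 0 := by
  obtain ⟨Ψ, hΨ⟩ := exists_dual_gvec hη hlam hz hl h₀
  have : NeZero D.r := ⟨hr.ne'⟩
  have : Fintype (ZMod D.r) := ZMod.fintype _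
  have hr0 : (D.r : ℂ) ≠ 0 := by exact_mod_cast hr.ne'
  refine ⟨(D.r : ℂ)⁻¹ • ∑ ν : ZMod D.r, phase D (-a₀) ν • (Ψ ∘ₗ LinearMap.proj ν),
    fun g a hg ha ha' => ?_⟩
  have e : ((D.r : ℂ)⁻¹ • ∑ ν : ZMod D.r, phase D (-a₀) ν • (Ψ ∘ₗ LinearMap.proj ν))
      (gfun D n z a g) = (D.r : ℂ)⁻¹ * (∑ ν : ZMod D.r, phase D (-a₀) ν * phase D a ν) *
        Ψ (gvec D n z g) := by
    simp only [LinearMap.smul_apply, LinearMap.sum_apply, LinearMap.comp_apply,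
      LinearMap.proj_apply, gfun, embed_apply, map_smul, smul_eq_mul, Finset.mul_sum,
      Finset.sum_mul]
    exact Finset.sum_congr rfl fun ν _ => by ring
  rw [e]
  by_cases h : a = a₀
  · subst h
    simp only [phase_neg_mul_phase, Finset.sum_const, Finset.card_univ, ZMod.card, nsmul_eq_mul,
      mul_one, inv_mul_cancel₀ hr0, one_mul, hΨ g a hg, true_and]
  · rw [sum_phase hr hcop, mul_zero, zero_mul, if_neg fun h' => h h'.1]
    intro hd
    have := Int.eq_zero_of_abs_lt_dvd hd (by rw [abs_lt]; constructor <;> omega)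
    omega

/-- Closed chains in the fundamental range of heights. -/
def ClosedChain (D : Params) (n : Fin N → ℕ) (l : List (Fin N)) : Type :=
  {p : ℤ × (Fin N → ℤ × ℤ) // Chain n p.2 l p.1 p.1 ∧ 0 ≤ p.1 ∧ p.1 < D.r}

theorem linearIndependent_of_dual {ι V : Type*} [DecidableEq ι] [AddCommMonoid V] [Module ℂ V]
    {v : ι → V} (h : ∀ i, ∃ Ψ : V →ₗ[ℂ] ℂ, ∀ j, Ψ (v j) = if j = i then 1 else 0) :
    LinearIndependent ℂ v := by
  choose Ψ hΨ using h
  intro x y hxy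
  ext i
  have := congrArg (Ψ i) hxy
  have e : ∀ t : ℂ, (if t = 0 then 0 else t) = t := fun t => by split <;> simp_all
  simpa [Finsupp.linearCombination_apply, Finsupp.sum, map_sum, hΨ, e] using this

theorem linearIndependent_gfun (hr : 0 < D.r) (hcop : IsCoprime D.r' (D.r : ℤ))
    (hη : D.th 1 1 (2 * D.η) ≠ 0)
    (hlam : ∀ a : ℤ, D.th 1 1 (D.height a) ≠ 0) {z : Fin N → ℂ} (hz : z ∈ regular D N)
    {l : List (Fin N)} (hl : Full l) :
    LinearIndependent ℂ fun p : ClosedChain D n l => gfun D n z p.1.1 p.1.2 := by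
  classical
  refine linearIndependent_of_dual fun p => ?_
  obtain ⟨Ψ, hΨ⟩ := exists_dual_gfun hr hcop hη hlam hz hl p.2.1 p.2.2.1 p.2.2.2
  refine ⟨Ψ, fun q => (hΨ _ _ q.2.1 q.2.2.1 q.2.2.2).trans ?_⟩
  congr 1
  rw [← Prod.ext_iff]
  exact propext Subtype.ext_iff.symm

/-- Linear maps with prescribed values on the functions attached to closed chains. -/
theorem exists_linearMap_gfun (hr : 0 < D.r) (hcop : IsCoprime D.r' (D.r : ℤ))
    (hη : D.th 1 1 (2 * D.η) ≠ 0)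
    (hlam : ∀ a : ℤ, D.th 1 1 (D.height a) ≠ 0) {z : Fin N → ℂ} (hz : z ∈ regular D N)
    {l : List (Fin N)} (hl : Full l) (t : ℤ → (Fin N → ℤ × ℤ) → FunSpace D n)
    (ht : ∀ a g (k : ℤ), t (a + k * D.r) (raise (k * D.r) g) = t a g) :
    ∃ T : Module.End ℂ (FunSpace D n), ∀ a g, Chain n g l a a → T (gfun D n z a g) = t a g := by
  let _ : AddCommGroup (FunSpace D n) := Module.addCommMonoidToAddCommGroup ℂ
  obtain ⟨T, hT⟩ := exists_linearMap_of_linearIndependent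
    (linearIndependent_gfun (n := n) hr hcop hη hlam hz hl) fun p => t p.1.1 p.1.2
  refine ⟨T, fun a g hg => ?_⟩
  obtain ⟨k, hk, hk'⟩ := exists_raise hr a
  rw [← gfun_raise hr z a k g, ← ht a g k]
  exact hT ⟨(_, _), hg.raise _, hk, hk'⟩

end Chains

/-! ### Spaces spanned by closed chains -/

section ChainSpaces

variable {N : ℕ} {n : Fin N → ℕ} {D : Params} {S : Type*}

/-- The families in the span of the functions attached to the closed chains along `l`, with
coefficients in `𝓜`. -/
def chainSpan (D : Params) (n : Fin N → ℕ) (𝓜 : Subalgebra ℂ (S → ℂ)) (w : S → Fin N → ℂ)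
    (l : List (Fin N)) : Submodule ℂ (S → FunSpace D n) :=
  Submodule.span ℂ {X | ∃ p ∈ 𝓜, ∃ a g, Chain n g l a a ∧ X = fun σ => p σ • gfun D n (w σ) a g}

/-- The span of the functions attached to the closed chains along `l`. -/
def chainSpace (D : Params) (n : Fin N → ℕ) (l : List (Fin N)) (z : Fin N → ℂ) :
    Submodule ℂ (FunSpace D n) :=
  Submodule.span ℂ {f | ∃ a g, Chain n g l a a ∧ f = gfun D n z a g}

theorem const_mem_chainSpan {l : List (Fin N)} {z : Fin N → ℂ} {f : FunSpace D n}
    (hf : f ∈ chainSpace D n l z) :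
    (fun _ : Unit => f) ∈ chainSpan D n ⊤ (fun _ : Unit => z) l := by
  refine famMap_mem (S := Unit) (T := fun _ => LinearMap.id)
    (s := {X | ∃ a g, Chain n g l a a ∧ X = fun _ => gfun D n z a g}) ?_
    (X := fun _ => f) ?_
  · rintro _ ⟨a, g, h, rfl⟩
    exact Submodule.subset_span ⟨1, Subalgebra.one_mem _, a, g, h, by simp⟩
  · have : chainSpace D n l z ≤ (Submodule.span ℂ
        {X : Unit → FunSpace D n | ∃ a g, Chain n g l a a ∧ X = fun _ => gfun D n z a g}).comap
        (LinearMap.pi fun _ => LinearMap.id) := by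
      refine Submodule.span_le.2 ?_
      rintro _ ⟨a, g, h, rfl⟩
      exact Submodule.subset_span ⟨a, g, h, rfl⟩
    exact this hf

theorem span_apply_mem {V : Type*} [AddCommMonoid V] [Module ℂ V] {s : Set (S → V)}
    {p : Submodule ℂ V} {σ : S} (h : ∀ X ∈ s, X σ ∈ p) {X : S → V} (hX : X ∈ Submodule.span ℂ s) :
    X σ ∈ p := by
  have : Submodule.span ℂ s ≤ p.comap (LinearMap.proj (R := ℂ) (φ := fun _ : S => V) σ) :=
    Submodule.span_le.2 h
  exact this hX

theorem apply_mem_chainSpace {𝓜 : Subalgebra ℂ (S → ℂ)} {w : S → Fin N → ℂ} {l : List (Fin N)}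
    {X : S → FunSpace D n} (hX : X ∈ chainSpan D n 𝓜 w l) (σ : S) :
    X σ ∈ chainSpace D n l (w σ) := by
  refine span_apply_mem ?_ hX
  rintro _ ⟨p, -, a, g, h, rfl⟩
  exact Submodule.smul_mem _ _ (Submodule.subset_span ⟨a, g, h, rfl⟩)

/-- The fused `R` matrix at the difference of two spectral parameters. -/
def funRz (D : Params) (n : Fin N → ℕ) (z : Fin N → ℂ) (j k : Fin N) :
    Module.End ℂ (FunSpace D n) := funR D n j k (z j - z k)

theorem funR_embed (j k : Fin N) (u : ℂ) (a : ℤ) (v : StateSpace D n) :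
    funR D n j k u (embed D n a v) = embed D n a (fusedR D n j k u v) := by
  funext ν
  rw [funR, LinearMap.compLeft_apply, Function.comp, embed_apply, map_smul, embed_apply]

theorem Chain.exchange {g : Fin N → ℤ × ℤ} {l₁ l₂ : List (Fin N)} {j k : Fin N}
    (hl : (l₁ ++ j :: k :: l₂).Nodup) {a b μ : ℤ}
    (h : Chain n g (l₁ ++ j :: k :: l₂) a b) (h₁ : Adm (n k) (g j).1 μ) (h₂ : Adm (n j) μ (g k).2) :
    Chain n (Function.update (Function.update g j (μ, (g k).2)) k ((g j).1, μ))
      (l₁ ++ k :: j :: l₂) a b := by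
  obtain ⟨c, hc, h1, -, h2, -, h3⟩ := chain_append.1 h
  have hnd := List.nodup_append.1 hl
  have hnd₂ := hnd.2.1
  simp only [List.nodup_cons, List.mem_cons, not_or] at hnd₂
  have hg : ∀ i, i ≠ j → i ≠ k →
      Function.update (Function.update g j (μ, (g k).2)) k ((g j).1, μ) i = g i := fun i hi hi' => by
    rw [Function.update_of_ne hi', Function.update_of_ne hi]
  have hjk : j ≠ k := hnd₂.1.1
  refine chain_append.2 ⟨c, hc.congr fun i hi => hg i ?_ ?_, ?_, ?_, ?_, ?_, ?_⟩
  · exact hnd.2.2 i hi j (by simp)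
  · exact hnd.2.2 i hi k (by simp)
  · simpa using h1
  · simpa using h₁
  · simp [Function.update_of_ne hjk]
  · simpa [Function.update_of_ne hjk] using h₂
  · rw [Function.update_of_ne hjk, Function.update_self]
    refine h3.congr fun i hi => hg i ?_ ?_
    · rintro rfl; exact hnd₂.1.2 hi
    · rintro rfl; exact hnd₂.2.1 hi

theorem Chain.eq_of_adjacent {g : Fin N → ℤ × ℤ} {l₁ l₂ : List (Fin N)} {j k : Fin N} {a b : ℤ}
    (h : Chain n g (l₁ ++ j :: k :: l₂) a b) : (g j).2 = (g k).1 := by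
  obtain ⟨c, hc, h1, -, h2, -, h3⟩ := chain_append.1 h
  exact h2.symm

theorem Full.ne_of_adjacent {l₁ l₂ : List (Fin N)} {j k : Fin N}
    (hl : Full (l₁ ++ j :: k :: l₂)) : j ≠ k := by
  have := (List.nodup_append.1 hl.1).2.1
  simp only [List.nodup_cons, List.mem_cons, not_or] at this
  exact this.1.1

/-- Only the middle height between `j` and `k` changes, so the base height, and with it the
character of `ℤ/rℤ`, is untouched. -/
theorem funRz_chainSpan (hη : D.th 1 1 (2 * D.η) ≠ 0) (hlam : ∀ a : ℤ, D.th 1 1 (D.height a) ≠ 0)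
    {𝓜 : Subalgebra ℂ (S → ℂ)} {w : S → Fin N → ℂ} {l₁ l₂ : List (Fin N)} {j k : Fin N}
    (hM : IsCoeffAlg D w 𝓜 j k) (hl : Full (l₁ ++ j :: k :: l₂)) {X : S → FunSpace D n}
    (hX : X ∈ chainSpan D n 𝓜 w (l₁ ++ j :: k :: l₂)) :
    (fun σ => funRz D n (w σ) j k (X σ)) ∈ chainSpan D n 𝓜 w (l₁ ++ k :: j :: l₂) := by
  refine famMap_mem ?_ hX
  rintro _ ⟨p, hp, a, g, hg, rfl⟩
  have h := fusedR_gvec hη hlam (fun i => hg.adm i (hl.2 i)) hM hl.ne_of_adjacent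
    hg.eq_of_adjacent
  simp only [funRz, map_smul, gfun, funR_embed]
  refine famMap_mem (T := fun σ => p σ • embed D n a) ?_ h
  rintro _ ⟨q, hq, μ, h₁, h₂, rfl⟩
  refine Submodule.subset_span ⟨p * q, 𝓜.mul_mem hp hq, a, _, hg.exchange hl.1 h₁ h₂, ?_⟩
  funext σ
  rw [LinearMap.smul_apply, map_smul, smul_smul]
  rfl

theorem perm_adjacent (l₁ l₂ : List (Fin N)) (j k : Fin N) :
    (l₁ ++ j :: k :: l₂).Perm (l₁ ++ k :: j :: l₂) := (List.Perm.swap k j l₂).append_left l₁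

theorem gridRow_chainSpan (hη : D.th 1 1 (2 * D.η) ≠ 0)
    (hlam : ∀ a : ℤ, D.th 1 1 (D.height a) ≠ 0)
    {𝓜 : Subalgebra ℂ (S → ℂ)} {w : S → Fin N → ℂ} {l₁ C l₂ : List (Fin N)} {j : Fin N}
    (hM : ∀ k ∈ C, IsCoeffAlg D w 𝓜 j k) (hl : Full (l₁ ++ j :: (C ++ l₂))) {X : S → FunSpace D n}
    (hX : X ∈ chainSpan D n 𝓜 w (l₁ ++ j :: (C ++ l₂))) :
    (fun σ => gridRow (funRz D n (w σ)) j C (X σ)) ∈ chainSpan D n 𝓜 w (l₁ ++ (C ++ j :: l₂)) := by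
  induction C generalizing l₁ X with
  | nil => simpa [gridRow] using hX
  | cons k C ih =>
    simp only [gridRow_cons, Module.End.mul_apply]
    have h := funRz_chainSpan hη hlam (hM k List.mem_cons_self) hl hX
    have hl' := hl.perm (perm_adjacent _ _ _ _)
    have e : l₁ ++ k :: j :: (C ++ l₂) = (l₁ ++ [k]) ++ j :: (C ++ l₂) := by simp
    rw [List.append_eq, e] at h hl'
    have := ih (fun k' hk' => hM k' (List.mem_cons_of_mem _ hk')) hl' h
    simpa using this

theorem gridCol_chainSpan (hη : D.th 1 1 (2 * D.η) ≠ 0)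
    (hlam : ∀ a : ℤ, D.th 1 1 (D.height a) ≠ 0)
    {𝓜 : Subalgebra ℂ (S → ℂ)} {w : S → Fin N → ℂ} {l₁ C l₂ : List (Fin N)} {j : Fin N}
    (hM : ∀ k ∈ C, IsCoeffAlg D w 𝓜 k j) (hl : Full (l₁ ++ (C ++ j :: l₂))) {X : S → FunSpace D n}
    (hX : X ∈ chainSpan D n 𝓜 w (l₁ ++ (C ++ j :: l₂))) :
    (fun σ => gridCol (funRz D n (w σ)) C j (X σ)) ∈ chainSpan D n 𝓜 w (l₁ ++ j :: (C ++ l₂)) := by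
  induction C generalizing l₁ with
  | nil => simpa [gridCol] using hX
  | cons k C ih =>
    simp only [gridCol_cons, Module.End.mul_apply]
    have e : l₁ ++ (k :: C ++ j :: l₂) = (l₁ ++ [k]) ++ (C ++ j :: l₂) := by simp
    rw [e] at hX hl
    have h := ih (fun k' hk' => hM k' (List.mem_cons_of_mem _ hk')) hl hX
    have e' : (l₁ ++ [k]) ++ j :: (C ++ l₂) = l₁ ++ k :: j :: (C ++ l₂) := by simp
    rw [e'] at h
    refine funRz_chainSpan hη hlam (hM k List.mem_cons_self) ?_ h
    refine hl.perm ?_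
    simpa using (List.perm_middle.cons k).append_left l₁

theorem isCoeffAlg_top (w : S → Fin N → ℂ) (j k : Fin N) : IsCoeffAlg D w ⊤ j k :=
  ⟨fun _ _ => Algebra.mem_top, fun _ => Algebra.mem_top⟩

theorem gridRow_chainSpace (hη : D.th 1 1 (2 * D.η) ≠ 0)
    (hlam : ∀ a : ℤ, D.th 1 1 (D.height a) ≠ 0) (z : Fin N → ℂ) {l₁ C l₂ : List (Fin N)}
    {j : Fin N} (hl : Full (l₁ ++ j :: (C ++ l₂))) {f : FunSpace D n}
    (hf : f ∈ chainSpace D n (l₁ ++ j :: (C ++ l₂)) z) :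
    gridRow (funRz D n z) j C f ∈ chainSpace D n (l₁ ++ (C ++ j :: l₂)) z :=
  apply_mem_chainSpace (gridRow_chainSpan hη hlam (fun _ _ => isCoeffAlg_top _ _ _) hl
    (const_mem_chainSpan hf)) ()

theorem gridCol_chainSpace (hη : D.th 1 1 (2 * D.η) ≠ 0)
    (hlam : ∀ a : ℤ, D.th 1 1 (D.height a) ≠ 0) (z : Fin N → ℂ) {l₁ C l₂ : List (Fin N)}
    {j : Fin N} (hl : Full (l₁ ++ (C ++ j :: l₂))) {f : FunSpace D n}
    (hf : f ∈ chainSpace D n (l₁ ++ (C ++ j :: l₂)) z) :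
    gridCol (funRz D n z) C j f ∈ chainSpace D n (l₁ ++ j :: (C ++ l₂)) z :=
  apply_mem_chainSpace (gridCol_chainSpan hη hlam (fun _ _ => isCoeffAlg_top _ _ _) hl
    (const_mem_chainSpan hf)) ()

/-! ### Lifting to the tensor product of all copies of `ℂ²` -/

/-- The operator `B` induces `T`. -/
def Induces (D : Params) (n : Fin N → ℕ) (B : Module.End ℂ (BigSpace n))
    (T : Module.End ℂ (FunSpace D n)) : Prop :=
  ∀ F : ZMod D.r → BigSpace n, T (fun ν => mulAll D n (F ν)) = fun ν => mulAll D n (B (F ν))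

theorem induces_one : Induces D n 1 1 := fun _ => rfl

theorem Induces.mul {B B' : Module.End ℂ (BigSpace n)} {T T' : Module.End ℂ (FunSpace D n)}
    (h : Induces D n B T) (h' : Induces D n B' T') : Induces D n (B * B') (T * T') := fun F => by
  rw [Module.End.mul_apply, h', h]
  rfl

theorem induces_funRz (hη : D.th 1 1 (2 * D.η) ≠ 0) (z : Fin N → ℂ) {j k : Fin N} (h : j ≠ k) :
    Induces D n (blockR D n z j k) (funRz D n z j k) := fun F => by
  funext ν
  rw [funRz, funR, LinearMap.compLeft_apply]
  exact fusedR_mulAll hη z h (F ν)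

theorem induces_gridRow (hη : D.th 1 1 (2 * D.η) ≠ 0) (z : Fin N → ℂ) {j : Fin N}
    {C : List (Fin N)} (h : j ∉ C) :
    Induces D n (gridRow (blockR D n z) j C) (gridRow (funRz D n z) j C) := by
  induction C with
  | nil => exact induces_one
  | cons k C ih =>
    rw [not_mem_cons_iff] at h
    rw [gridRow_cons, gridRow_cons]
    exact (ih h.2).mul (induces_funRz hη z h.1)

theorem induces_gridCol (hη : D.th 1 1 (2 * D.η) ≠ 0) (z : Fin N → ℂ) {j : Fin N}
    {C : List (Fin N)} (h : j ∉ C) :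
    Induces D n (gridCol (blockR D n z) C j) (gridCol (funRz D n z) C j) := by
  induction C with
  | nil => exact induces_one
  | cons k C ih =>
    rw [not_mem_cons_iff] at h
    rw [gridCol_cons, gridCol_cons]
    exact (induces_funRz hη z h.1.symm).mul (ih h.2)

/-- Operators are compared only on vectors lifting to the copies of `ℂ²`; the spans of closed chains
consist of such vectors, so surjectivity of the multiplication map is not needed. -/
theorem exists_lift_of_mem {l : List (Fin N)} (hl : Full l) {z : Fin N → ℂ} {f : FunSpace D n}
    (hf : f ∈ chainSpace D n l z) :
    ∃ F : ZMod D.r → BigSpace n, f = fun ν => mulAll D n (F ν) := by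
  have : chainSpace D n l z ≤ LinearMap.range ((mulAll D n).compLeft (ZMod D.r)) := by
    refine Submodule.span_le.2 ?_
    rintro _ ⟨a, g, hg, rfl⟩
    obtain ⟨v, hv⟩ := gvec_mem_range (D := D) (fun i => hg.adm i (hl.2 i)) z
    refine ⟨fun ν => phase D a ν • v, ?_⟩
    funext ν
    rw [LinearMap.compLeft_apply, Function.comp, map_smul, hv]
    rfl
  obtain ⟨F, hF⟩ := this hf
  exact ⟨F, hF.symm⟩

/-- The transfer principle: an operator identity on `BigSpace` yields the corresponding identity of
fused operators on closed chains. -/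
theorem Induces.eq_of_mem {B : Module.End ℂ (BigSpace n)} {T T' : Module.End ℂ (FunSpace D n)}
    (h : Induces D n B T) (h' : Induces D n B T') {l : List (Fin N)} (hl : Full l)
    {z : Fin N → ℂ} {f : FunSpace D n} (hf : f ∈ chainSpace D n l z) : T f = T' f := by
  obtain ⟨F, rfl⟩ := exists_lift_of_mem hl hf
  rw [h, h']

theorem gridCol_gridRow_apply (hη : D.th 1 1 (2 * D.η) ≠ 0) {z : Fin N → ℂ}
    (hz : z ∈ regular D N) {j : Fin N} {C : List (Fin N)} (hj : j ∉ C) (hC : C.Nodup)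
    {l : List (Fin N)} (hl : Full l) {f : FunSpace D n} (hf : f ∈ chainSpace D n l z) :
    gridCol (funRz D n z) C j (gridRow (funRz D n z) j C f) = f := by
  have h := (induces_gridCol (D := D) (n := n) hη z hj).mul (induces_gridRow hη z hj)
  have e := grid_mul_grid (disjointCommute_blockR (n := n) hη z) (A := [j]) (B := C) (by simp) hC
    (by simpa using hj) fun x hx y hy => blockR_mul_blockR hη hz ?_
  · rw [grid_singleton] at e
    have e' : grid (blockR D n z) C [j] = gridCol (blockR D n z) C j := by simp [grid]
    rw [e'] at e
    rw [e] at h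
    exact h.eq_of_mem induces_one hl hf
  · rintro rfl
    rw [List.mem_singleton.1 hx] at hy
    exact hj hy

theorem gridRow_gridCol_apply (hη : D.th 1 1 (2 * D.η) ≠ 0) {z : Fin N → ℂ}
    (hz : z ∈ regular D N) {j : Fin N} {C : List (Fin N)} (hj : j ∉ C)
    {l : List (Fin N)} (hl : Full l) {f : FunSpace D n} (hf : f ∈ chainSpace D n l z) :
    gridRow (funRz D n z) j C (gridCol (funRz D n z) C j f) = f := by
  have h := (induces_gridRow (D := D) (n := n) hη z hj).mul (induces_gridCol hη z hj)
  have e : gridRow (blockR D n z) j C * gridCol (blockR D n z) C j = 1 :=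
    gridRow_mul_gridCol fun x hx => blockR_mul_blockR hη hz fun e => hj (e ▸ hx)
  rw [e] at h
  exact h.eq_of_mem induces_one hl hf

end ChainSpaces

/-! ### Boundary operators for arbitrary arrangements -/

section BoundaryOps

variable {N : ℕ} {n : Fin N → ℕ} {D : Params} {S : Type*}

/-- The factor `e^{c(a_N - a_{N-1} - 2l)}`. -/
def zfac (D : Params) (n : Fin N → ℕ) (k : Fin N) (g : Fin N → ℤ × ℤ) : ℂ :=
  Complex.exp (D.c * (((g k).2 - (g k).1 - (n k : ℤ) : ℤ) : ℂ))

theorem zfac_ne_zero (k : Fin N) (g : Fin N → ℤ × ℤ) : zfac D n k g ≠ 0 := Complex.exp_ne_zero _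

theorem zfac_raise (k : Fin N) (m : ℤ) (g : Fin N → ℤ × ℤ) :
    zfac D n k (raise m g) = zfac D n k g := by
  simp only [zfac, raise, add_sub_add_right_eq_sub]

/-- `T` is the boundary operator for the arrangement `(l, k)`. -/
def IsB (D : Params) (n : Fin N → ℕ) (l : List (Fin N)) (k : Fin N) (z : Fin N → ℂ)
    (T : Module.End ℂ (FunSpace D n)) : Prop :=
  ∀ a g, Chain n g (l ++ [k]) a a →
    T (gfun D n z a g) = zfac D n k g • gfun D n (shift D k z) (g k).1 g

theorem chain_snoc {g : Fin N → ℤ × ℤ} {l : List (Fin N)} {k : Fin N} {a b : ℤ} :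
    Chain n g (l ++ [k]) a b ↔
      Chain n g l a (g k).1 ∧ Adm (n k) (g k).1 (g k).2 ∧ (g k).2 = b := by
  rw [chain_append]
  constructor
  · rintro ⟨c, h, rfl, h2, h3⟩; exact ⟨h, h2, h3⟩
  · rintro ⟨h, h2, h3⟩; exact ⟨_, h, rfl, h2, h3⟩

/-- Heights are stored as pairs at the labels, so a cyclic rotation leaves `g` unchanged and only
replaces the base height. -/
theorem chain_rotate {g : Fin N → ℤ × ℤ} {l : List (Fin N)} {k : Fin N} {a : ℤ}
    (h : Chain n g (l ++ [k]) a a) : Chain n g (k :: l) (g k).1 (g k).1 := by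
  obtain ⟨h1, h2, rfl⟩ := chain_snoc.1 h
  exact ⟨rfl, h2, h1⟩

theorem chain_rotate' {g : Fin N → ℤ × ℤ} {l : List (Fin N)} {k : Fin N} {a : ℤ}
    (h : Chain n g (k :: l) a a) : Chain n g (l ++ [k]) (g k).2 (g k).2 := by
  obtain ⟨rfl, h2, h1⟩ := h
  exact chain_snoc.2 ⟨h1, h2, rfl⟩

theorem exists_isB (hr : 0 < D.r) (hcop : IsCoprime D.r' (D.r : ℤ))
    (hη : D.th 1 1 (2 * D.η) ≠ 0)
    (hlam : ∀ a : ℤ, D.th 1 1 (D.height a) ≠ 0) {z : Fin N → ℂ} (hz : z ∈ regular D N)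
    {l : List (Fin N)} {k : Fin N} (hl : Full (l ++ [k])) : ∃ T, IsB D n l k z T :=
  exists_linearMap_gfun hr hcop hη hlam hz hl
    (fun _ g => zfac D n k g • gfun D n (shift D k z) (g k).1 g) fun a g m => by
      rw [zfac_raise]
      exact congrArg _ (gfun_raise hr _ _ _ _)

/-- The inverse rotation is well defined because the functions at the shifted point are independent,
which is where its regularity enters. -/
theorem exists_isB_inverse (hr : 0 < D.r) (hcop : IsCoprime D.r' (D.r : ℤ))
    (hη : D.th 1 1 (2 * D.η) ≠ 0)
    (hlam : ∀ a : ℤ, D.th 1 1 (D.height a) ≠ 0) {z : Fin N → ℂ} {l : List (Fin N)} {k : Fin N}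
    (hz : shift D k z ∈ regular D N) (hl : Full (k :: l)) :
    ∃ T : Module.End ℂ (FunSpace D n), ∀ a g, Chain n g (k :: l) a a →
      T (gfun D n (shift D k z) a g) = (zfac D n k g)⁻¹ • gfun D n z (g k).2 g :=
  exists_linearMap_gfun hr hcop hη hlam hz hl
    (fun _ g => (zfac D n k g)⁻¹ • gfun D n z (g k).2 g) fun a g m => by
      rw [zfac_raise]
      exact congrArg _ (gfun_raise hr _ _ _ _)

theorem IsB.mem_chainSpan {𝓜 : Subalgebra ℂ (S → ℂ)} {w : S → Fin N → ℂ} {l : List (Fin N)}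
    {k : Fin N} {T : S → Module.End ℂ (FunSpace D n)} (hT : ∀ σ, IsB D n l k (w σ) (T σ))
    {X : S → FunSpace D n} (hX : X ∈ chainSpan D n 𝓜 w (l ++ [k])) :
    (fun σ => T σ (X σ)) ∈ chainSpan D n 𝓜 (fun σ => shift D k (w σ)) (k :: l) := by
  refine famMap_mem ?_ hX
  rintro _ ⟨p, hp, a, g, hg, rfl⟩
  refine Submodule.subset_span ⟨zfac D n k g • p, 𝓜.smul_mem hp _, (g k).1, g, chain_rotate hg, ?_⟩
  funext σ
  rw [map_smul, hT σ a g hg, smul_smul, mul_comm]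
  rfl

theorem IsB.mem_chainSpace {z : Fin N → ℂ} {l : List (Fin N)}
    {k : Fin N} {T : Module.End ℂ (FunSpace D n)} (hT : IsB D n l k z T)
    {f : FunSpace D n} (hf : f ∈ chainSpace D n (l ++ [k]) z) :
    T f ∈ chainSpace D n (k :: l) (shift D k z) :=
  apply_mem_chainSpace (IsB.mem_chainSpan (T := fun _ => T) (fun _ => hT) (const_mem_chainSpan hf)) ()

theorem IsB.bijOn (hr : 0 < D.r) (hcop : IsCoprime D.r' (D.r : ℤ))
    (hη : D.th 1 1 (2 * D.η) ≠ 0)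
    (hlam : ∀ a : ℤ, D.th 1 1 (D.height a) ≠ 0) {z : Fin N → ℂ}
    {l : List (Fin N)} {k : Fin N} (hz : shift D k z ∈ regular D N) (hl : Full (l ++ [k]))
    {T : Module.End ℂ (FunSpace D n)}
    (hT : IsB D n l k z T) :
    Set.BijOn T (chainSpace D n (l ++ [k]) z) (chainSpace D n (k :: l) (shift D k z)) := by
  have hl' : Full (k :: l) := hl.perm (by simp)
  obtain ⟨T', hT'⟩ := exists_isB_inverse (n := n) hr hcop hη hlam hz hl'
  have hmaps : Set.MapsTo T' (chainSpace D n (k :: l) (shift D k z))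
      (chainSpace D n (l ++ [k]) z) := by
    have : chainSpace D n (k :: l) (shift D k z) ≤
        (chainSpace D n (l ++ [k]) z).comap T' := by
      refine Submodule.span_le.2 ?_
      rintro _ ⟨a, g, hg, rfl⟩
      rw [SetLike.mem_coe, Submodule.mem_comap, hT' a g hg]
      exact Submodule.smul_mem _ _ (Submodule.subset_span ⟨_, g, chain_rotate' hg, rfl⟩)
    exact this
  refine Set.InvOn.bijOn (f' := T') ⟨fun f hf => ?_, fun f hf => ?_⟩ (fun f hf => hT.mem_chainSpace hf)
    hmaps
  · have : Set.EqOn (T' * T) (1 : Module.End ℂ (FunSpace D n))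
        (chainSpace D n (l ++ [k]) z) := by
      refine LinearMap.eqOn_span' ?_
      rintro _ ⟨a, g, hg, rfl⟩
      rw [Module.End.mul_apply, hT a g hg, map_smul, hT' _ g (chain_rotate hg), smul_smul,
        mul_inv_cancel₀ (zfac_ne_zero k g), one_smul, (chain_snoc.1 hg).2.2]
      rfl
    exact this hf
  · have : Set.EqOn (T * T') (1 : Module.End ℂ (FunSpace D n))
        (chainSpace D n (k :: l) (shift D k z)) := by
      refine LinearMap.eqOn_span' ?_
      rintro _ ⟨a, g, hg, rfl⟩
      rw [Module.End.mul_apply, hT' a g hg, map_smul, hT _ g (chain_rotate' hg), smul_smul,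
        inv_mul_cancel₀ (zfac_ne_zero k g), one_smul, hg.1]
      rfl
    exact this hf

theorem IsB.eq_of_mem {z : Fin N → ℂ} {l : List (Fin N)} {k : Fin N}
    {T T' : Module.End ℂ (FunSpace D n)} (hT : IsB D n l k z T) (hT' : IsB D n l k z T')
    {f : FunSpace D n} (hf : f ∈ chainSpace D n (l ++ [k]) z) : T f = T' f := by
  have : Set.EqOn T T' (chainSpace D n (l ++ [k]) z) := by
    refine LinearMap.eqOn_span' ?_
    rintro _ ⟨a, g, hg, rfl⟩
    rw [hT a g hg, hT' a g hg]
  exact this hf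

/-- The functions on two points with equal values. -/
def diagAlg : Subalgebra ℂ (Bool → ℂ) :=
  AlgHom.equalizer (Pi.evalAlgHom ℂ (fun _ : Bool => ℂ) true) (Pi.evalAlgHom ℂ (fun _ => ℂ) false)

theorem mem_diagAlg {p : Bool → ℂ} : p ∈ diagAlg ↔ p true = p false := Iff.rfl

theorem isCoeffAlg_diagAlg {z z' : Fin N → ℂ} {i j : Fin N} (h : z i - z j = z' i - z' j) :
    IsCoeffAlg D (fun b : Bool => if b then z else z') diagAlg i j :=
  ⟨fun P _ => by simp [mem_diagAlg, h], fun m => by simp [mem_diagAlg, h]⟩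

/-- Linear identities between the actions of an `R` matrix at two values of the spectral parameters
with the same difference. -/
theorem fusedR_gvec_induction (hη : D.th 1 1 (2 * D.η) ≠ 0)
    (hlam : ∀ a : ℤ, D.th 1 1 (D.height a) ≠ 0) {g : Fin N → ℤ × ℤ}
    (hg : ∀ i, Adm (n i) (g i).1 (g i).2) {i j : Fin N} (hij : i ≠ j) (h : (g i).2 = (g j).1)
    {z z' : Fin N → ℂ} (hz : z i - z j = z' i - z' j) {V : Type*} [AddCommMonoid V] [Module ℂ V]
    (φ ψ : StateSpace D n →ₗ[ℂ] V)
    (hφ : ∀ μ, Adm (n j) (g i).1 μ → Adm (n i) μ (g j).2 →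
      φ (gvec D n z (Function.update (Function.update g i (μ, (g j).2)) j ((g i).1, μ))) =
      ψ (gvec D n z' (Function.update (Function.update g i (μ, (g j).2)) j ((g i).1, μ)))) :
    φ (fusedR D n i j (z i - z j) (gvec D n z g)) =
      ψ (fusedR D n i j (z' i - z' j) (gvec D n z' g)) := by
  have h1 := fusedR_gvec hη hlam hg (isCoeffAlg_diagAlg (D := D) hz) hij h
  have h2 := LinearMap.eqOn_span (f := φ ∘ₗ LinearMap.proj true) (g := ψ ∘ₗ LinearMap.proj false)
    ?_ h1
  · exact h2
  · rintro _ ⟨p, hp, μ, h₁, h₂, rfl⟩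
    rw [mem_diagAlg] at hp
    simp only [LinearMap.comp_apply, LinearMap.proj_apply, map_smul, hp]
    congr 1
    exact hφ μ h₁ h₂

theorem shift_of_ne {k i : Fin N} (h : i ≠ k) (z : Fin N → ℂ) : shift D k z i = z i :=
  Function.update_of_ne h _ _

theorem shift_self (k : Fin N) (z : Fin N → ℂ) : shift D k z k = z k + D.κ :=
  Function.update_self _ _ _

theorem shift_comm (j k : Fin N) (z : Fin N → ℂ) :
    shift D j (shift D k z) = shift D k (shift D j z) := by
  by_cases h : j = k
  · rw [h]
  · funext i
    by_cases hj : i = j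
    · subst hj
      rw [shift_self, shift_of_ne h, shift_of_ne h, shift_self]
    · by_cases hk : i = k
      · subst hk
        rw [shift_of_ne hj, shift_self, shift_self, shift_of_ne hj]
      · rw [shift_of_ne hj, shift_of_ne hk, shift_of_ne hk, shift_of_ne hj]

/-- Shifting `z_k` does not affect `z_i - z_j`, and the boundary factor involves only the heights
next to `k`, which the exchange of `i` and `j` leaves alone. -/
theorem IsB.comm_funRz (hη : D.th 1 1 (2 * D.η) ≠ 0)
    (hlam : ∀ a : ℤ, D.th 1 1 (D.height a) ≠ 0) {z : Fin N → ℂ} {l₁ l₂ : List (Fin N)}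
    {i j k : Fin N} (hl : Full (l₁ ++ i :: j :: l₂ ++ [k])) {T T' : Module.End ℂ (FunSpace D n)}
    (hT : IsB D n (l₁ ++ i :: j :: l₂) k z T) (hT' : IsB D n (l₁ ++ j :: i :: l₂) k z T')
    {f : FunSpace D n} (hf : f ∈ chainSpace D n (l₁ ++ i :: j :: l₂ ++ [k]) z) :
    T' (funRz D n z i j f) = funRz D n (shift D k z) i j (T f) := by
  have hnd := List.nodup_append.1 hl.1
  have hik : i ≠ k := hnd.2.2 i (by simp) k (by simp)
  have hjk : j ≠ k := hnd.2.2 j (by simp) k (by simp)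
  have e₁ : l₁ ++ i :: j :: l₂ ++ [k] = l₁ ++ i :: j :: (l₂ ++ [k]) := by simp
  have hl' := hl
  rw [e₁] at hl'
  have hij := hl'.ne_of_adjacent
  have : Set.EqOn (T' * funRz D n z i j) (funRz D n (shift D k z) i j * T)
      (chainSpace D n (l₁ ++ i :: j :: l₂ ++ [k]) z) := by
    refine LinearMap.eqOn_span' ?_
    rintro _ ⟨a, g, hg, rfl⟩
    have hg' := hg
    rw [e₁] at hg'
    rw [Module.End.mul_apply, Module.End.mul_apply, hT a g hg, map_smul, gfun, gfun, funRz, funRz,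
      funR_embed, funR_embed]
    refine fusedR_gvec_induction hη hlam (fun i => hg.adm i (hl.2 i)) hij hg'.eq_of_adjacent ?_
      (T' ∘ₗ embed D n a) (zfac D n k g • embed D n (g k).1) fun μ h₁ h₂ => ?_
    · rw [shift_of_ne hik, shift_of_ne hjk]
    · have hc := hg'.exchange hl'.1 h₁ h₂
      have e₂ : l₁ ++ j :: i :: (l₂ ++ [k]) = l₁ ++ j :: i :: l₂ ++ [k] := by simp
      rw [e₂] at hc
      rw [LinearMap.comp_apply, LinearMap.smul_apply]
      have := hT' a _ hc
      simp only [zfac, Function.update_of_ne hjk.symm, Function.update_of_ne hik.symm] at this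
      exact this
  exact this hf

theorem IsB.comm_gridRow (hr : 0 < D.r) (hcop : IsCoprime D.r' (D.r : ℤ))
    (hη : D.th 1 1 (2 * D.η) ≠ 0)
    (hlam : ∀ a : ℤ, D.th 1 1 (D.height a) ≠ 0) {z : Fin N → ℂ} (hz : z ∈ regular D N)
    {l₁ C l₂ : List (Fin N)} {j k : Fin N} (hl : Full (l₁ ++ j :: (C ++ l₂) ++ [k]))
    {T T' : Module.End ℂ (FunSpace D n)}
    (hT : IsB D n (l₁ ++ j :: (C ++ l₂)) k z T) (hT' : IsB D n (l₁ ++ (C ++ j :: l₂)) k z T')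
    {f : FunSpace D n} (hf : f ∈ chainSpace D n (l₁ ++ j :: (C ++ l₂) ++ [k]) z) :
    T' (gridRow (funRz D n z) j C f) = gridRow (funRz D n (shift D k z)) j C (T f) := by
  induction C generalizing l₁ T f with
  | nil => simpa [gridRow] using IsB.eq_of_mem hT' hT hf
  | cons y C ih =>
    simp only [gridRow_cons, Module.End.mul_apply]
    have hl' : Full ((l₁ ++ [y]) ++ j :: (C ++ l₂) ++ [k]) := hl.perm (by
      simpa using ((List.Perm.swap y j _).append_left l₁))
    -- After one exchange the remaining labels stand in a new order, for which a separate boundary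
    -- operator is required.
    obtain ⟨T₁, hT₁⟩ := exists_isB (n := n) hr hcop hη hlam hz hl'
    have hT₁' : IsB D n (l₁ ++ y :: j :: (C ++ l₂)) k z T₁ := by simpa using hT₁
    rw [← IsB.comm_funRz hη hlam hl hT hT₁' hf]
    refine ih hl' hT₁ (by simpa using hT') ?_
    have e := gridRow_chainSpace hη hlam z (l₁ := l₁) (j := j) (C := [y]) (l₂ := C ++ l₂ ++ [k])
      (by simpa using hl) (f := f) (by simpa using hf)
    simpa [gridRow] using e

/-- Carrying both labels around shifts both parameters by `κ`, so their difference is kept, and the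
two boundary factors together do not depend on the middle height that `R_{jk}` changes. -/
theorem IsB.exchange (hη : D.th 1 1 (2 * D.η) ≠ 0)
    (hlam : ∀ a : ℤ, D.th 1 1 (D.height a) ≠ 0) {z : Fin N → ℂ} {l : List (Fin N)} {j k : Fin N}
    (hl : Full (l ++ [j, k])) {Tk Tj Tj' Tk' : Module.End ℂ (FunSpace D n)}
    (hTk : IsB D n (l ++ [j]) k z Tk) (hTj : IsB D n (k :: l) j (shift D k z) Tj)
    (hTj' : IsB D n (l ++ [k]) j z Tj') (hTk' : IsB D n (j :: l) k (shift D j z) Tk')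
    {f : FunSpace D n} (hf : f ∈ chainSpace D n (l ++ [j, k]) z) :
    Tk' (Tj' (funRz D n z j k f)) =
      funRz D n (shift D j (shift D k z)) j k (Tj (Tk f)) := by
  have hjk : j ≠ k := hl.ne_of_adjacent
  have : Set.EqOn (Tk' * Tj' * funRz D n z j k) (funRz D n (shift D j (shift D k z)) j k * (Tj * Tk))
      (chainSpace D n (l ++ [j, k]) z) := by
    refine LinearMap.eqOn_span' ?_
    rintro _ ⟨a, g, hg, rfl⟩
    have e₁ : l ++ [j, k] = l ++ [j] ++ [k] := by simp
    have hg₁ := hg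
    rw [e₁] at hg₁
    have hg₂ := chain_rotate hg₁
    have e₂ : k :: (l ++ [j]) = (k :: l) ++ [j] := by simp
    rw [e₂] at hg₂
    simp only [Module.End.mul_apply]
    rw [hTk a g hg₁, map_smul, hTj _ g hg₂, smul_smul, map_smul, gfun, gfun, funRz, funRz,
      funR_embed, funR_embed]
    refine fusedR_gvec_induction hη hlam (fun i => hg.adm i (hl.2 i)) hjk hg.eq_of_adjacent ?_
      (Tk' ∘ₗ Tj' ∘ₗ embed D n a) ((zfac D n k g * zfac D n j g) • embed D n (g j).1)
      fun μ h₁ h₂ => ?_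
    · rw [shift_self, shift_of_ne hjk, shift_of_ne hjk.symm, shift_self]
      ring
    · have hc := hg.exchange hl.1 h₁ h₂
      set g' := Function.update (Function.update g j (μ, (g k).2)) k ((g j).1, μ) with hg'
      have gk : g' k = ((g j).1, μ) := by rw [hg', Function.update_self]
      have gj : g' j = (μ, (g k).2) := by
        rw [hg', Function.update_of_ne hjk, Function.update_self]
      have e₃ : l ++ [k, j] = l ++ [k] ++ [j] := by simp
      rw [e₃] at hc
      have hc₂ := chain_rotate hc
      have e₄ : j :: (l ++ [k]) = (j :: l) ++ [k] := by simp
      rw [e₄] at hc₂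
      have e₅ := hTj' a g' hc
      have e₆ := hTk' _ g' hc₂
      rw [gfun] at e₅
      rw [LinearMap.comp_apply, LinearMap.comp_apply, e₅, map_smul, e₆, smul_smul,
        LinearMap.smul_apply, gk, shift_comm j k, gfun]
      congr 1
      -- The exponents are linear in the height differences, so the middle heights telescope away on
      -- both sides.
      rw [zfac, zfac, zfac, zfac, gk, gj, ← Complex.exp_add, ← Complex.exp_add, ← mul_add,
        ← mul_add]
      congr 2
      have := hg.eq_of_adjacent
      simp only [this]
      push_cast
      ring
  exact this hf

end BoundaryOps

/-! ### Closed paths and closed chains -/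

section Paths

variable {N : ℕ} {n : Fin N → ℕ} {D : Params}

/-- The pairs of heights next to the labels, for a path in the arrangement `π`. -/
def pathPairs (π : Equiv.Perm (Fin N)) (a : Fin (N + 1) → ℤ) (i : Fin N) : ℤ × ℤ :=
  (a (π i).castSucc, a (π i).succ)

theorem pathFun_eq_gfun (π : Equiv.Perm (Fin N)) (z : Fin N → ℂ) (a : Fin (N + 1) → ℤ) :
    pathFun D n π z a = gfun D n z (a 0) (pathPairs π a) := rfl

theorem chain_ofFn {M : ℕ} {e : Fin M → Fin N} {h : Fin (M + 1) → ℤ} {g : Fin N → ℤ × ℤ}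
    (hg : ∀ p, g (e p) = (h p.castSucc, h p.succ))
    (hadm : ∀ p, Adm (n (e p)) (h p.castSucc) (h p.succ)) :
    Chain n g (List.ofFn e) (h 0) (h (Fin.last M)) := by
  induction M with
  | zero => rfl
  | succ M ih =>
    rw [List.ofFn_succ]
    have h0 := hg 0
    refine ⟨by rw [h0]; rfl, by rw [h0]; exact hadm 0, ?_⟩
    rw [h0]
    exact ih (e := fun p => e p.succ) (h := fun p => h p.succ) (fun p => hg p.succ)
      fun p => hadm p.succ

theorem exists_path_of_chain {M : ℕ} {e : Fin M → Fin N} {g : Fin N → ℤ × ℤ} {a b : ℤ}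
    (hc : Chain n g (List.ofFn e) a b) : ∃ h : Fin (M + 1) → ℤ, h 0 = a ∧ h (Fin.last M) = b ∧
      ∀ p, g (e p) = (h p.castSucc, h p.succ) := by
  induction M generalizing a with
  | zero => exact ⟨fun _ => a, rfl, hc, fun p => p.elim0⟩
  | succ M ih =>
    rw [List.ofFn_succ] at hc
    obtain ⟨h1, -, h2⟩ := hc
    obtain ⟨h, h0, hl, hp⟩ := ih h2
    refine ⟨Fin.cons a h, rfl, ?_, fun p => ?_⟩
    · rw [← Fin.succ_last, Fin.cons_succ, hl]
    · refine Fin.cases ?_ (fun q => ?_) p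
      · refine Prod.ext h1 ?_
        simp [h0]
      · rw [hp q]
        rfl

theorem chain_of_admissible {π : Equiv.Perm (Fin N)} {a : Fin (N + 1) → ℤ}
    (h : Admissible n π a) :
    Chain n (pathPairs π a) (List.ofFn π.symm) (a 0) (a (Fin.last N)) :=
  chain_ofFn (fun p => by simp [pathPairs]) fun p => by
    have := h (π.symm p)
    rwa [Equiv.apply_symm_apply] at this

theorem full_ofFn (π : Equiv.Perm (Fin N)) : Full (List.ofFn π) :=
  ⟨List.nodup_ofFn.2 π.injective, fun i => List.mem_ofFn.2 ⟨π.symm i, by simp⟩⟩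

theorem exists_closedPath {π : Equiv.Perm (Fin N)} {g : Fin N → ℤ × ℤ} {a : ℤ}
    (h : Chain n g (List.ofFn π.symm) a a) (h0 : 0 ≤ a) (hr : a < D.r) :
    ∃ b : ClosedPath D n π, b.1 0 = a ∧ pathPairs π b.1 = g := by
  obtain ⟨b, hb0, hbl, hb⟩ := exists_path_of_chain h
  have e : pathPairs π b = g := by
    funext i
    have := hb (π i)
    rw [Equiv.symm_apply_apply] at this
    exact this.symm
  refine ⟨⟨b, fun i => ?_, hb0.trans hbl.symm, hb0 ▸ h0, hb0 ▸ hr⟩, hb0, e⟩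
  have := h.adm i ((full_ofFn π.symm).2 i)
  rwa [← e] at this

theorem exists_closedPath_gfun (hr : 0 < D.r) {π : Equiv.Perm (Fin N)} {g : Fin N → ℤ × ℤ} {a : ℤ}
    (h : Chain n g (List.ofFn π.symm) a a) :
    ∃ b : ClosedPath D n π, (∃ k : ℤ, b.1 0 = a + k * D.r ∧ pathPairs π b.1 = raise (k * D.r) g) ∧
      ∀ z, pathFun D n π z b.1 = gfun D n z a g := by
  obtain ⟨k, hk, hk'⟩ := exists_raise hr a
  obtain ⟨b, hb, hb'⟩ := exists_closedPath (h.raise (k * D.r)) hk hk'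
  refine ⟨b, ⟨k, hb, hb'⟩, fun z => ?_⟩
  rw [pathFun_eq_gfun, hb, hb', gfun_raise hr]

theorem ClosedPath.chain {π : Equiv.Perm (Fin N)} (a : ClosedPath D n π) :
    Chain n (pathPairs π a.1) (List.ofFn π.symm) (a.1 0) (a.1 0) := by
  have := chain_of_admissible a.2.1
  rwa [← a.2.2.1] at this

/-- By periodicity, dropping the restriction `0 ≤ a_0 < r` on closed chains does not enlarge the
span. -/
theorem bethe_eq_chainSpace (hr : 0 < D.r) (π : Equiv.Perm (Fin N)) (z : Fin N → ℂ) :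
    bethe D n π z = chainSpace D n (List.ofFn π.symm) z := by
  refine le_antisymm (Submodule.span_le.2 ?_) (Submodule.span_le.2 ?_)
  · rintro _ ⟨a, rfl⟩
    exact Submodule.subset_span ⟨_, _, a.chain, rfl⟩
  · rintro _ ⟨a, g, h, rfl⟩
    obtain ⟨b, -, hb⟩ := exists_closedPath_gfun hr h
    exact Submodule.subset_span ⟨b, hb z⟩

theorem linearIndependent_pathFun (hr : 0 < D.r) (hcop : IsCoprime D.r' (D.r : ℤ))
    (hη : D.th 1 1 (2 * D.η) ≠ 0)
    (hlam : ∀ a : ℤ, D.th 1 1 (D.height a) ≠ 0) {z : Fin N → ℂ} (hz : z ∈ regular D N)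
    (π : Equiv.Perm (Fin N)) :
    LinearIndependent ℂ fun a : ClosedPath D n π => pathFun D n π z a.1 := by
  let φ : ClosedPath D n π → ClosedChain D n (List.ofFn π.symm) := fun a =>
    ⟨(a.1 0, pathPairs π a.1), a.chain, a.2.2.2⟩
  refine (linearIndependent_gfun hr hcop hη hlam hz (full_ofFn π.symm)).comp φ fun a b h => ?_
  have h0 : a.1 0 = b.1 0 := congrArg (fun p => p.1.1) h
  have h1 : pathPairs π a.1 = pathPairs π b.1 := congrArg (fun p => p.1.2) h
  apply Subtype.ext
  funext p
  refine Fin.cases h0 (fun q => ?_) p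
  have := congrArg Prod.snd (congrFun h1 (π.symm q))
  simpa [pathPairs] using this

/-! ### The arrangements occurring in the operators `A_j` -/

/-- The labels before `j`. -/
def ltL (j : Fin N) : List (Fin N) := (List.finRange N).filter (fun k => k < j)

/-- The labels after `j`. -/
def gtL (j : Fin N) : List (Fin N) := (List.finRange N).filter (fun k => j < k)

theorem mem_ltL {j k : Fin N} : k ∈ ltL j ↔ k < j := by simp [ltL]

theorem mem_gtL {j k : Fin N} : k ∈ gtL j ↔ j < k := by simp [gtL]

theorem pairwise_ltL (j : Fin N) : (ltL j).Pairwise (· < ·) :=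
  (List.pairwise_lt_finRange N).filter _

theorem pairwise_gtL (j : Fin N) : (gtL j).Pairwise (· < ·) :=
  (List.pairwise_lt_finRange N).filter _

theorem finRange_eq (j : Fin N) : List.finRange N = ltL j ++ j :: gtL j := by
  refine (List.sortedLT_finRange N).eq_of_mem_iff (List.Pairwise.sortedLT ?_) fun k => ?_
  · refine List.pairwise_append.2 ⟨pairwise_ltL j, List.pairwise_cons.2
      ⟨fun k hk => mem_gtL.1 hk, pairwise_gtL j⟩, fun a ha b hb => ?_⟩
    rw [mem_ltL] at ha
    rcases List.mem_cons.1 hb with rfl | hb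
    · exact ha
    · exact ha.trans (mem_gtL.1 hb)
  · simp only [List.mem_finRange, List.mem_append, List.mem_cons, mem_ltL, mem_gtL, true_iff]
    rcases lt_trichotomy k j with h | h | h
    · exact Or.inl h
    · exact Or.inr (Or.inl h)
    · exact Or.inr (Or.inr h)

theorem ofFn_one : List.ofFn (Equiv.symm (1 : Equiv.Perm (Fin N))) = List.finRange N :=
  List.ofFn_id N

theorem ofFn_succAbove {m : ℕ} (j : Fin (m + 1)) :
    List.ofFn j.succAbove = ltL j ++ gtL j := by
  refine (Fin.strictMono_succAbove j).sortedLT_ofFn.eq_of_mem_iff (List.Pairwise.sortedLT ?_)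
    fun k => ?_
  · refine List.pairwise_append.2 ⟨pairwise_ltL j, pairwise_gtL j, fun a ha b hb => ?_⟩
    exact (mem_ltL.1 ha).trans (mem_gtL.1 hb)
  · simp only [List.mem_append, mem_ltL, mem_gtL, List.mem_ofFn]
    exact Fin.exists_succAbove_eq_iff.trans lt_or_lt_iff_ne.symm

theorem ofFn_lastOrder (j : Fin N) :
    List.ofFn (lastOrder j).symm = ltL j ++ gtL j ++ [j] := by
  cases N with
  | zero => exact j.elim0
  | succ m =>
    have e : ∀ p, (lastOrder j).symm p = j.cycleRange.symm (finRotate (m + 1) p) := fun p => rfl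
    rw [List.ofFn_succ_last, e, finRotate_last, Fin.cycleRange_symm_zero, ← ofFn_succAbove]
    simp only [e, finRotate_apply, Fin.coeSucc_eq_succ, Fin.cycleRange_symm_succ]

theorem full_finRange : Full (List.finRange N) := ⟨List.nodup_finRange N, List.mem_finRange⟩

theorem full_lastOrder (j : Fin N) : Full (ltL j ++ gtL j ++ [j]) :=
  ofFn_lastOrder j ▸ full_ofFn _

theorem lastOrder_self {m : ℕ} (j : Fin (m + 1)) : lastOrder j j = Fin.last m := by
  rw [lastOrder, Equiv.trans_apply, Fin.cycleRange_self, Equiv.symm_apply_eq, finRotate_last]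

theorem pathPairs_lastOrder_self (j : Fin N) (a : Fin (N + 1) → ℤ) :
    pathPairs (lastOrder j) a j = (a ⟨N - 1, by omega⟩, a (Fin.last N)) := by
  cases N with
  | zero => exact j.elim0
  | succ m =>
    rw [pathPairs, lastOrder_self]
    rfl

theorem pathPairs_rotatePath (j : Fin N) {a : Fin (N + 1) → ℤ} (ha : a 0 = a (Fin.last N)) :
    pathPairs (firstOrder j) (rotatePath a) = pathPairs (lastOrder j) a := by
  cases N with
  | zero => exact j.elim0
  | succ m =>
    funext i
    have e : firstOrder j i = finRotate (m + 1) (lastOrder j i) := by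
      rw [lastOrder, Equiv.trans_apply, Equiv.apply_symm_apply]; rfl
    rw [pathPairs, pathPairs, e]
    generalize lastOrder j i = p
    refine Fin.lastCases ?_ (fun q => ?_) p
    · rw [finRotate_last]
      refine Prod.ext rfl ?_
      exact ha
    · rw [finRotate_apply, Fin.coeSucc_eq_succ]
      rfl

theorem IsB.isBoundary {j : Fin N} {z : Fin N → ℂ} {T : Module.End ℂ (FunSpace D n)}
    (h : IsB D n (ltL j ++ gtL j) j z T) : IsBoundary D n j z T := by
  intro a
  have hc := a.chain
  rw [ofFn_lastOrder] at hc
  rw [pathFun_eq_gfun, pathFun_eq_gfun, h _ _ hc, zfac, pathPairs_rotatePath j a.2.2.1,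
    pathPairs_lastOrder_self]
  rfl

/-- A closed chain with any base height is raised to a closed path in the fundamental range. The
vectors and the exponential factor are unchanged, so the prescription on closed paths determines all
chains. -/
theorem IsBoundary.isB (hr : 0 < D.r) {j : Fin N} {z : Fin N → ℂ}
    {T : Module.End ℂ (FunSpace D n)} (h : IsBoundary D n j z T) :
    IsB D n (ltL j ++ gtL j) j z T := by
  intro a g hg
  rw [← ofFn_lastOrder] at hg
  obtain ⟨b, ⟨k, hb0, hb⟩, hbz⟩ := exists_closedPath_gfun hr hg
  have e := h b
  have e1 := pathPairs_lastOrder_self j b.1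
  rw [hb] at e1
  have e2 : b.1 ⟨N - 1, by omega⟩ = (g j).1 + k * D.r := (congrArg Prod.fst e1).symm
  have e3 : b.1 (Fin.last N) = (g j).2 + k * D.r := (congrArg Prod.snd e1).symm
  have e4 : rotatePath b.1 0 = (g j).1 + k * D.r := e2
  rw [hbz, pathFun_eq_gfun, pathPairs_rotatePath j b.2.2.1, hb, e4, gfun_raise hr, e2, e3,
    add_sub_add_right_eq_sub] at e
  exact e

theorem isBoundary_boundary (hr : 0 < D.r) (hcop : IsCoprime D.r' (D.r : ℤ))
    (hη : D.th 1 1 (2 * D.η) ≠ 0)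
    (hlam : ∀ a : ℤ, D.th 1 1 (D.height a) ≠ 0) {z : Fin N → ℂ} (hz : z ∈ regular D N)
    (j : Fin N) : IsBoundary D n j z (boundary D n j z) := by
  have h : ∃ T, IsBoundary D n j z T := by
    obtain ⟨T, hT⟩ := exists_isB (n := n) hr hcop hη hlam hz (full_lastOrder j)
    exact ⟨T, hT.isBoundary⟩
  rw [boundary, dif_pos h]
  exact h.choose_spec

theorem isB_boundary (hr : 0 < D.r) (hcop : IsCoprime D.r' (D.r : ℤ))
    (hη : D.th 1 1 (2 * D.η) ≠ 0)
    (hlam : ∀ a : ℤ, D.th 1 1 (D.height a) ≠ 0) {z : Fin N → ℂ} (hz : z ∈ regular D N)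
    (j : Fin N) : IsB D n (ltL j ++ gtL j) j z (boundary D n j z) :=
  (isBoundary_boundary hr hcop hη hlam hz j).isB hr

/-- The arguments `z_j + κ - z_k` to the left of the boundary operator are the differences for the
shifted point, so both products are rows, one at `z` and one at `z_j`. -/
theorem opA_eq (j : Fin N) (z : Fin N → ℂ) : opA D n j z =
    gridRow (funRz D n (shift D j z)) j (ltL j) * boundary D n j z *
      gridRow (funRz D n z) j (gtL j) := by
  have e : (ltL j).map (fun k => funRz D n (shift D j z) j k) =
      (ltL j).map fun k => funR D n j k (z j + D.κ - z k) :=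
    List.map_congr_left fun k hk => by rw [funRz, shift_self, shift_of_ne (mem_ltL.1 hk).ne]
  rw [gridRow, gridRow, e, ← List.map_reverse, ← List.map_reverse]
  rfl

end Paths

/-! ### Rearrangements of rows -/

section Rows

variable {ι M : Type*} [Monoid M] {r : ι → ι → M}

theorem commute_gridRow_gridRow (hr : DisjointCommute r) {j k : ι} {A B : List ι} (hjk : j ≠ k)
    (hjB : j ∉ B) (hkA : k ∉ A) (hAB : A.Disjoint B) :
    Commute (gridRow r j A) (gridRow r k B) :=
  commute_gridRow fun b hb => (commute_gridRow fun a ha => hr k b j a hjk.symm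
    (fun h => hkA (h ▸ ha)) (fun h => hjB (h ▸ hb)) (fun h => hAB ha (h ▸ hb))).symm

theorem gridRow_append_cons (x y : ι) (B C : List ι) :
    gridRow r x (B ++ y :: C) = gridRow r x C * r x y * gridRow r x B := by
  rw [gridRow_append, gridRow_cons]

variable {j k : ι} {X₁ X₂ X₃ : List ι}

/-- The labels `X₁, j, X₂, k, X₃` are distinct. -/
structure Distinct (j k : ι) (X₁ X₂ X₃ : List ι) : Prop where
  ne : j ≠ k
  j₁ : j ∉ X₁
  j₂ : j ∉ X₂
  j₃ : j ∉ X₃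
  k₁ : k ∉ X₁
  k₂ : k ∉ X₂
  k₃ : k ∉ X₃
  n₁ : X₁.Nodup
  n₂ : X₂.Nodup
  n₃ : X₃.Nodup
  d₁₂ : X₁.Disjoint X₂
  d₁₃ : X₁.Disjoint X₃
  d₂₃ : X₂.Disjoint X₃

theorem distinct_of_nodup (h : (X₁ ++ j :: (X₂ ++ k :: X₃)).Nodup) : Distinct j k X₁ X₂ X₃ := by
  simp only [List.nodup_append, List.nodup_cons, List.mem_append, List.mem_cons, not_or] at h
  obtain ⟨h1, ⟨⟨h2, h3, h4⟩, h5, ⟨h6, h7⟩, h8⟩, h9⟩ := h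
  exact
    { ne := h3
      j₁ := fun h => h9 j h j (Or.inl rfl) rfl
      j₂ := h2
      j₃ := h4
      k₁ := fun h => h9 k h k (Or.inr (Or.inr (Or.inl rfl))) rfl
      k₂ := fun h => h8 k h k (Or.inl rfl) rfl
      k₃ := h6
      n₁ := h1
      n₂ := h5
      n₃ := h7
      d₁₂ := fun a ha hb => h9 a ha a (Or.inr (Or.inl hb)) rfl
      d₁₃ := fun a ha hb => h9 a ha a (Or.inr (Or.inr (Or.inr hb))) rfl
      d₂₃ := fun a ha hb => h8 a ha a (Or.inr hb) rfl }

/-- Yang-Baxter along `X₂` brings `r j k` next to `r k j`, and the two cancel. -/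
theorem gridRow_mul_gridRow_cancel (hr : DisjointCommute r) (hY : YangBaxter r)
    (h : Distinct j k X₁ X₂ X₃) (hu : r j k * r k j = 1) :
    gridRow r j (X₂ ++ k :: X₃) * gridRow r k (X₁ ++ j :: X₂) =
      gridRow r k (X₁ ++ X₂) * gridRow r j (X₂ ++ X₃) := by
  have y := yangBaxter_gridRow hr hY h.ne h.j₂ h.k₂ h.n₂
  have c₁ := commute_gridRow_gridRow hr h.ne h.j₂ h.k₃ h.d₂₃.symm
  have c₂ := commute_gridRow_gridRow hr h.ne h.j₁ h.k₂ h.d₁₂.symm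
  have c₃ := commute_gridRow_gridRow hr h.ne h.j₁ h.k₃ h.d₁₃.symm
  rw [gridRow_append_cons, gridRow_append_cons, gridRow_append, gridRow_append]
  calc gridRow r j X₃ * r j k * gridRow r j X₂ * (gridRow r k X₂ * r k j * gridRow r k X₁)
      = gridRow r j X₃ * (r j k * gridRow r j X₂ * gridRow r k X₂) * r k j * gridRow r k X₁ := by
        simp only [mul_assoc]
    _ = gridRow r j X₃ * gridRow r k X₂ * gridRow r j X₂ * (r j k * r k j) * gridRow r k X₁ := by
        rw [y]; simp only [mul_assoc]
    _ = (gridRow r j X₃ * gridRow r k X₂) * (gridRow r j X₂ * gridRow r k X₁) := by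
        rw [hu, mul_one]; simp only [mul_assoc]
    _ = gridRow r k X₂ * (gridRow r j X₃ * gridRow r k X₁) * gridRow r j X₂ := by
        rw [c₁.eq, c₂.eq]; simp only [mul_assoc]
    _ = _ := by rw [c₃.eq]; simp only [mul_assoc]

theorem gridRow_mul_gridRow_append (hr : DisjointCommute r) (hY : YangBaxter r)
    (h : Distinct j k X₁ X₂ X₃) :
    gridRow r k X₃ * gridRow r j (X₂ ++ k :: X₃) =
      r j k * (gridRow r j (X₂ ++ X₃) * gridRow r k X₃) := by
  have y := yangBaxter_gridRow hr hY h.ne h.j₃ h.k₃ h.n₃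
  have c := commute_gridRow_gridRow hr h.ne h.j₃ h.k₂ h.d₂₃
  rw [gridRow_append_cons, gridRow_append]
  calc gridRow r k X₃ * (gridRow r j X₃ * r j k * gridRow r j X₂)
      = gridRow r k X₃ * gridRow r j X₃ * r j k * gridRow r j X₂ := by simp only [mul_assoc]
    _ = r j k * gridRow r j X₃ * (gridRow r k X₃ * gridRow r j X₂) := by
        rw [← y]; simp only [mul_assoc]
    _ = _ := by rw [← c.eq]; simp only [mul_assoc]

theorem gridRow_append_mul_gridRow (hr : DisjointCommute r) (hY : YangBaxter r)
    (h : Distinct j k X₁ X₂ X₃) (hu : r k j * r j k = 1) :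
    gridRow r k (X₁ ++ j :: X₂) * (gridRow r j X₁ * r j k) =
      gridRow r j X₁ * gridRow r k (X₁ ++ X₂) := by
  have y := yangBaxter_gridRow hr hY h.ne h.j₁ h.k₁ h.n₁
  have c := commute_gridRow_gridRow hr h.ne h.j₂ h.k₁ h.d₁₂
  rw [gridRow_append_cons, gridRow_append]
  calc gridRow r k X₂ * r k j * gridRow r k X₁ * (gridRow r j X₁ * r j k)
      = gridRow r k X₂ * r k j * (gridRow r k X₁ * gridRow r j X₁ * r j k) := by
        simp only [mul_assoc]
    _ = gridRow r k X₂ * (r k j * r j k) * gridRow r j X₁ * gridRow r k X₁ := by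
        rw [← y]; simp only [mul_assoc]
    _ = (gridRow r k X₂ * gridRow r j X₁) * gridRow r k X₁ := by rw [hu, mul_one]
    _ = _ := by rw [← c.eq]; simp only [mul_assoc]

end Rows

/-! ### The operators `A_j` -/

section OperatorsA

variable {N : ℕ} {n : Fin N → ℕ} {D : Params}

theorem gridRow_bijOn (hη : D.th 1 1 (2 * D.η) ≠ 0)
    (hlam : ∀ a : ℤ, D.th 1 1 (D.height a) ≠ 0) {z : Fin N → ℂ} (hz : z ∈ regular D N)
    {l₁ C l₂ : List (Fin N)} {j : Fin N} (hl : Full (l₁ ++ j :: (C ++ l₂))) :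
    Set.BijOn ⇑(gridRow (funRz D n z) j C)
      (chainSpace D n (l₁ ++ j :: (C ++ l₂)) z : Set (FunSpace D n))
      (chainSpace D n (l₁ ++ (C ++ j :: l₂)) z : Set (FunSpace D n)) := by
  have hnd := (List.nodup_append.1 hl.1).2.1
  rw [List.nodup_cons, List.mem_append, not_or] at hnd
  have hl' : Full (l₁ ++ (C ++ j :: l₂)) := hl.perm (List.perm_middle.symm.append_left l₁)
  exact Set.InvOn.bijOn (f' := ⇑(gridCol (funRz D n z) C j))
    ⟨fun f hf => gridCol_gridRow_apply hη hz hnd.1.1 (List.nodup_append.1 hnd.2).1 hl hf,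
      fun f hf => gridRow_gridCol_apply hη hz hnd.1.1 hl' hf⟩
    (fun f hf => gridRow_chainSpace hη hlam z hl hf)
    (fun f hf => gridCol_chainSpace hη hlam z hl' hf)

theorem opA_bijOn (hr : 0 < D.r) (hcop : IsCoprime D.r' (D.r : ℤ))
    (hη : D.th 1 1 (2 * D.η) ≠ 0)
    (hlam : ∀ a : ℤ, D.th 1 1 (D.height a) ≠ 0) {z : Fin N → ℂ} (hz : z ∈ regular D N)
    {j : Fin N} (hz' : shift D j z ∈ regular D N) :
    Set.BijOn (opA D n j z) (chainSpace D n (List.finRange N) z)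
      (chainSpace D n (List.finRange N) (shift D j z)) := by
  have hl : Full (ltL j ++ j :: (gtL j ++ [])) := by
    rw [List.append_nil, ← finRange_eq]; exact full_finRange
  have hl₂ := full_lastOrder j
  have hl₃ : Full ([] ++ j :: (ltL j ++ gtL j)) := hl₂.perm (List.perm_append_singleton _ _)
  have h1 := gridRow_bijOn (n := n) hη hlam hz hl
  have h2 := (isB_boundary (n := n) hr hcop hη hlam hz j).bijOn hr hcop hη hlam hz' hl₂
  have h3 := gridRow_bijOn (n := n) hη hlam hz' hl₃
  rw [List.append_nil, ← finRange_eq, ← List.append_assoc] at h1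
  rw [List.nil_append, List.nil_append, ← finRange_eq] at h3
  rw [opA_eq]
  exact (h3.comp h2).comp h1

theorem exists_finRange_eq {j k : Fin N} (h : j < k) : ∃ X₁ X₂ X₃ : List (Fin N),
    List.finRange N = X₁ ++ j :: (X₂ ++ k :: X₃) ∧ ltL j = X₁ ∧ gtL j = X₂ ++ k :: X₃ ∧
      ltL k = X₁ ++ j :: X₂ ∧ gtL k = X₃ := by
  obtain ⟨X₂, X₃, hX⟩ := List.append_of_mem (mem_gtL.2 h)
  have e : List.finRange N = ltL j ++ j :: (X₂ ++ k :: X₃) := by rw [← hX, ← finRange_eq]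
  have e' : ltL k ++ k :: gtL k = (ltL j ++ j :: X₂) ++ k :: X₃ := by
    rw [← finRange_eq, e]; simp
  have h' := (List.append_cons_inj_of_notMem (fun h => lt_irrefl k (mem_ltL.1 h))
    fun h => lt_irrefl k (mem_gtL.1 h)).1 e'
  exact ⟨ltL j, X₂, X₃, e, rfl, hX, h'.1, h'.2.2⟩

/-- Both sides reduce to: row `k` over `X₃`, row `j` over `X₂ ++ X₃`, carry `k` and then `j` around,
row `k` over `X₁ ++ X₂`, row `j` over `X₁`. On the left `R_{jk}R_{kj}` cancels between the two
boundary operators; on the right `R_{jk}` is pulled through both of them and then cancels against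
`R_{kj}`. -/
theorem opA_comm_aux (hr : 0 < D.r) (hcop : IsCoprime D.r' (D.r : ℤ))
    (hη : D.th 1 1 (2 * D.η) ≠ 0)
    (hlam : ∀ a : ℤ, D.th 1 1 (D.height a) ≠ 0) {z : Fin N → ℂ} (hz : z ∈ regular D N)
    {j k : Fin N} (hj : shift D j z ∈ regular D N) (hk : shift D k z ∈ regular D N)
    (hjk : shift D j (shift D k z) ∈ regular D N) {X₁ X₂ X₃ : List (Fin N)}
    (hl : Full (X₁ ++ j :: (X₂ ++ k :: X₃))) {Zk Zj' Zj Zk' : Module.End ℂ (FunSpace D n)}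
    (hZk : IsB D n (X₁ ++ j :: (X₂ ++ X₃)) k z Zk)
    (hZj' : IsB D n (X₁ ++ (X₂ ++ k :: X₃)) j (shift D k z) Zj')
    (hZj : IsB D n (X₁ ++ (X₂ ++ k :: X₃)) j z Zj)
    (hZk' : IsB D n (X₁ ++ j :: (X₂ ++ X₃)) k (shift D j z) Zk')
    {f : FunSpace D n} (hf : f ∈ chainSpace D n (X₁ ++ j :: (X₂ ++ k :: X₃)) z) :
    gridRow (funRz D n (shift D j (shift D k z))) j X₁ (Zj'
      (gridRow (funRz D n (shift D k z)) j (X₂ ++ k :: X₃)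
        (gridRow (funRz D n (shift D k z)) k (X₁ ++ j :: X₂) (Zk
          (gridRow (funRz D n z) k X₃ f))))) =
    gridRow (funRz D n (shift D j (shift D k z))) k (X₁ ++ j :: X₂) (Zk'
      (gridRow (funRz D n (shift D j z)) k X₃
        (gridRow (funRz D n (shift D j z)) j X₁ (Zj
          (gridRow (funRz D n z) j (X₂ ++ k :: X₃) f))))) := by
  have hd := distinct_of_nodup hl.1
  have hj₂₃ : j ∉ X₂ ++ X₃ := by simp [hd.j₂, hd.j₃]
  have hk₁₂ : k ∉ X₁ ++ X₂ := by simp [hd.k₁, hd.k₂]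
  have hjk₂₃ : j ∉ X₂ ++ k :: X₃ := by simp [hd.j₂, hd.j₃, hd.ne]
  have hkj₁₂ : k ∉ X₁ ++ j :: X₂ := by simp [hd.k₁, hd.k₂, hd.ne.symm]
  have full : ∀ {l : List (Fin N)}, l.Perm (X₁ ++ j :: (X₂ ++ k :: X₃)) → Full l :=
    fun h => hl.perm h.symm
  have perm : ∀ {l l' : List (Fin N)}, (∀ a, l.count a = l'.count a) → l.Perm l' :=
    fun h => List.perm_iff_count.2 h
  have fA : Full (X₁ ++ (X₂ ++ (X₃ ++ [j])) ++ [k]) := full (perm fun a => by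
    simp only [List.count_append, List.count_cons, List.count_nil]; ring)
  have fB : Full (k :: (X₁ ++ (X₂ ++ X₃)) ++ [j]) := full (perm fun a => by
    simp only [List.count_append, List.count_cons, List.count_nil]; ring)
  have fC : Full (X₁ ++ (X₂ ++ (X₃ ++ [k])) ++ [j]) := full (perm fun a => by
    simp only [List.count_append, List.count_cons, List.count_nil]; ring)
  have fD : Full (j :: (X₁ ++ (X₂ ++ X₃)) ++ [k]) := full (perm fun a => by
    simp only [List.count_append, List.count_cons, List.count_nil]; ring)
  have fE : Full (X₁ ++ j :: (X₂ ++ X₃) ++ [k]) := full (perm fun a => by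
    simp only [List.count_append, List.count_cons, List.count_nil]; ring)
  have fF : Full (X₁ ++ (X₂ ++ k :: X₃) ++ [j]) := full (perm fun a => by
    simp only [List.count_append, List.count_cons, List.count_nil]; ring)
  have fG : Full (X₁ ++ (X₂ ++ X₃) ++ [j, k]) := full (perm fun a => by
    simp only [List.count_append, List.count_cons, List.count_nil]; ring)
  have fH : Full (j :: (k :: (X₁ ++ (X₂ ++ X₃)))) := full (perm fun a => by
    simp only [List.count_append, List.count_cons]; ring)
  have fI : Full (k :: (X₁ ++ j :: (X₂ ++ X₃))) := full (perm fun a => by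
    simp only [List.count_append, List.count_cons]; ring)
  have fJ : Full (j :: (X₁ ++ (X₂ ++ k :: X₃))) := full (perm fun a => by
    simp only [List.count_append, List.count_cons]; ring)
  -- Moving rows through the boundary changes the order of the labels, so boundary operators for
  -- intermediate arrangements are needed besides the four given ones.
  obtain ⟨ZkA, hZkA⟩ := exists_isB (n := n) hr hcop hη hlam hz fA
  obtain ⟨ZjA, hZjA⟩ := exists_isB (n := n) hr hcop hη hlam hk fB
  obtain ⟨ZjB, hZjB⟩ := exists_isB (n := n) hr hcop hη hlam hz fC
  obtain ⟨ZkB, hZkB⟩ := exists_isB (n := n) hr hcop hη hlam hj fD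
  -- the left-hand side
  have f₁ : gridRow (funRz D n z) k X₃ f ∈ chainSpace D n (X₁ ++ j :: (X₂ ++ X₃) ++ [k]) z := by
    simpa using gridRow_chainSpace hη hlam z (l₁ := X₁ ++ j :: X₂) (j := k) (C := X₃) (l₂ := [])
      (by simpa using hl) (f := f) (by simpa using hf)
  set F₁ := gridRow (funRz D n z) k X₃ f with hF₁
  have f₃ : gridRow (funRz D n z) j (X₂ ++ X₃) F₁ ∈
      chainSpace D n (X₁ ++ (X₂ ++ X₃) ++ [j, k]) z := by
    simpa using gridRow_chainSpace hη hlam z (l₁ := X₁) (j := j) (C := X₂ ++ X₃) (l₂ := [k])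
      (by simpa using fE) (f := F₁) (by simpa using f₁)
  set F₃ := gridRow (funRz D n z) j (X₂ ++ X₃) F₁ with hF₃
  have l₁ : gridRow (funRz D n (shift D k z)) j (X₂ ++ k :: X₃)
      (gridRow (funRz D n (shift D k z)) k (X₁ ++ j :: X₂) (Zk F₁)) =
      gridRow (funRz D n (shift D k z)) k (X₁ ++ X₂)
        (gridRow (funRz D n (shift D k z)) j (X₂ ++ X₃) (Zk F₁)) := by
    have h := (induces_gridRow (n := n) hη (shift D k z) hjk₂₃).mul
      (induces_gridRow hη (shift D k z) hkj₁₂)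
    rw [gridRow_mul_gridRow_cancel (disjointCommute_blockR hη _) (yangBaxter_blockR hη _) hd
      (blockR_mul_blockR hη hk hd.ne.symm)] at h
    exact h.eq_of_mem ((induces_gridRow hη _ hk₁₂).mul (induces_gridRow hη _ hj₂₃)) fI
      (hZk.mem_chainSpace f₁)
  have l₂ : gridRow (funRz D n (shift D k z)) j (X₂ ++ X₃) (Zk F₁) = ZkA F₃ :=
    (IsB.comm_gridRow hr hcop hη hlam hz (l₁ := X₁) (C := X₂ ++ X₃) (l₂ := []) (by simpa using fE)
      (by simpa using hZk) (by simpa using hZkA) (by simpa using f₁)).symm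
  have f₄ : ZkA F₃ ∈ chainSpace D n (k :: (X₁ ++ (X₂ ++ X₃)) ++ [j]) (shift D k z) := by
    simpa using hZkA.mem_chainSpace (by simpa using f₃)
  have l₃ : Zj' (gridRow (funRz D n (shift D k z)) k (X₁ ++ X₂) (ZkA F₃)) =
      gridRow (funRz D n (shift D j (shift D k z))) k (X₁ ++ X₂) (ZjA (ZkA F₃)) :=
    IsB.comm_gridRow hr hcop hη hlam hk (l₁ := []) (C := X₁ ++ X₂) (l₂ := X₃) (by simpa using fB)
      (by simpa using hZjA) (by simpa using hZj') (by simpa using f₄)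
  -- the right-hand side
  have g₁ : gridRow (funRz D n z) j (X₂ ++ k :: X₃) f ∈
      chainSpace D n (X₁ ++ (X₂ ++ k :: X₃) ++ [j]) z := by
    simpa using gridRow_chainSpace hη hlam z (l₁ := X₁) (j := j) (C := X₂ ++ k :: X₃) (l₂ := [])
      (by simpa using hl) (f := f) (by simpa using hf)
  set G₁ := gridRow (funRz D n z) j (X₂ ++ k :: X₃) f with hG₁
  have r₁ : gridRow (funRz D n (shift D j z)) k X₃
      (gridRow (funRz D n (shift D j z)) j X₁ (Zj G₁)) =
      gridRow (funRz D n (shift D j z)) j X₁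
        (gridRow (funRz D n (shift D j z)) k X₃ (Zj G₁)) := by
    have h := (induces_gridRow (n := n) hη (shift D j z) hd.k₃).mul
      (induces_gridRow hη (shift D j z) hd.j₁)
    rw [← (commute_gridRow_gridRow (disjointCommute_blockR (n := n) hη (shift D j z)) hd.ne hd.j₃
      hd.k₁ hd.d₁₃).eq] at h
    exact h.eq_of_mem ((induces_gridRow hη _ hd.j₁).mul (induces_gridRow hη _ hd.k₃)) fJ
      (hZj.mem_chainSpace g₁)
  have r₂ : gridRow (funRz D n (shift D j z)) k X₃ (Zj G₁) =
      ZjB (gridRow (funRz D n z) k X₃ G₁) :=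
    (IsB.comm_gridRow hr hcop hη hlam hz (l₁ := X₁ ++ X₂) (C := X₃) (l₂ := []) (by simpa using fF)
      (by simpa using hZj) (by simpa using hZjB) (by simpa using g₁)).symm
  have r₃ : gridRow (funRz D n z) k X₃ G₁ = funRz D n z j k F₃ := by
    have h := (induces_gridRow (n := n) hη z hd.k₃).mul (induces_gridRow hη z hjk₂₃)
    rw [gridRow_mul_gridRow_append (disjointCommute_blockR hη _) (yangBaxter_blockR hη _) hd] at h
    exact h.eq_of_mem ((induces_funRz hη z hd.ne).mul
      ((induces_gridRow hη z hj₂₃).mul (induces_gridRow hη z hd.k₃))) hl hf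
  have g₂ : ZjB (funRz D n z j k F₃) ∈
      chainSpace D n (j :: (X₁ ++ (X₂ ++ X₃)) ++ [k]) (shift D j z) := by
    have h := gridRow_chainSpace hη hlam z (l₁ := X₁ ++ (X₂ ++ X₃)) (j := j) (C := [k]) (l₂ := [])
      (by simpa using fG) (f := F₃) (by simpa using f₃)
    have e : gridRow (funRz D n z) j [k] = funRz D n z j k := by simp [gridRow]
    rw [e] at h
    simpa using hZjB.mem_chainSpace (by simpa using h)
  have r₄ : Zk' (gridRow (funRz D n (shift D j z)) j X₁ (ZjB (funRz D n z j k F₃))) =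
      gridRow (funRz D n (shift D j (shift D k z))) j X₁ (ZkB (ZjB (funRz D n z j k F₃))) := by
    rw [shift_comm j k]
    exact IsB.comm_gridRow hr hcop hη hlam hj (l₁ := []) (C := X₁) (l₂ := X₂ ++ X₃)
      (by simpa using fD) (by simpa using hZkB) (by simpa using hZk') (by simpa using g₂)
  have r₅ : ZkB (ZjB (funRz D n z j k F₃)) =
      funRz D n (shift D j (shift D k z)) j k (ZjA (ZkA F₃)) :=
    IsB.exchange hη hlam fG (by simpa using hZkA) hZjA (by simpa using hZjB) hZkB f₃
  have r₆ : gridRow (funRz D n (shift D j (shift D k z))) k (X₁ ++ j :: X₂)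
      (gridRow (funRz D n (shift D j (shift D k z))) j X₁
        (funRz D n (shift D j (shift D k z)) j k (ZjA (ZkA F₃)))) =
      gridRow (funRz D n (shift D j (shift D k z))) j X₁
        (gridRow (funRz D n (shift D j (shift D k z))) k (X₁ ++ X₂) (ZjA (ZkA F₃))) := by
    have h := (induces_gridRow (n := n) hη (shift D j (shift D k z)) hkj₁₂).mul
      ((induces_gridRow hη (shift D j (shift D k z)) hd.j₁).mul 
        (induces_funRz hη (shift D j (shift D k z)) hd.ne))
    rw [gridRow_append_mul_gridRow (disjointCommute_blockR hη _) (yangBaxter_blockR hη _) hd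
      (blockR_mul_blockR hη hjk hd.ne)] at h
    exact h.eq_of_mem ((induces_gridRow hη _ hd.j₁).mul (induces_gridRow hη _ hk₁₂)) fH
      (hZjA.mem_chainSpace f₄)
  rw [l₁, l₂, l₃, r₁, r₂, r₃, r₄, r₅, r₆]

theorem opA_comm_of_lt (hr : 0 < D.r) (hcop : IsCoprime D.r' (D.r : ℤ))
    (hη : D.th 1 1 (2 * D.η) ≠ 0)
    (hlam : ∀ a : ℤ, D.th 1 1 (D.height a) ≠ 0) {z : Fin N → ℂ} (hz : z ∈ regular D N)
    {j k : Fin N} (hlt : j < k) (hj : shift D j z ∈ regular D N)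
    (hk : shift D k z ∈ regular D N) (hjk : shift D j (shift D k z) ∈ regular D N)
    {f : FunSpace D n} (hf : f ∈ chainSpace D n (List.finRange N) z) :
    opA D n j (shift D k z) (opA D n k z f) = opA D n k (shift D j z) (opA D n j z f) := by
  obtain ⟨X₁, X₂, X₃, e, e₁, e₂, e₃, e₄⟩ := exists_finRange_eq hlt
  have bk := isB_boundary (n := n) hr hcop hη hlam hz k
  have bj' := isB_boundary (n := n) hr hcop hη hlam hk j
  have bj := isB_boundary (n := n) hr hcop hη hlam hz j
  have bk' := isB_boundary (n := n) hr hcop hη hlam hj k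
  rw [e₃, e₄, List.append_assoc, List.cons_append] at bk bk'
  rw [e₁, e₂] at bj bj'
  simp only [opA_eq, Module.End.mul_apply, e₁, e₂, e₃, e₄]
  rw [shift_comm k j]
  exact opA_comm_aux hr hcop hη hlam hz hj hk hjk (e ▸ full_finRange) bk bj' bj bk' (e ▸ hf)

theorem opA_comm (hr : 0 < D.r) (hcop : IsCoprime D.r' (D.r : ℤ))
    (hη : D.th 1 1 (2 * D.η) ≠ 0)
    (hlam : ∀ a : ℤ, D.th 1 1 (D.height a) ≠ 0) {z : Fin N → ℂ} (hz : z ∈ regular D N)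
    {j k : Fin N} (hj : shift D j z ∈ regular D N)
    (hk : shift D k z ∈ regular D N) (hjk : shift D j (shift D k z) ∈ regular D N)
    {f : FunSpace D n} (hf : f ∈ chainSpace D n (List.finRange N) z) :
    opA D n j (shift D k z) (opA D n k z f) = opA D n k (shift D j z) (opA D n j z f) := by
  rcases lt_trichotomy j k with h | rfl | h
  · exact opA_comm_of_lt hr hcop hη hlam hz h hj hk hjk hf
  · rfl
  · rw [shift_comm j k] at hjk
    exact (opA_comm_of_lt hr hcop hη hlam hz h hk hj hjk hf).symm

end OperatorsA

/-! ### The matrix difference system -/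

section Mero

variable {N : ℕ} {n : Fin N → ℕ} {D : Params}

/-- The functions on `Ω` which are quotients of entire functions, with denominators that do not
vanish on `Ω`. -/
def meroAlg {E : Type*} [NormedAddCommGroup E] [NormedSpace ℂ E] (Ω : Set E) :
    Subalgebra ℂ (Ω → ℂ) where
  carrier := {p | ∃ P Q : E → ℂ, Differentiable ℂ P ∧ Differentiable ℂ Q ∧
    ∀ σ : Ω, Q σ ≠ 0 ∧ p σ = P σ / Q σ}
  mul_mem' := by
    rintro p p' ⟨P, Q, hP, hQ, h⟩ ⟨P', Q', hP', hQ', h'⟩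
    refine ⟨P * P', Q * Q', hP.mul hP', hQ.mul hQ', fun σ => ⟨mul_ne_zero (h σ).1 (h' σ).1, ?_⟩⟩
    rw [Pi.mul_apply, (h σ).2, (h' σ).2, div_mul_div_comm]
    rfl
  add_mem' := by
    rintro p p' ⟨P, Q, hP, hQ, h⟩ ⟨P', Q', hP', hQ', h'⟩
    refine ⟨P * Q' + Q * P', Q * Q', (hP.mul hQ').add (hQ.mul hP'), hQ.mul hQ',
      fun σ => ⟨mul_ne_zero (h σ).1 (h' σ).1, ?_⟩⟩
    rw [Pi.add_apply, (h σ).2, (h' σ).2, div_add_div _ _ (h σ).1 (h' σ).1]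
    rfl
  algebraMap_mem' c := ⟨fun _ => c, fun _ => 1, differentiable_const _, differentiable_const _,
    fun σ => ⟨one_ne_zero, by simp⟩⟩

theorem isCoeffAlg_meroAlg {Ω : Set (Fin N → ℂ)} {W : (Fin N → ℂ) → Fin N → ℂ}
    (hW : Differentiable ℂ W) (hΩ : ∀ z ∈ Ω, W z ∈ regular D N) {j k : Fin N} (hjk : j ≠ k) :
    IsCoeffAlg D (fun σ : Ω => W σ) (meroAlg Ω) j k := by
  have hd : Differentiable ℂ fun z => W z j - W z k :=
    (differentiable_pi.1 hW j).sub (differentiable_pi.1 hW k)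
  refine ⟨fun P hP => ⟨fun z => P (W z j - W z k), fun _ => 1, hP.comp hd,
    differentiable_const _, fun σ => ⟨one_ne_zero, by simp⟩⟩, fun m => ⟨fun _ => 1,
    fun z => D.th 1 1 (W z j - W z k + m * D.η), differentiable_const _,
    (D.differentiable_th 1 1).comp (hd.add_const _), fun σ => ⟨?_, by simp⟩⟩⟩
  exact (hΩ σ σ.2 m).2 j k hjk

theorem differentiable_shift (j : Fin N) : Differentiable ℂ (shift D j) := by
  refine differentiable_pi.2 fun i => ?_
  by_cases h : i = j
  · subst h
    simpa only [shift_self] using (differentiable_apply i).add_const _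
  · simpa only [shift_of_ne h] using differentiable_apply i

theorem exists_coeff_of_mem_chainSpan (hr : 0 < D.r) {S : Type*} {𝓜 : Subalgebra ℂ (S → ℂ)}
    {w : S → Fin N → ℂ} {π : Equiv.Perm (Fin N)} {X : S → FunSpace D n}
    (hX : X ∈ chainSpan D n 𝓜 w (List.ofFn π.symm)) :
    ∃ q : ClosedPath D n π → S → ℂ, (∀ b, q b ∈ 𝓜) ∧
      ∀ σ, X σ = ∑ b, q b σ • pathFun D n π (w σ) b.1 := by
  classical
  induction hX using Submodule.span_induction with
  | mem X h =>
    obtain ⟨p, hp, a, g, hg, rfl⟩ := h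
    obtain ⟨b, -, hb⟩ := exists_closedPath_gfun hr hg
    refine ⟨Pi.single b p, fun b' => ?_, fun σ => ?_⟩
    · by_cases h : b' = b
      · subst h; simpa using hp
      · rw [Pi.single_eq_of_ne h]; exact 𝓜.zero_mem
    · rw [Finset.sum_eq_single b, Pi.single_eq_same, hb]
      · intro b' _ h
        rw [Pi.single_eq_of_ne h, Pi.zero_apply, zero_smul]
      · simp
  | zero => exact ⟨0, fun b => 𝓜.zero_mem, fun σ => by simp⟩
  | add X Y _ _ hX hY =>
    obtain ⟨q, hq, e⟩ := hX
    obtain ⟨q', hq', e'⟩ := hY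
    refine ⟨q + q', fun b => 𝓜.add_mem (hq b) (hq' b), fun σ => ?_⟩
    simp only [Pi.add_apply, add_smul, Finset.sum_add_distrib, e, e']
  | smul c X _ hX =>
    obtain ⟨q, hq, e⟩ := hX
    refine ⟨c • q, fun b => 𝓜.smul_mem (hq b) c, fun σ => ?_⟩
    simp only [Pi.smul_apply, e, Finset.smul_sum, smul_smul, smul_eq_mul]

/-- The points at which the coefficients of the equation with label `j` are considered. -/
def eqDomain (D : Params) (j : Fin N) : Set (Fin N → ℂ) :=
  {z | z ∈ regular D N ∧ shift D j z ∈ regular D N}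

/-- Here `z` itself is the family parameter. The first row takes its coefficients from differences
of `z`, the second from differences of the shifted point; regularity of both keeps the denominators
nonzero, and rotation contributes only constants. -/
theorem opA_pathFun_mem_chainSpan (hr : 0 < D.r) (hcop : IsCoprime D.r' (D.r : ℤ))
    (hη : D.th 1 1 (2 * D.η) ≠ 0) (hlam : ∀ a : ℤ, D.th 1 1 (D.height a) ≠ 0) (j : Fin N)
    (a : ClosedPath D n 1) :
    (fun σ : eqDomain D j => opA D n j σ (pathFun D n 1 σ a.1)) ∈
      chainSpan D n (meroAlg (eqDomain D j)) (fun σ => shift D j σ)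
        (List.ofFn (Equiv.symm (1 : Equiv.Perm (Fin N)))) := by
  have hl : Full (ltL j ++ j :: (gtL j ++ [])) := by
    rw [List.append_nil, ← finRange_eq]; exact full_finRange
  have hl₃ : Full ([] ++ j :: (ltL j ++ gtL j)) :=
    (full_lastOrder j).perm (List.perm_append_singleton _ _)
  have h₀ : (fun σ : eqDomain D j => pathFun D n 1 σ a.1) ∈ chainSpan D n (meroAlg (eqDomain D j))
      (fun σ => (σ : Fin N → ℂ)) (ltL j ++ j :: (gtL j ++ [])) := by
    rw [List.append_nil, ← finRange_eq, ← ofFn_one]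
    refine Submodule.subset_span ⟨1, Subalgebra.one_mem _, _, _, a.chain, ?_⟩
    funext σ
    rw [Pi.one_apply, one_smul]
    rfl
  have h₁ := gridRow_chainSpan hη hlam (fun k hk => isCoeffAlg_meroAlg (W := id) differentiable_id
    (fun z hz => hz.1) (mem_gtL.1 hk).ne) hl h₀
  rw [← List.append_assoc] at h₁
  have h₂ := IsB.mem_chainSpan
    (fun σ : eqDomain D j => isB_boundary (n := n) hr hcop hη hlam σ.2.1 j) h₁
  have h₃ := gridRow_chainSpan hη hlam (fun k hk => isCoeffAlg_meroAlg (differentiable_shift j)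
    (fun z hz => hz.2) (mem_ltL.1 hk).ne') hl₃ h₂
  rw [List.nil_append, ← finRange_eq] at h₃
  rw [ofFn_one]
  simp only [opA_eq]
  exact h₃

theorem exists_coeffMatrix (hr : 0 < D.r) (hcop : IsCoprime D.r' (D.r : ℤ))
    (hη : D.th 1 1 (2 * D.η) ≠ 0) (hlam : ∀ a : ℤ, D.th 1 1 (D.height a) ≠ 0) (j : Fin N) :
    ∃ M : (Fin N → ℂ) → Matrix (ClosedPath D n 1) (ClosedPath D n 1) ℂ,
      (∀ b a, ∃ P Q : (Fin N → ℂ) → ℂ, Differentiable ℂ P ∧ Differentiable ℂ Q ∧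
        ∀ z ∈ regular D N, shift D j z ∈ regular D N → Q z ≠ 0 ∧ M z b a = P z / Q z) ∧
      ∀ z ∈ regular D N, shift D j z ∈ regular D N → ∀ x,
        opA D n j z (irf D n z x) = irf D n (shift D j z) ((M z).mulVec x) := by
  classical
  choose q hq hqe using fun a => exists_coeff_of_mem_chainSpan hr
    (opA_pathFun_mem_chainSpan (n := n) hr hcop hη hlam j a)
  choose P Q hP hQ hPQ using hq
  -- Off the admissible points the value of the quotient is irrelevant; nothing is claimed about it
  -- there.
  refine ⟨fun z b a => P a b z / Q a b z, fun b a => ⟨P a b, Q a b, hP a b, hQ a b,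
    fun z hz hz' => ⟨(hPQ a b ⟨z, hz, hz'⟩).1, rfl⟩⟩, fun z hz hz' x => ?_⟩
  simp only [irf, map_sum, map_smul, Matrix.mulVec, dotProduct, Finset.sum_smul]
  rw [Finset.sum_comm]
  refine Finset.sum_congr rfl fun a _ => ?_
  rw [hqe a ⟨z, hz, hz'⟩, Finset.smul_sum]
  refine Finset.sum_congr rfl fun b _ => ?_
  rw [smul_smul, (hPQ a b ⟨z, hz, hz'⟩).2, mul_comm]

theorem irf_injective (hr : 0 < D.r) (hcop : IsCoprime D.r' (D.r : ℤ))
    (hη : D.th 1 1 (2 * D.η) ≠ 0) (hlam : ∀ a : ℤ, D.th 1 1 (D.height a) ≠ 0)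
    {z : Fin N → ℂ} (hz : z ∈ regular D N) : Function.Injective (irf D n z) := fun x y h =>
  funext (Fintype.linearIndependent_iffₛ.1
    (linearIndependent_pathFun hr hcop hη hlam hz 1) x y h)

theorem bethe_one (hr : 0 < D.r) (z : Fin N → ℂ) :
    bethe D n 1 z = chainSpace D n (List.finRange N) z := by
  rw [bethe_eq_chainSpace hr, ofFn_one]

theorem irf_mem_bethe (z : Fin N → ℂ) (x : ClosedPath D n 1 → ℂ) :
    irf D n z x ∈ bethe D n 1 z :=
  Submodule.sum_mem _ fun a _ => Submodule.smul_mem _ _ (Submodule.subset_span ⟨a, rfl⟩)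

end Mero

end EllipticQKZ

end

/-! ### The proposition: passage from the operators to matrices in the basis of path functions -/

open EllipticQKZ

theorem mainTheorem1 (D : EllipticQKZ.Params) {N : ℕ} (n : Fin N → ℕ)
    (hr : 0 < D.r) (hcop : IsCoprime D.r' (D.r : ℤ))
    (hη : D.th 1 1 (2 * D.η) ≠ 0)
    (hlam : ∀ a : ℤ, D.th 1 1 (D.height a) ≠ 0) :
    -- the boundary operator is well defined
    (∀ j, ∀ z ∈ EllipticQKZ.regular D N,
      EllipticQKZ.IsBoundary D n j z (EllipticQKZ.boundary D n j z)) ∧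
    -- `A_j(z)` maps the Bethe vectors at `z` isomorphically to the Bethe vectors at `z_j`
    (∀ j, ∀ z ∈ EllipticQKZ.regular D N, EllipticQKZ.shift D j z ∈ EllipticQKZ.regular D N →
      Set.BijOn (EllipticQKZ.opA D n j z) (EllipticQKZ.bethe D n 1 z)
        (EllipticQKZ.bethe D n 1 (EllipticQKZ.shift D j z))) ∧
    -- compatibility
    (∀ j k, ∀ z ∈ EllipticQKZ.regular D N,
      EllipticQKZ.shift D j z ∈ EllipticQKZ.regular D N →
      EllipticQKZ.shift D k z ∈ EllipticQKZ.regular D N →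
      EllipticQKZ.shift D j (EllipticQKZ.shift D k z) ∈ EllipticQKZ.regular D N →
      ∀ f ∈ EllipticQKZ.bethe D n 1 z,
        EllipticQKZ.opA D n j (EllipticQKZ.shift D k z) (EllipticQKZ.opA D n k z f) =
          EllipticQKZ.opA D n k (EllipticQKZ.shift D j z) (EllipticQKZ.opA D n j z f)) ∧
    -- the path vectors form a basis of the space of Bethe vectors, and in these coordinates the
    -- system `f(z_j) = A_j(z) f(z)` is a holonomic matrix difference system
    (∀ z ∈ EllipticQKZ.regular D N, LinearIndependent ℂ
      fun a : EllipticQKZ.ClosedPath D n 1 => EllipticQKZ.pathFun D n 1 z a.1) ∧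
    ∃ M : Fin N → (Fin N → ℂ) →
        Matrix (EllipticQKZ.ClosedPath D n 1) (EllipticQKZ.ClosedPath D n 1) ℂ,
      (∀ j, ∀ z ∈ EllipticQKZ.regular D N, EllipticQKZ.shift D j z ∈ EllipticQKZ.regular D N →
        ∀ x x' : EllipticQKZ.ClosedPath D n 1 → ℂ,
          EllipticQKZ.irf D n (EllipticQKZ.shift D j z) x' =
              EllipticQKZ.opA D n j z (EllipticQKZ.irf D n z x) ↔
            x' = (M j z).mulVec x) ∧
      EllipticQKZ.IsHolonomic D (EllipticQKZ.regular D N) M := by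
  choose M hmero hM using exists_coeffMatrix (D := D) (n := n) hr hcop hη hlam
  have hbij : ∀ j, ∀ z ∈ regular D N, shift D j z ∈ regular D N →
      Set.BijOn (opA D n j z) (bethe D n 1 z) (bethe D n 1 (shift D j z)) :=
    fun j z hz hz' => by
      rw [bethe_one hr, bethe_one hr]
      exact opA_bijOn hr hcop hη hlam hz hz'
  have hcomm : ∀ j k, ∀ z ∈ regular D N, shift D j z ∈ regular D N →
      shift D k z ∈ regular D N → shift D j (shift D k z) ∈ regular D N →
      ∀ f ∈ bethe D n 1 z, opA D n j (shift D k z) (opA D n k z f) =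
        opA D n k (shift D j z) (opA D n j z f) := fun j k z hz hj hk hjk f hf => by
    rw [bethe_one hr] at hf
    exact opA_comm hr hcop hη hlam hz hj hk hjk hf
  refine ⟨fun j z hz => isBoundary_boundary hr hcop hη hlam hz j, hbij, hcomm,
    fun z hz => linearIndependent_pathFun hr hcop hη hlam hz 1, M, fun j z hz hz' x x' => ?_,
    hmero, fun j z hz hz' => ?_, fun j k z hz hj hk hjk => ?_⟩
  · rw [hM j z hz hz']
    exact (irf_injective hr hcop hη hlam hz').eq_iff
  -- For a finite square matrix injectivity is enough; it follows from that of `A_j` on the Bethe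
  -- vectors and from independence at `z`.
  · refine Matrix.mulVec_injective_iff_isUnit.1 fun x y h => ?_
    refine irf_injective hr hcop hη hlam hz ((hbij j z hz hz').injOn (irf_mem_bethe z x)
      (irf_mem_bethe z y) ?_)
    rw [hM j z hz hz', hM j z hz hz', h]
  -- Both matrix products give coordinates of one Bethe vector at the doubly shifted point, where
  -- coordinates are unique.
  · refine Matrix.mulVec_injective (funext fun x => irf_injective hr hcop hη hlam hjk ?_)
    have hkj := hjk
    rw [shift_comm] at hkj
    have := hcomm j k z hz hj hk hjk _ (irf_mem_bethe z x)
    rw [hM k z hz hk, hM j z hz hj, hM j _ hk hjk, hM k _ hj hkj, shift_comm k j] at this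
    rw [← Matrix.mulVec_mulVec, ← Matrix.mulVec_mulVec]
    exact this
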